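/- Let $\mathcal{F}^\omega[\mathbb{P}]$ be the following formal system over the finite types generated from the ground types $0$ (natural numbers), $\Omega$ (points) and $S$ (events), where $\tau(\rho)$ is the type of functionals from $\rho$ to $\tau$ and $1:=0(0)$. It consists of weakly extensional classical Peano arithmetic in all finite types (equality of type $0$ is the only primitive relation; higher type equality is defined pointwise; there are combinators and simultaneous primitive recursors in all types, full induction, and the quantifier-free extensionality rule), the schemata of quantifier-free choice and of dependent choice for tuples of all types, constants $\mathrm{eq}$, $\in$, $\cup$, $(\cdot)^c$, $\emptyset$, $c_\Omega$ with the universal axioms stating that $\mathrm{eq}$ is an equivalence relation on $\Omega$ and that $\in$, $\cup$, $(\cdot)^c$, $\emptyset$ behave as membership, union, complement and empty set (events being equal if they have the same elements), and a constant $\mathbb{P}$ of type $1(S)$ with axioms stating $0\le\mathbb{P}(A)\le1$, $\mathbb{P}(\emptyset)=0$, $\mathbb{P}(A\cup B)=\mathbb{P}(A)+\mathbb{P}(B)-\mathbb{P}(A\cap B)$, and that $\mathbb{P}(A)>\mathbb{P}(B)$ implies that some $x$ satisfies $x\in A$ and $x\notin B$. Real numbers are represented by objects of type $1$ coding rational Cauchy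 sequences $(q_n)$ with $|q_n-q_{n+1}|<2^{-n-1}$; finite unions and intersections of events are defined by recursion, and $\bigcup_{j=m}^{k}A(j)=\emptyset$ if $k<m$. \textbf{Theorem.} (1) The system $\mathcal{F}^\omega[\mathbb{P}]$ proves \[ \forall A^{S(0)}, M^{0(1)}, u^0, v^0>_0 u\ \exists n^0\left(\forall F^1\left(\mathbb{P}\left(\bigcap_{m = 0}^{M(F)}\bigcup_{j = m}^{F(m)}A(j)\right) \le_{\mathbb{R}} 2^{-v} \right)\to\mathbb{P}(A(n)) <_{\mathbb{R}} 2^{-u}\right). \] (2) For every set $\Omega$, every algebra $S\subseteq 2^\Omega$, every finitely additive $\mathbb{P}:S\to[0,\infty]$ with $\mathbb{P}(\Omega)=1$, every sequence $(A_j)_{j\in\mathbb{N}}$ in $S$, every $M:\mathbb{N}^{\mathbb{N}}\to\mathbb{N}$ and all natural numbers $u<v$, there is an $n\in\mathbb{N}$ such that \[ \mathbb{P}\left(\bigcap_{m = 0}^{M(F)}\bigcup_{j = m}^{F(m)}A_j\right) \le 2^{-v}\ \text{ for all } F:\mathbb{N}\to\mathbb{N}\quad\text{implies}\quad \mathbb{P}(A_n)<2^{-u}.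 \] (3) For $f,g:\mathbb{N}\to\mathbb{N}$ write $g\gtrsim_1 f$ if $g(n)\ge f(m)$ and $g(n)\ge g(m)$ for all $m\le n$; for $Y,M:\mathbb{N}^{\mathbb{N}}\to\mathbb{N}$ write $Y\gtrsim_2 M$ if $Y(g)\ge M(f)$ and $Y(g)\ge Y(f)$ whenever $g\gtrsim_1 f$. There is a partial functional $\Phi(Y,u,v)$ of $Y:\mathbb{N}^{\mathbb{N}}\to\mathbb{N}$ and $u,v\in\mathbb{N}$ with values in $\mathbb{N}$, computable in the sense of Kleene's schemes S1--S9, which is defined for all $u,v$ and all $Y$ that are strongly majorizable (i.e.\ $Z\gtrsim_2 Y$ for some $Z$), and such that for all $\Omega$, $S$, $\mathbb{P}$, $(A_j)$, $M$ and $u<v$ as in (2) and every $Y\gtrsim_2 M$, an $n$ as in (2) exists with $n\le\Phi(Y,u,v)$. In particular, the bound depends only on $u$, $v$ and a majorant of $M$, and not on the space, the content or the events. -/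

import Mathlib

namespace ProofMining

/-! ### The formal system: types, terms and formulas -/

/-- The finite types over the ground types `0` (natural numbers), `Ω` (points) and `S` (events);
`arr σ τ` is the type of functionals taking arguments of type `σ` to values of type `τ`. -/
inductive Ty : Type
  | nat : Ty
  | pt : Ty
  | ev : Ty
  | arr : Ty → Ty → Ty

local infixr:60 " ⇒ " => Ty.arr

/-- The type `1` of functions from numbers to numbers, also used for codes of real numbers. -/
abbrev Ty.one : Ty := Ty.nat ⇒ Ty.nat

/-- `arrs [ρ₁, …, ρₖ] τ` is the type of functionals with successive arguments of types
`ρ₁, …, ρₖ` and values of type `τ`. -/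
def arrs : List Ty → Ty → Ty
  | [], τ => τ
  | ρ :: ρs, τ => ρ ⇒ arrs ρs τ

/-- Typed variables (de Bruijn indices): positions of the type `τ` in a context. -/
inductive Var : List Ty → Ty → Type
  | here {Γ : List Ty} {τ : Ty} : Var (τ :: Γ) τ
  | there {Γ : List Ty} {σ τ : Ty} : Var Γ τ → Var (σ :: Γ) τ

namespace Var

def map (f : Ty → Ty) {Γ : List Ty} {τ : Ty} : Var Γ τ → Var (Γ.map f) (f τ)
  | here => here
  | there x => there (map f x)

def inl {Γ Δ : List Ty} {τ : Ty} : Var Γ τ → Var (Γ ++ Δ) τ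
  | here => here
  | there x => there (inl x)

def inr {Δ : List Ty} {τ : Ty} : (Γ : List Ty) → Var Δ τ → Var (Γ ++ Δ) τ
  | [], x => x
  | _ :: Γ, x => there (inr Γ x)

end Var

/-- The types of the step functionals of simultaneous recursion into the types `ρs`. -/
def stepTys (ρs : List Ty) : List Ty := ρs.map (fun ρ => arrs ρs (Ty.nat ⇒ ρ))

/-- The constants of the language: zero, successor, the combinators `Π` and `Σ`, the recursors
for simultaneous primitive recursion in all finite types, and the constants for algebras of sets
and for the content. -/
inductive Const : Ty → Type
  | zero : Const Ty.nat
  | succ : Const (Ty.nat ⇒ Ty.nat)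
  | proj (σ τ : Ty) : Const (σ ⇒ τ ⇒ σ)
  | dist (δ ρ τ : Ty) : Const ((δ ⇒ ρ ⇒ τ) ⇒ (δ ⇒ ρ) ⇒ δ ⇒ τ)
  | recur (ρs : List Ty) {ρ : Ty} (i : Var ρs ρ) :
      Const (Ty.nat ⇒ arrs ρs (arrs (stepTys ρs) ρ))
  | eqPt : Const (Ty.pt ⇒ Ty.pt ⇒ Ty.nat)
  | mem : Const (Ty.pt ⇒ Ty.ev ⇒ Ty.nat)
  | union : Const (Ty.ev ⇒ Ty.ev ⇒ Ty.ev)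
  | compl : Const (Ty.ev ⇒ Ty.ev)
  | empty : Const Ty.ev
  | point : Const Ty.pt
  | prob : Const (Ty.ev ⇒ Ty.one)

/-- Terms with free variables from the context `Γ`. -/
inductive Term (Γ : List Ty) : Ty → Type
  | var {τ : Ty} : Var Γ τ → Term Γ τ
  | const {τ : Ty} : Const τ → Term Γ τ
  | app {σ τ : Ty} : Term Γ (σ ⇒ τ) → Term Γ σ → Term Γ τ

/-- Formulas with free variables from `Γ`; the only primitive relation is equality at type `0`. -/
inductive Formula : List Ty → Type
  | eq {Γ : List Ty} : Term Γ Ty.nat → Term Γ Ty.nat → Formula Γ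
  | falsum {Γ : List Ty} : Formula Γ
  | and {Γ : List Ty} : Formula Γ → Formula Γ → Formula Γ
  | or {Γ : List Ty} : Formula Γ → Formula Γ → Formula Γ
  | imp {Γ : List Ty} : Formula Γ → Formula Γ → Formula Γ
  | all {Γ : List Ty} (σ : Ty) : Formula (σ :: Γ) → Formula Γ
  | ex {Γ : List Ty} (σ : Ty) : Formula (σ :: Γ) → Formula Γ

/-- Simultaneous substitutions of terms over `Δ` for the variables of `Γ`. -/
abbrev Sub (Γ Δ : List Ty) : Type := ∀ τ : Ty, Var Γ τ → Term Δ τ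

namespace Term

def subst {Γ Δ : List Ty} (θ : Sub Γ Δ) : {τ : Ty} → Term Γ τ → Term Δ τ
  | _, var x => θ _ x
  | _, const c => const c
  | _, app s t => app (subst θ s) (subst θ t)

/-- Weakening by one fresh variable. -/
def wk {Γ : List Ty} {σ τ : Ty} (t : Term Γ τ) : Term (σ :: Γ) τ :=
  t.subst (fun _ x => var (Var.there x))

end Term

namespace Sub

/-- Substitution under a binder. -/
def lift {Γ Δ : List Ty} {σ : Ty} (θ : Sub Γ Δ) : Sub (σ :: Γ) (σ :: Δ)
  | _, Var.here => Term.var Var.here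
  | _, Var.there x => (θ _ x).wk

/-- The extension of a substitution by a term for one further variable. -/
def cons {Γ Δ : List Ty} {σ : Ty} (t : Term Δ σ) (θ : Sub Γ Δ) : Sub (σ :: Γ) Δ
  | _, Var.here => t
  | _, Var.there x => θ _ x

/-- Substitution of a single term for the last variable. -/
def single {Γ : List Ty} {σ : Ty} (t : Term Γ σ) : Sub (σ :: Γ) Γ :=
  cons t (fun _ x => Term.var x)

/-- Replacement of the last variable by its successor. -/
def shift {Γ : List Ty} : Sub (Ty.nat :: Γ) (Ty.nat :: Γ) :=
  cons (Term.app (Term.const Const.succ) (Term.var Var.here)) (fun _ x => Term.var (Var.there x))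

def append {Δ Θ : List Ty} : {Γ : List Ty} → Sub Γ Θ → Sub Δ Θ → Sub (Γ ++ Δ) Θ
  | [], _, β, _, x => β _ x
  | _ :: _, α, _, _, Var.here => α _ Var.here
  | _ :: _, α, β, _, Var.there x => append (fun _ y => α _ (Var.there y)) β _ x

end Sub

namespace Formula

def subst : {Γ Δ : List Ty} → Sub Γ Δ → Formula Γ → Formula Δ
  | _, _, θ, eq s t => eq (s.subst θ) (t.subst θ)
  | _, _, _, falsum => falsum
  | _, _, θ, and φ ψ => and (subst θ φ) (subst θ ψ)
  | _, _, θ, or φ ψ => or (subst θ φ) (subst θ ψ)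
  | _, _, θ, imp φ ψ => imp (subst θ φ) (subst θ ψ)
  | _, _, θ, all σ φ => all σ (subst θ.lift φ)
  | _, _, θ, ex σ φ => ex σ (subst θ.lift φ)

def wk {Γ : List Ty} {σ : Ty} (φ : Formula Γ) : Formula (σ :: Γ) :=
  φ.subst (fun _ x => Term.var (Var.there x))

/-- Instantiation of the last variable. -/
def inst {Γ : List Ty} {σ : Ty} (φ : Formula (σ :: Γ)) (t : Term Γ σ) : Formula Γ :=
  φ.subst (Sub.single t)

def neg {Γ : List Ty} (φ : Formula Γ) : Formula Γ := imp φ falsum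

def iff {Γ : List Ty} (φ ψ : Formula Γ) : Formula Γ := and (imp φ ψ) (imp ψ φ)

/-- Universal quantification over a tuple of variables. -/
def allN {Γ : List Ty} : (σs : List Ty) → Formula (σs ++ Γ) → Formula Γ
  | [], φ => φ
  | σ :: σs, φ => allN σs (all σ φ)

/-- Existential quantification over a tuple of variables. -/
def exN {Γ : List Ty} : (σs : List Ty) → Formula (σs ++ Γ) → Formula Γ
  | [], φ => φ
  | σ :: σs, φ => exN σs (ex σ φ)

/-- Quantifier-free formulas. -/
def IsQF : {Γ : List Ty} → Formula Γ → Prop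
  | _, eq _ _ => True
  | _, falsum => True
  | _, and φ ψ => IsQF φ ∧ IsQF ψ
  | _, or φ ψ => IsQF φ ∧ IsQF ψ
  | _, imp φ ψ => IsQF φ ∧ IsQF ψ
  | _, all _ _ => False
  | _, ex _ _ => False

end Formula

namespace Term

/-- Application to a tuple of arguments. -/
def appN {Γ : List Ty} {τ : Ty} : (ρs : List Ty) → Term Γ (arrs ρs τ) → Sub ρs Γ → Term Γ τ
  | [], t, _ => t
  | _ :: ρs, t, a => appN ρs (app t (a _ Var.here)) (fun _ x => a _ (Var.there x))

/-- `λ`-abstraction of a variable, defined from the combinators. -/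
def lamVar {Γ : List Ty} {σ : Ty} : {τ : Ty} → Var (σ :: Γ) τ → Term Γ (σ ⇒ τ)
  | _, Var.here => app (app (const (Const.dist σ (σ ⇒ σ) σ)) (const (Const.proj σ (σ ⇒ σ))))
      (const (Const.proj σ σ))
  | _, Var.there x => app (const (Const.proj _ σ)) (var x)

/-- `λ`-abstraction, defined from the combinators. -/
def lam {Γ : List Ty} {σ : Ty} : {τ : Ty} → Term (σ :: Γ) τ → Term Γ (σ ⇒ τ)
  | _, var x => lamVar x
  | _, const c => app (const (Const.proj _ σ)) (const c)
  | _, app s t => app (app (const (Const.dist σ _ _)) (lam s)) (lam t)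

section
variable {Γ : List Ty}

abbrev v0 {a : Ty} : Term (a :: Γ) a := var Var.here
abbrev v1 {a b : Ty} : Term (a :: b :: Γ) b := var (Var.there Var.here)
abbrev v2 {a b c : Ty} : Term (a :: b :: c :: Γ) c := var (Var.there (Var.there Var.here))
abbrev v3 {a b c d : Ty} : Term (a :: b :: c :: d :: Γ) d :=
  var (Var.there (Var.there (Var.there Var.here)))
abbrev v4 {a b c d e : Ty} : Term (a :: b :: c :: d :: e :: Γ) e :=
  var (Var.there (Var.there (Var.there (Var.there Var.here))))

/-! ### Primitive recursive arithmetic -/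

def zero : Term Γ Ty.nat := const Const.zero
def succ (t : Term Γ Ty.nat) : Term Γ Ty.nat := app (const Const.succ) t
def one : Term Γ Ty.nat := succ zero
def two : Term Γ Ty.nat := succ one
def three : Term Γ Ty.nat := succ two

/-- Recursion into a single type: `recT 0 a f = a` and `recT (n + 1) a f = f (recT n a f) n`. -/
def recT {ρ : Ty} (n : Term Γ Ty.nat) (a : Term Γ ρ) (f : Term Γ (ρ ⇒ Ty.nat ⇒ ρ)) : Term Γ ρ :=
  app (app (app (const (Const.recur [ρ] Var.here)) n) a) f

/-- `a` if `c = 0`, and `b` otherwise. -/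
def caseZero {ρ : Ty} (c : Term Γ Ty.nat) (a b : Term Γ ρ) : Term Γ ρ :=
  recT c a (lam (lam b.wk.wk))

def add (s t : Term Γ Ty.nat) : Term Γ Ty.nat := recT t s (lam (lam (succ v1)))
def pred (t : Term Γ Ty.nat) : Term Γ Ty.nat := recT t zero (lam (lam v0))
/-- Truncated subtraction. -/
def sub (s t : Term Γ Ty.nat) : Term Γ Ty.nat := recT t s (lam (lam (pred v1)))
def mul (s t : Term Γ Ty.nat) : Term Γ Ty.nat := recT t zero (lam (lam (add v1 s.wk.wk)))
/-- `2 ^ t`. -/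
def pow2 (t : Term Γ Ty.nat) : Term Γ Ty.nat := recT t one (lam (lam (add v1 v1)))
/-- `t mod 2`. -/
def parity (t : Term Γ Ty.nat) : Term Γ Ty.nat := recT t zero (lam (lam (sub one v1)))
/-- `⌊t / 2⌋`. -/
def half (t : Term Γ Ty.nat) : Term Γ Ty.nat := recT t zero (lam (lam (add v1 (parity v0))))
/-- `|s - t|`. -/
def dist (s t : Term Γ Ty.nat) : Term Γ Ty.nat := add (sub s t) (sub t s)

/-- The least `k < n` with `f k = 0` if there is one, and `n` otherwise. -/
def least (f : Term Γ Ty.one) (n : Term Γ Ty.nat) : Term Γ Ty.nat :=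
  recT n zero (lam (lam (caseZero (app f.wk.wk v1) v1 (succ v0))))

/-- The least `k ≤ n` with `f k = 0` if there is one, and `0` otherwise. -/
def bmin (f : Term Γ Ty.one) (n : Term Γ Ty.nat) : Term Γ Ty.nat :=
  caseZero (app f (least f n)) (least f n) zero

/-- `(n + m)² + 3 n + m`. -/
def pairBound (n m : Term Γ Ty.nat) : Term Γ Ty.nat :=
  add (add (mul (add n m) (add n m)) (mul three n)) m

/-- The pairing function `j(n, m) = min u ≤ (n + m)² + 3 n + m [2 u = (n + m)² + 3 n + m]`. -/
def pair (n m : Term Γ Ty.nat) : Term Γ Ty.nat :=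
  bmin (lam (dist (mul two v0) (pairBound n m).wk)) (pairBound n m)

/-- The first component of a pair: the least `x ≤ z` with `∃ y ≤ z, j(x, y) = z`. -/
def fst (z : Term Γ Ty.nat) : Term Γ Ty.nat :=
  bmin (lam (dist (pair v0 (bmin (lam (dist (pair v1 v0) z.wk.wk)) z.wk)) z.wk)) z

/-- The second component of a pair: the least `y ≤ z` with `j(fst z, y) = z`. -/
def snd (z : Term Γ Ty.nat) : Term Γ Ty.nat :=
  bmin (lam (dist (pair (fst z).wk v0) z.wk)) z

/-! ### Codes of rational numbers: `j(2 k, m)` codes `k / (m + 1)`, and `j(2 k - 1, m)` with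
`k ≥ 1` codes `- k / (m + 1)`. -/

/-- The numerator of the positive part. -/
def numPos (q : Term Γ Ty.nat) : Term Γ Ty.nat := caseZero (parity (fst q)) (half (fst q)) zero
/-- The numerator of the negative part. -/
def numNeg (q : Term Γ Ty.nat) : Term Γ Ty.nat := caseZero (parity (fst q)) zero (half (succ (fst q)))
/-- The denominator. -/
def den (q : Term Γ Ty.nat) : Term Γ Ty.nat := succ (snd q)

/-- The code of `(a - b) / d` for `d ≥ 1`. -/
def qMk (a b d : Term Γ Ty.nat) : Term Γ Ty.nat :=
  pair (add (mul two (sub a b)) (pred (mul two (sub b a)))) (pred d)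

def qAdd (q r : Term Γ Ty.nat) : Term Γ Ty.nat :=
  qMk (add (mul (numPos q) (den r)) (mul (numPos r) (den q)))
    (add (mul (numNeg q) (den r)) (mul (numNeg r) (den q))) (mul (den q) (den r))
def qNeg (q : Term Γ Ty.nat) : Term Γ Ty.nat := qMk (numNeg q) (numPos q) (den q)
def qSub (q r : Term Γ Ty.nat) : Term Γ Ty.nat := qAdd q (qNeg r)
def qAbs (q : Term Γ Ty.nat) : Term Γ Ty.nat := qMk (add (numPos q) (numNeg q)) zero (den q)
/-- The rational `2 ^ (-k)`. -/
def qPow (k : Term Γ Ty.nat) : Term Γ Ty.nat := pair two (pred (pow2 k))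
/-- The two sides `(s, t)`, brought to a common denominator, of a comparison of rationals. -/
def qCross (q r : Term Γ Ty.nat) : Term Γ Ty.nat :=
  add (mul (numPos q) (den r)) (mul (numNeg r) (den q))
/-- `qLeChar q r = 0` if and only if `q ≤ r` as rationals. -/
def qLeChar (q r : Term Γ Ty.nat) : Term Γ Ty.nat := sub (qCross q r) (qCross r q)

/-! ### Codes of real numbers: rational sequences with `|x k - x (k + 1)| < 2 ^ (-k-1)` -/

/-- The value at `n` of the sequence `x̂`: `x n` if `|x k - x (k + 1)| < 2 ^ (-k-1)` for all
`k < n`, and otherwise `x k` for the least `k < n` for which this fails. -/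
def hatAt (x : Term Γ Ty.one) (n : Term Γ Ty.nat) : Term Γ Ty.nat :=
  app x (least (lam (qLeChar (qPow (succ v0)) (qAbs (qSub (app x.wk v0) (app x.wk (succ v0)))))) n)

def rAdd (x y : Term Γ Ty.one) : Term Γ Ty.one :=
  lam (qAdd (hatAt x.wk (succ v0)) (hatAt y.wk (succ v0)))
def rNeg (x : Term Γ Ty.one) : Term Γ Ty.one := lam (qNeg (hatAt x.wk v0))
def rSub (x y : Term Γ Ty.one) : Term Γ Ty.one := rAdd x (rNeg y)
/-- The constant sequence of a rational code. -/
def rOfQ (q : Term Γ Ty.nat) : Term Γ Ty.one := lam q.wk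
def rZero : Term Γ Ty.one := rOfQ (pair zero zero)
def rOne : Term Γ Ty.one := rOfQ (pair two zero)
/-- The real number `2 ^ (-k)`. -/
def rPow (k : Term Γ Ty.nat) : Term Γ Ty.one := rOfQ (qPow k)

/-! ### Events -/

def memT (x : Term Γ Ty.pt) (A : Term Γ Ty.ev) : Term Γ Ty.nat := app (app (const Const.mem) x) A
def eqPtT (x y : Term Γ Ty.pt) : Term Γ Ty.nat := app (app (const Const.eqPt) x) y
def union (A B : Term Γ Ty.ev) : Term Γ Ty.ev := app (app (const Const.union) A) B
def compl (A : Term Γ Ty.ev) : Term Γ Ty.ev := app (const Const.compl) A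
def empty : Term Γ Ty.ev := const Const.empty
def inter (A B : Term Γ Ty.ev) : Term Γ Ty.ev := compl (union (compl A) (compl B))
def prob (A : Term Γ Ty.ev) : Term Γ Ty.one := app (const Const.prob) A

/-- `⋃_{i = n}^{m} A i`, which is empty for `m < n`. -/
def bigUnion (A : Term Γ (Ty.nat ⇒ Ty.ev)) (n m : Term Γ Ty.nat) : Term Γ Ty.ev :=
  caseZero (sub n m)
    (recT (sub m n) (app A n) (lam (lam (union v1 (app A.wk.wk (succ (add n.wk.wk v0)))))))
    empty

/-- `⋂_{i = n}^{m} A i = (⋃_{i = n}^{m} (A i)ᶜ)ᶜ`. -/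
def bigInter (A : Term Γ (Ty.nat ⇒ Ty.ev)) (n m : Term Γ Ty.nat) : Term Γ Ty.ev :=
  compl (bigUnion (lam (compl (app A.wk v0))) n m)

end

end Term

namespace Formula

section
variable {Γ : List Ty}

/-- `s ≤ t` at type `0`. -/
def le (s t : Term Γ Ty.nat) : Formula Γ := eq (Term.sub s t) Term.zero
/-- `s < t` at type `0`. -/
def lt (s t : Term Γ Ty.nat) : Formula Γ := le (Term.succ s) t

/-- `q ≤ r` for codes of rationals. -/
def qLe (q r : Term Γ Ty.nat) : Formula Γ := le (Term.qCross q r) (Term.qCross r q)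
/-- `q < r` for codes of rationals. -/
def qLt (q r : Term Γ Ty.nat) : Formula Γ := lt (Term.qCross q r) (Term.qCross r q)

/-- `x = y` for codes of reals: `∀ n, |x̂ (n + 1) - ŷ (n + 1)| < 2 ^ (-n)`. -/
def rEq (x y : Term Γ Ty.one) : Formula Γ :=
  all Ty.nat (qLt (Term.qAbs (Term.qSub (Term.hatAt x.wk (Term.succ Term.v0))
    (Term.hatAt y.wk (Term.succ Term.v0)))) (Term.qPow Term.v0))
/-- `x < y` for codes of reals: `∃ n, 2 ^ (-n) ≤ ŷ (n + 1) - x̂ (n + 1)`. -/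
def rLt (x y : Term Γ Ty.one) : Formula Γ :=
  ex Ty.nat (qLe (Term.qPow Term.v0) (Term.qSub (Term.hatAt y.wk (Term.succ Term.v0))
    (Term.hatAt x.wk (Term.succ Term.v0))))
/-- `x ≤ y` for codes of reals: not `y < x`. -/
def rLe (x y : Term Γ Ty.one) : Formula Γ := neg (rLt y x)

/-- `x ∈ A`, that is, `∈ x A = 0`. -/
def mem (x : Term Γ Ty.pt) (A : Term Γ Ty.ev) : Formula Γ := eq (Term.memT x A) Term.zero
/-- `x = y` at type `Ω`, that is, `eq x y = 0`. -/
def eqPt (x y : Term Γ Ty.pt) : Formula Γ := eq (Term.eqPtT x y) Term.zero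

end

/-- Equality at all types: primitive at type `0`, given by `eq` at type `Ω`, by having the same
elements at type `S`, and pointwise at function types. -/
def eqT : (τ : Ty) → {Γ : List Ty} → Term Γ τ → Term Γ τ → Formula Γ
  | Ty.nat, _, s, t => eq s t
  | Ty.pt, _, s, t => eqPt s t
  | Ty.ev, _, s, t => all Ty.pt (iff (mem Term.v0 s.wk) (mem Term.v0 t.wk))
  | Ty.arr σ τ, _, s, t => all σ (eqT τ (Term.app s.wk Term.v0) (Term.app t.wk Term.v0))

end Formula

/-! ### The formal system: axioms and derivations -/

open Term Formula in
/-- The conclusion `∃ Y ∀ x A(x, Y x)` of quantifier-free choice, for tuples. -/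
def choiceMatrix {Γ : List Ty} (σs τs : List Ty) (φ : Formula (τs ++ (σs ++ Γ))) :
    Formula (σs ++ (τs.map (arrs σs) ++ Γ)) :=
  φ.subst (Sub.append
    (fun _ y => appN σs (var (Var.inr σs (Var.inl (y.map (arrs σs))))) (fun _ x => var (Var.inl x)))
    (Sub.append (fun _ x => var (Var.inl x))
      (fun _ x => var (Var.inr σs (Var.inr (τs.map (arrs σs)) x)))))

open Term Formula in
/-- The formula `A(x, f x, f (x + 1))` in the conclusion of dependent choice, for tuples. In `φ`
the variables are, from the innermost outwards, the tuples `z` and `y` and the number `x`. -/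
def depMatrix {Γ : List Ty} (ρs : List Ty) (φ : Formula (ρs ++ (ρs ++ (Ty.nat :: Γ)))) :
    Formula (Ty.nat :: (ρs.map (fun ρ => Ty.nat ⇒ ρ) ++ Γ)) :=
  φ.subst (Sub.append
    (fun _ z => app (var (Var.there (Var.inl (z.map (fun ρ => Ty.nat ⇒ ρ))))) (succ v0))
    (Sub.append
      (fun _ y => app (var (Var.there (Var.inl (y.map (fun ρ => Ty.nat ⇒ ρ))))) v0)
      (Sub.cons v0 (fun _ x => var (Var.there (Var.inr (ρs.map (fun ρ => Ty.nat ⇒ ρ)) x))))))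

open Term Formula in
/-- The non-logical axioms of the system `F^ω[P]`. -/
inductive Postulate : {Γ : List Ty} → Formula Γ → Prop
  -- equality and successor
  | refl {Γ : List Ty} (s : Term Γ Ty.nat) : Postulate (eq s s)
  | symm {Γ : List Ty} (s t : Term Γ Ty.nat) : Postulate (imp (eq s t) (eq t s))
  | trans {Γ : List Ty} (s t r : Term Γ Ty.nat) :
      Postulate (imp (and (eq s t) (eq t r)) (eq s r))
  | succ_ne_zero {Γ : List Ty} (s : Term Γ Ty.nat) : Postulate (neg (eq (succ s) zero))
  | succ_inj {Γ : List Ty} (s t : Term Γ Ty.nat) :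
      Postulate (imp (eq (succ s) (succ t)) (eq s t))
  -- induction, for arbitrary formulas
  | induction {Γ : List Ty} (φ : Formula (Ty.nat :: Γ)) :
      Postulate (imp (and (φ.inst zero) (all Ty.nat (imp φ (φ.subst Sub.shift)))) (all Ty.nat φ))
  -- combinators and simultaneous recursion
  | proj {Γ : List Ty} {σ τ : Ty} (x : Term Γ σ) (y : Term Γ τ) :
      Postulate (eqT σ (app (app (const (Const.proj σ τ)) x) y) x)
  | dist {Γ : List Ty} {δ ρ τ : Ty} (x : Term Γ (δ ⇒ ρ ⇒ τ)) (y : Term Γ (δ ⇒ ρ))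
      (z : Term Γ δ) :
      Postulate (eqT τ (app (app (app (const (Const.dist δ ρ τ)) x) y) z)
        (app (app x z) (app y z)))
  | recur_zero {Γ : List Ty} (ρs : List Ty) {ρ : Ty} (i : Var ρs ρ)
      (y : Sub ρs Γ) (z : Sub (stepTys ρs) Γ) :
      Postulate (eqT ρ
        (appN (stepTys ρs) (appN ρs (app (const (Const.recur ρs i)) zero) y) z) (y ρ i))
  | recur_succ {Γ : List Ty} (ρs : List Ty) {ρ : Ty} (i : Var ρs ρ) (x : Term Γ Ty.nat)
      (y : Sub ρs Γ) (z : Sub (stepTys ρs) Γ) :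
      Postulate (eqT ρ
        (appN (stepTys ρs) (appN ρs (app (const (Const.recur ρs i)) (succ x)) y) z)
        (app (appN ρs (z _ (i.map (fun ρ => arrs ρs (Ty.nat ⇒ ρ))))
          (fun _ k => appN (stepTys ρs) (appN ρs (app (const (Const.recur ρs k)) x) y) z)) x))
  -- quantifier-free choice and dependent choice, for tuples
  | qf_ac {Γ : List Ty} (σs τs : List Ty) (φ : Formula (τs ++ (σs ++ Γ))) (h : φ.IsQF) :
      Postulate (imp (allN σs (exN τs φ))
        (exN (τs.map (arrs σs)) (allN σs (choiceMatrix σs τs φ))))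
  | dc {Γ : List Ty} (ρs : List Ty) (φ : Formula (ρs ++ (ρs ++ (Ty.nat :: Γ)))) :
      Postulate (imp (all Ty.nat (allN ρs (exN ρs φ)))
        (exN (ρs.map (fun ρ => Ty.nat ⇒ ρ)) (all Ty.nat (depMatrix ρs φ))))
  -- algebras of sets
  | eqPt_le {Γ : List Ty} (x y : Term Γ Ty.pt) : Postulate (le (eqPtT x y) one)
  | eqPt_equiv {Γ : List Ty} (x y z : Term Γ Ty.pt) :
      Postulate (and (eqPt x x) (and (imp (eqPt x y) (eqPt y x))
        (imp (and (eqPt x y) (eqPt y z)) (eqPt x z))))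
  | mem_le {Γ : List Ty} (x : Term Γ Ty.pt) (A : Term Γ Ty.ev) : Postulate (le (memT x A) one)
  | mem_empty {Γ : List Ty} (x : Term Γ Ty.pt) : Postulate (neg (mem x empty))
  | mem_union {Γ : List Ty} (x : Term Γ Ty.pt) (A B : Term Γ Ty.ev) :
      Postulate (iff (mem x (union A B)) (or (mem x A) (mem x B)))
  | mem_compl {Γ : List Ty} (x : Term Γ Ty.pt) (A : Term Γ Ty.ev) :
      Postulate (iff (mem x (compl A)) (neg (mem x A)))
  -- probability contents
  | prob_bounds {Γ : List Ty} (A : Term Γ Ty.ev) :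
      Postulate (and (rLe rZero (prob A)) (rLe (prob A) rOne))
  | prob_empty {Γ : List Ty} : Postulate (Γ := Γ) (rEq (prob empty) rZero)
  | prob_union {Γ : List Ty} (A B : Term Γ Ty.ev) :
      Postulate (rEq (prob (union A B)) (rSub (rAdd (prob A) (prob B)) (prob (inter A B))))
  | prob_mono {Γ : List Ty} (A B : Term Γ Ty.ev) :
      Postulate (ex Ty.pt (imp (rLt (prob B.wk) (prob A.wk))
        (and (mem v0 A.wk) (neg (mem v0 B.wk)))))

/-- Derivability in `F^ω[P]` from open assumptions: classical natural deduction over the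
non-logical axioms, together with the quantifier-free extensionality rule, whose premise must be
derived without open assumptions. -/
inductive Derivable : {Γ : List Ty} → List (Formula Γ) → Formula Γ → Prop
  | ax {Γ : List Ty} {Δ : List (Formula Γ)} {φ : Formula Γ} : Postulate φ → Derivable Δ φ
  | hyp {Γ : List Ty} {Δ : List (Formula Γ)} {φ : Formula Γ} : φ ∈ Δ → Derivable Δ φ
  | andI {Γ : List Ty} {Δ : List (Formula Γ)} {φ ψ : Formula Γ} :
      Derivable Δ φ → Derivable Δ ψ → Derivable Δ (Formula.and φ ψ)
  | andL {Γ : List Ty} {Δ : List (Formula Γ)} {φ ψ : Formula Γ} :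
      Derivable Δ (Formula.and φ ψ) → Derivable Δ φ
  | andR {Γ : List Ty} {Δ : List (Formula Γ)} {φ ψ : Formula Γ} :
      Derivable Δ (Formula.and φ ψ) → Derivable Δ ψ
  | orL {Γ : List Ty} {Δ : List (Formula Γ)} {φ ψ : Formula Γ} :
      Derivable Δ φ → Derivable Δ (Formula.or φ ψ)
  | orR {Γ : List Ty} {Δ : List (Formula Γ)} {φ ψ : Formula Γ} :
      Derivable Δ ψ → Derivable Δ (Formula.or φ ψ)
  | orE {Γ : List Ty} {Δ : List (Formula Γ)} {φ ψ χ : Formula Γ} :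
      Derivable Δ (Formula.or φ ψ) → Derivable (φ :: Δ) χ → Derivable (ψ :: Δ) χ → Derivable Δ χ
  | impI {Γ : List Ty} {Δ : List (Formula Γ)} {φ ψ : Formula Γ} :
      Derivable (φ :: Δ) ψ → Derivable Δ (Formula.imp φ ψ)
  | impE {Γ : List Ty} {Δ : List (Formula Γ)} {φ ψ : Formula Γ} :
      Derivable Δ (Formula.imp φ ψ) → Derivable Δ φ → Derivable Δ ψ
  | raa {Γ : List Ty} {Δ : List (Formula Γ)} {φ : Formula Γ} :
      Derivable (φ.neg :: Δ) Formula.falsum → Derivable Δ φ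
  | allI {Γ : List Ty} {Δ : List (Formula Γ)} {σ : Ty} {φ : Formula (σ :: Γ)} :
      Derivable (Δ.map Formula.wk) φ → Derivable Δ (Formula.all σ φ)
  | allE {Γ : List Ty} {Δ : List (Formula Γ)} {σ : Ty} {φ : Formula (σ :: Γ)} (t : Term Γ σ) :
      Derivable Δ (Formula.all σ φ) → Derivable Δ (φ.inst t)
  | exI {Γ : List Ty} {Δ : List (Formula Γ)} {σ : Ty} {φ : Formula (σ :: Γ)} (t : Term Γ σ) :
      Derivable Δ (φ.inst t) → Derivable Δ (Formula.ex σ φ)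
  | exE {Γ : List Ty} {Δ : List (Formula Γ)} {σ : Ty} {φ : Formula (σ :: Γ)} {ψ : Formula Γ} :
      Derivable Δ (Formula.ex σ φ) → Derivable (φ :: Δ.map Formula.wk) ψ.wk → Derivable Δ ψ
  | qfER {Γ : List Ty} {Δ : List (Formula Γ)} {ρ τ : Ty} (α : Formula Γ) (h : α.IsQF)
      (s t : Term Γ ρ) (r : Term (ρ :: Γ) τ) :
      Derivable [] (Formula.imp α (Formula.eqT ρ s t)) →
      Derivable Δ (Formula.imp α
        (Formula.eqT τ (r.subst (Sub.single s)) (r.subst (Sub.single t))))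

/-- The system `F^ω[P]` proves the sentence `φ`. -/
def Proves (φ : Formula []) : Prop := Derivable [] φ

open Term Formula in
/-- The sentence
`∀ A^{S(0)}, M^{0(1)}, u, v > u ∃ n
  (∀ F^1 (P(⋂_{m = 0}^{M(F)} ⋃_{j = m}^{F(m)} A(j)) ≤ 2^{-v}) → P(A(n)) < 2^{-u})`. -/
def combinatorialSentence : Formula [] :=
  -- inside the quantifiers, `A`, `M`, `u`, `v`, `n` and then `F` or `m` are bound in this order
  all (Ty.nat ⇒ Ty.ev) <| all (Ty.one ⇒ Ty.nat) <| all Ty.nat <| all Ty.nat <|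
    imp (lt v1 v0) <| ex Ty.nat <|
      imp
        (all Ty.one
          (rLe
            (prob (bigInter
              (lam (bigUnion (Term.wk (Term.wk v4)) v0 (app v1 v0)))
              zero (app v4 v0)))
            (rPow v2)))
        (rLt (prob (app v4 v0)) (rPow v2))

/-! ### Computable functionals and majorants -/

/-- `Computes Y e x y`: the computation with index `e`, functional argument `Y` of type `2` and
number argument `x` terminates with value `y`. These are Kleene's schemes S1-S9 for one argument of
type `2`, with tuples of numbers coded by `Nat.pair`: initial functions, composition, primitive
recursion, application of `Y` to a total function computed by an index, and evaluation of an index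
given as an argument (a scheme for minimisation, which is derivable, is included as well). -/
inductive Computes (Y : (ℕ → ℕ) → ℕ) : ℕ → ℕ → ℕ → Prop
  | zero (x : ℕ) : Computes Y (Nat.pair 0 0) x 0
  | succ (x : ℕ) : Computes Y (Nat.pair 1 0) x (x + 1)
  | left (x : ℕ) : Computes Y (Nat.pair 2 0) x (Nat.unpair x).1
  | right (x : ℕ) : Computes Y (Nat.pair 3 0) x (Nat.unpair x).2
  | pair {c d x a b : ℕ} : Computes Y c x a → Computes Y d x b →
      Computes Y (Nat.pair 4 (Nat.pair c d)) x (Nat.pair a b)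
  | comp {c d x a b : ℕ} : Computes Y d x a → Computes Y c a b →
      Computes Y (Nat.pair 5 (Nat.pair c d)) x b
  | prec_zero {c d x a : ℕ} : Computes Y c x a →
      Computes Y (Nat.pair 6 (Nat.pair c d)) (Nat.pair x 0) a
  | prec_succ {c d x n a b : ℕ} :
      Computes Y (Nat.pair 6 (Nat.pair c d)) (Nat.pair x n) a →
      Computes Y d (Nat.pair x (Nat.pair n a)) b →
      Computes Y (Nat.pair 6 (Nat.pair c d)) (Nat.pair x (n + 1)) b
  | call {c x : ℕ} (f : ℕ → ℕ) : (∀ n, Computes Y c (Nat.pair x n) (f n)) →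
      Computes Y (Nat.pair 7 c) x (Y f)
  | eval {c x a : ℕ} : Computes Y c x a → Computes Y (Nat.pair 8 0) (Nat.pair c x) a
  | find {c x n : ℕ} (g : ℕ → ℕ) : (∀ k < n, Computes Y c (Nat.pair x k) (g k + 1)) →
      Computes Y c (Nat.pair x n) 0 → Computes Y (Nat.pair 9 c) x n

/-- Strong majorization at type `1`. -/
def Maj1 (g f : ℕ → ℕ) : Prop := ∀ n m, m ≤ n → f m ≤ g n ∧ g m ≤ g n

/-- Strong majorization at type `2`. -/
def Maj2 (Y Z : (ℕ → ℕ) → ℕ) : Prop := ∀ g f, Maj1 g f → Z f ≤ Y g ∧ Y f ≤ Y g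

end ProofMining

/-! Combinatorial core. Write W(m,k) for the union of A_j over m ≤ j ≤ k. For fixed m the contents
of W(m,k) increase with k and stay below 1, so some F(m) exists past which W(m,k) gains at most
2^(-(v+m+1)). Put N = M(F) and let L be at least N and all F(m) with m ≤ N. The event A_L lies in
W(m,L) for every m ≤ N, so intersecting with W(m,F(m)) costs at most 2^(-(v+m+1)). After N+1 such
cuts what is left of A_L lies in the intersection from the hypothesis, whence P(A_L) < 2^(-v) +
2^(-v) ≤ 2^(-u), and n = L works. For set algebras this is `content_lt` together with
`exists_content_le_add`.

Formal provability is obtained semantically. `proves_of_models` is a completeness theorem for the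
calculus, proved by a Henkin construction. The extensionality rule only accepts premises without
open assumptions, so terms of higher type are identified when no context of type 0 separates them
(`Germ.setoid`); with this choice the combinator and recursor equations hold literally in the term
model. In place of new constants, each stage adds a variable to the context. It then remains to run
the combinatorial argument in an arbitrary model (`exists_pr_lt`). There the numbers form a possibly
nonstandard ordered semiring with fraction field `K`, codes of reals get values in an ultrapower `R`
of `K`, and the laws of the content hold up to 2^(-n) for every n of the model. Induction and choice
are available for definable predicates only; the classes `IsDef`, `IsDefRel` and `IsDefK` check
definability by instance search.

For the computable bound, F cannot be found outright, but a finite search with a bounded number of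
trials replaces it. If numbers g(0) ≤ g(1) ≤ ... are tried for F(m), one of the first 2^(v+m+1)
steps raises the content of W(m,g(i)) by at most 2^(-(v+m+1)). Since the later choices depend on the
current trial, this becomes a bar recursion over finite stacks (`BarValue`), which stops once Y of
the stack drops below its length. It is total on majorizable Y because a majorant bounds Y along a
whole infinite branch (`exists_barValue`), it is computable by self-application through the
evaluation scheme (`exists_index_barValue`), and its value bounds n (`BarValue.exists_content_lt`).
-/

namespace ProofMining

local infixr:60 " ⇒ " => Ty.arr

/-! ### Substitution -/

namespace Sub

theorem ext {Γ Δ : List Ty} {θ η : Sub Γ Δ} (h : ∀ τ x, θ τ x = η τ x) : θ = η :=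
  funext fun τ => funext fun x => h τ x

@[simp] theorem lift_here {Γ Δ : List Ty} {σ : Ty} (θ : Sub Γ Δ) :
    (θ.lift (σ := σ)) σ Var.here = Term.var Var.here := rfl

@[simp] theorem lift_there {Γ Δ : List Ty} {σ τ : Ty} (θ : Sub Γ Δ) (x : Var Γ τ) :
    (θ.lift (σ := σ)) τ (Var.there x) = (θ τ x).wk := rfl

@[simp] theorem cons_here {Γ Δ : List Ty} {σ : Ty} (t : Term Δ σ) (θ : Sub Γ Δ) :
    (Sub.cons t θ) σ Var.here = t := rfl

@[simp] theorem cons_there {Γ Δ : List Ty} {σ τ : Ty} (t : Term Δ σ) (θ : Sub Γ Δ)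
    (x : Var Γ τ) : (Sub.cons t θ) τ (Var.there x) = θ τ x := rfl

end Sub

namespace Term

@[simp] theorem subst_var {Γ Δ : List Ty} (θ : Sub Γ Δ) {τ : Ty} (x : Var Γ τ) :
    (var x).subst θ = θ τ x := by simp only [subst]

@[simp] theorem subst_const {Γ Δ : List Ty} (θ : Sub Γ Δ) {τ : Ty} (c : Const τ) :
    (const c : Term Γ τ).subst θ = const c := by simp only [subst]

@[simp] theorem subst_app {Γ Δ : List Ty} (θ : Sub Γ Δ) {σ τ : Ty} (s : Term Γ (σ ⇒ τ))
    (t : Term Γ σ) : (app s t).subst θ = app (s.subst θ) (t.subst θ) := by simp only [subst]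

theorem subst_subst {Γ Δ Θ : List Ty} (θ : Sub Γ Δ) (η : Sub Δ Θ) {τ : Ty} (t : Term Γ τ) :
    (t.subst θ).subst η = t.subst (fun _ x => (θ _ x).subst η) := by
  induction t with
  | var x => simp
  | const c => simp
  | app s t hs ht => simp [hs, ht]

@[simp] theorem subst_id {Γ : List Ty} {τ : Ty} (t : Term Γ τ) :
    t.subst (fun _ x => var x) = t := by
  induction t with
  | var x => simp
  | const c => simp
  | app s t hs ht => simp [hs, ht]

@[simp] theorem wk_subst_lift {Γ Δ : List Ty} {σ τ : Ty} (θ : Sub Γ Δ) (t : Term Γ τ) :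
    (t.wk (σ := σ)).subst θ.lift = (t.subst θ).wk := by
  simp [wk, subst_subst]

@[simp] theorem wk_subst_cons {Γ Δ : List Ty} {σ τ : Ty} (s : Term Δ σ) (θ : Sub Γ Δ)
    (t : Term Γ τ) : t.wk.subst (Sub.cons s θ) = t.subst θ := by
  simp [wk, subst_subst]

@[simp] theorem wk_subst_single {Γ : List Ty} {σ τ : Ty} (s : Term Γ σ) (t : Term Γ τ) :
    t.wk.subst (Sub.single s) = t := by
  simp [Sub.single]

@[simp] theorem wk_var {Γ : List Ty} {σ τ : Ty} (x : Var Γ τ) :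
    (var x).wk (σ := σ) = var (Var.there x) := by simp [wk]

@[simp] theorem wk_const {Γ : List Ty} {σ τ : Ty} (c : Const τ) :
    (const c : Term Γ τ).wk (σ := σ) = const c := by simp [wk]

@[simp] theorem wk_app {Γ : List Ty} {ρ σ τ : Ty} (s : Term Γ (σ ⇒ τ)) (t : Term Γ σ) :
    (app s t).wk (σ := ρ) = app s.wk t.wk := by simp [wk]

end Term

namespace Sub

theorem lift_lift {Γ Δ Θ : List Ty} {σ : Ty} (θ : Sub Γ Δ) (η : Sub Δ Θ) :
    (fun τ x => ((θ.lift (σ := σ)) τ x).subst η.lift) = Sub.lift (fun τ x => (θ τ x).subst η) := by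
  refine Sub.ext fun τ x => ?_
  cases x with
  | here => simp
  | there x => simp

theorem lift_id {Γ : List Ty} {σ : Ty} :
    Sub.lift (σ := σ) (fun τ (x : Var Γ τ) => Term.var x) = fun _ x => Term.var x := by
  refine Sub.ext fun τ x => ?_
  cases x with
  | here => simp
  | there x => simp

theorem lift_single {Γ Δ : List Ty} {σ : Ty} (θ : Sub Γ Δ) (t : Term Δ σ) :
    (fun τ x => ((θ.lift (σ := σ)) τ x).subst (Sub.single t)) = Sub.cons t θ := by
  refine Sub.ext fun τ x => ?_
  cases x with
  | here => simp [Sub.single]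
  | there x => simp

end Sub

namespace Formula

theorem subst_subst {Γ Δ Θ : List Ty} (θ : Sub Γ Δ) (η : Sub Δ Θ) (φ : Formula Γ) :
    (φ.subst θ).subst η = φ.subst (fun _ x => (θ _ x).subst η) := by
  induction φ generalizing Δ Θ with
  | eq s t => simp [subst, Term.subst_subst]
  | falsum => simp [subst]
  | and φ ψ h1 h2 => simp [subst, h1, h2]
  | or φ ψ h1 h2 => simp [subst, h1, h2]
  | imp φ ψ h1 h2 => simp [subst, h1, h2]
  | all σ φ h => simp [subst, h, Sub.lift_lift]
  | ex σ φ h => simp [subst, h, Sub.lift_lift]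

theorem subst_id {Γ : List Ty} (φ : Formula Γ) : φ.subst (fun _ x => Term.var x) = φ := by
  induction φ with
  | eq s t => simp [subst]
  | falsum => simp [subst]
  | and φ ψ h1 h2 => simp [subst, h1, h2]
  | or φ ψ h1 h2 => simp [subst, h1, h2]
  | imp φ ψ h1 h2 => simp [subst, h1, h2]
  | all σ φ h => simp [subst, h, Sub.lift_id]
  | ex σ φ h => simp [subst, h, Sub.lift_id]

theorem subst_wk {Γ Δ : List Ty} {σ : Ty} (θ : Sub Γ Δ) (φ : Formula Γ) :
    (φ.subst θ).wk (σ := σ) = φ.subst (fun _ x => (θ _ x).wk) := by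
  simp only [wk, subst_subst]; rfl

theorem subst_lift_inst {Γ Δ : List Ty} {σ : Ty} (θ : Sub Γ Δ) (t : Term Δ σ)
    (φ : Formula (σ :: Γ)) : (φ.subst θ.lift).inst t = φ.subst (Sub.cons t θ) := by
  simp only [inst, subst_subst, Sub.lift_single]

theorem _root_.ProofMining.Var.isEmpty (τ : Ty) : IsEmpty (Var [] τ) := ⟨fun x => nomatch x⟩

/-- Weakening of a sentence to an arbitrary context. -/
def ofSentence {Γ : List Ty} (φ : Formula []) : Formula Γ :=
  φ.subst (fun _ x => ((Var.isEmpty _).false x).elim)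

theorem ofSentence_wk {Γ : List Ty} {σ : Ty} (φ : Formula []) :
    (φ.ofSentence (Γ := Γ)).wk (σ := σ) = φ.ofSentence := by
  simp only [ofSentence, subst_wk]
  congr 1
  exact Sub.ext (fun τ x => nomatch x)

theorem ofSentence_nil (φ : Formula []) : φ.ofSentence = φ := by
  rw [ofSentence]
  conv_rhs => rw [← subst_id φ]
  congr 1
  exact Sub.ext (fun τ x => nomatch x)

/-- This is the renaming behind eigenvariables: a matrix pushed under a fresh variable and
instantiated with that variable is unchanged. It is used for the universal case of the truth lemma.
-/
theorem subst_lift_there_inst {Γ : List Ty} {σ : Ty} (φ : Formula (σ :: Γ)) :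
    (φ.subst (Sub.lift fun _ x => Term.var (Var.there x))).inst (Term.var Var.here) = φ := by
  rw [subst_lift_inst]
  convert subst_id φ using 2
  refine Sub.ext fun τ x => ?_
  cases x <;> rfl

/-- Universal closure. -/
def closeAll : (Γ : List Ty) → Formula Γ → Formula []
  | [], φ => φ
  | σ :: Γ, φ => closeAll Γ (all σ φ)

end Formula

/-! ### Derivations -/

namespace Derivable

theorem mono {Γ : List Ty} {Δ Δ' : List (Formula Γ)} {φ : Formula Γ} (h : Derivable Δ φ)
    (hΔ : Δ ⊆ Δ') : Derivable Δ' φ := by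
  induction h with
  | ax h => exact ax h
  | hyp h => exact hyp (hΔ h)
  | andI _ _ h1 h2 => exact andI (h1 hΔ) (h2 hΔ)
  | andL _ h => exact andL (h hΔ)
  | andR _ h => exact andR (h hΔ)
  | orL _ h => exact orL (h hΔ)
  | orR _ h => exact orR (h hΔ)
  | orE _ _ _ h h1 h2 =>
    exact orE (h hΔ) (h1 (List.cons_subset_cons _ hΔ)) (h2 (List.cons_subset_cons _ hΔ))
  | impI _ h => exact impI (h (List.cons_subset_cons _ hΔ))
  | impE _ _ h1 h2 => exact impE (h1 hΔ) (h2 hΔ)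
  | raa _ h => exact raa (h (List.cons_subset_cons _ hΔ))
  | allI _ h => exact allI (h (List.map_subset _ hΔ))
  | allE t _ h => exact allE t (h hΔ)
  | exI t _ h => exact exI t (h hΔ)
  | exE _ _ h1 h2 =>
    exact exE (h1 hΔ) (h2 (List.cons_subset_cons _ (List.map_subset _ hΔ)))
  | qfER α h s t r h1 _ => exact qfER α h s t r h1

theorem weaken {Γ : List Ty} {Δ : List (Formula Γ)} {φ : Formula Γ} (h : Derivable [] φ) :
    Derivable Δ φ := h.mono (List.nil_subset _)

theorem cut {Γ : List Ty} {Δ : List (Formula Γ)} {φ ψ : Formula Γ} (h : Derivable Δ φ)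
    (h' : Derivable (φ :: Δ) ψ) : Derivable Δ ψ := impE (impI h') h

theorem hyp0 {Γ : List Ty} {Δ : List (Formula Γ)} {φ : Formula Γ} : Derivable (φ :: Δ) φ :=
  hyp (by simp)

theorem exfalso {Γ : List Ty} {Δ : List (Formula Γ)} {φ : Formula Γ}
    (h : Derivable Δ Formula.falsum) : Derivable Δ φ :=
  raa (h.mono (List.subset_cons_self _ _))

theorem closeAll {Γ : List Ty} {φ : Formula Γ} (h : Derivable [] φ) :
    Derivable [] (φ.closeAll Γ) := by
  induction Γ with
  | nil => exact h
  | cons σ Γ ih => exact ih (allI h)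

/-- The extensionality rule for an equation that is provable outright. -/
theorem congr_of_eqT {Γ : List Ty} {Δ : List (Formula Γ)} {ρ : Ty} {s t : Term Γ ρ}
    (r : Term (ρ :: Γ) Ty.nat) (h : Derivable [] (Formula.eqT ρ s t)) :
    Derivable Δ (Formula.eq (r.subst (Sub.single s)) (r.subst (Sub.single t))) := by
  -- The rule demands a quantifier-free premise; 0 = 0 serves as a dummy.
  have := qfER (Δ := Δ) (Formula.eq Term.zero Term.zero) trivial s t r
    (impI (h.weaken))
  exact impE this (ax (Postulate.refl _))

/-- Equality of numbers is a congruence. -/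
theorem congr_of_eq {Γ : List Ty} {Δ : List (Formula Γ)} {s t : Term Γ Ty.nat}
    (r : Term (Ty.nat :: Γ) Ty.nat) (h : Derivable Δ (Formula.eq s t)) :
    Derivable Δ (Formula.eq (r.subst (Sub.single s)) (r.subst (Sub.single t))) :=
  -- The equation itself is quantifier-free, so it can be the premise of the rule; the implication
  -- required is then a tautology without open assumptions, and the assumptions enter only
  -- afterwards.
  impE (qfER (Formula.eq s t) trivial s t r (impI hyp0)) h

theorem eq_symm {Γ : List Ty} {Δ : List (Formula Γ)} {s t : Term Γ Ty.nat}
    (h : Derivable Δ (Formula.eq s t)) : Derivable Δ (Formula.eq t s) :=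
  impE (ax (Postulate.symm _ _)) h

theorem eq_trans {Γ : List Ty} {Δ : List (Formula Γ)} {s t r : Term Γ Ty.nat}
    (h : Derivable Δ (Formula.eq s t)) (h' : Derivable Δ (Formula.eq t r)) :
    Derivable Δ (Formula.eq s r) :=
  impE (ax (Postulate.trans _ _ _)) (andI h h')

end Derivable

/-- A closed term of every type. -/
def Term.default {Γ : List Ty} : (τ : Ty) → Term Γ τ
  | Ty.nat => Term.const Const.zero
  | Ty.pt => Term.const Const.point
  | Ty.ev => Term.const Const.empty
  | Ty.arr σ τ => Term.app (Term.const (Const.proj τ σ)) (Term.default τ)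

/-! ### Countability of the language -/

/-- Countability of types, terms and formulas lets a single sequence of stages in the Henkin
construction treat every formula. It is shown by induction on a bound for the size. -/
theorem countable_of_size {α : Type*} (size : α → ℕ) (h : ∀ n, {a | size a ≤ n}.Countable) :
    Countable α := by
  rw [← Set.countable_univ_iff]
  refine (Set.countable_iUnion h).mono fun a _ => ?_
  exact Set.mem_iUnion.2 ⟨size a, by simp⟩

def Ty.size : Ty → ℕ
  | nat => 0
  | pt => 0
  | ev => 0
  | arr σ τ => σ.size + τ.size + 1

instance : Countable Ty := by
  refine countable_of_size Ty.size fun n => ?_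
  induction n with
  | zero =>
    refine (Set.countable_insert.2 (Set.countable_insert.2 (Set.countable_singleton Ty.ev)) :
      ({Ty.nat, Ty.pt, Ty.ev} : Set Ty).Countable).mono fun τ h => ?_
    cases τ <;> simp_all [Ty.size]
  | succ n ih =>
    refine ((Set.countable_insert.2 (Set.countable_insert.2 (Set.countable_singleton Ty.ev)) :
      ({Ty.nat, Ty.pt, Ty.ev} : Set Ty).Countable).union (ih.image2 ih Ty.arr)).mono fun τ h => ?_
    cases τ with
    | arr σ τ =>
      simp only [Ty.size, Set.mem_ofPred_eq] at h
      exact Or.inr ⟨σ, show σ.size ≤ n by omega, τ, show τ.size ≤ n by omega, rfl⟩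
    | _ => simp

def Term.size {Γ : List Ty} : {τ : Ty} → Term Γ τ → ℕ
  | _, var _ => 0
  | _, const _ => 0
  | _, app s t => s.size + t.size + 1

def Formula.size : {Γ : List Ty} → Formula Γ → ℕ
  | _, eq _ _ => 0
  | _, falsum => 0
  | _, and φ ψ => size φ + size ψ + 1
  | _, or φ ψ => size φ + size ψ + 1
  | _, imp φ ψ => size φ + size ψ + 1
  | _, all _ φ => size φ + 1
  | _, ex _ φ => size φ + 1

instance (Γ : List Ty) (τ : Ty) : Countable (Var Γ τ) := by
  induction Γ with
  | nil => exact ⟨fun _ => 0, fun x => nomatch x⟩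
  | cons σ Γ ih =>
    refine Function.Surjective.countable (α := PLift (σ = τ) ⊕ Var Γ τ)
      (f := fun o => match o with
        | .inl h => h.down ▸ Var.here
        | .inr x => Var.there x) fun x => ?_
    cases x with
    | here => exact ⟨.inl ⟨rfl⟩, rfl⟩
    | there x => exact ⟨.inr x, rfl⟩

instance : Countable (Σ τ, Const τ) := by
  rw [← Set.countable_univ_iff]
  refine ((((Set.toFinite {⟨_, Const.zero⟩, ⟨_, Const.succ⟩, ⟨_, Const.eqPt⟩, ⟨_, Const.mem⟩,
    ⟨_, Const.union⟩, ⟨_, Const.compl⟩, ⟨_, Const.empty⟩, ⟨_, Const.point⟩,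
    ⟨_, Const.prob⟩}).countable.union
    (Set.countable_range fun p : Ty × Ty => ⟨_, Const.proj p.1 p.2⟩)).union
    (Set.countable_range fun p : Ty × Ty × Ty => ⟨_, Const.dist p.1 p.2.1 p.2.2⟩)).union
    (Set.countable_range fun p : Σ (ρs : List Ty) (ρ : Ty), Var ρs ρ =>
      ⟨_, Const.recur p.1 p.2.2⟩)).mono ?_
  rintro ⟨τ, c⟩ -
  cases c with
  | proj σ τ => exact Or.inl (Or.inl (Or.inr ⟨(σ, τ), rfl⟩))
  | dist δ ρ τ => exact Or.inl (Or.inr ⟨(δ, ρ, τ), rfl⟩)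
  | recur ρs i => exact Or.inr ⟨⟨ρs, _, i⟩, rfl⟩
  | _ => exact Or.inl (Or.inl (Or.inl (by simp)))

instance (τ : Ty) : Countable (Const τ) :=
  Function.Injective.countable (f := fun c => (⟨τ, c⟩ : Σ τ, Const τ)) fun _ _ h => by
    simpa using h

instance (Γ : List Ty) (τ : Ty) : Countable (Term Γ τ) := by
  refine countable_of_size Term.size fun n => ?_
  induction n generalizing τ with
  | zero =>
    refine ((Set.countable_range Term.var).union (Set.countable_range Term.const)).mono
      fun t h => ?_
    cases t with
    | var x => exact Or.inl ⟨x, rfl⟩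
    | const c => exact Or.inr ⟨c, rfl⟩
    | app s t => simp [Term.size] at h
  | succ n ih =>
    refine (((Set.countable_range Term.var).union (Set.countable_range Term.const)).union
      (Set.countable_iUnion fun σ => (ih (σ ⇒ τ)).image2 (ih σ) Term.app)).mono fun t h => ?_
    cases t with
    | var x => exact Or.inl (Or.inl ⟨x, rfl⟩)
    | const c => exact Or.inl (Or.inr ⟨c, rfl⟩)
    | @app σ _ s t =>
      simp only [Term.size, Set.mem_ofPred_eq] at h
      exact Or.inr (Set.mem_iUnion.2 ⟨σ, s, show s.size ≤ n by omega, t,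
        show t.size ≤ n by omega, rfl⟩)

instance (Γ : List Ty) : Countable (Formula Γ) := by
  refine countable_of_size Formula.size fun n => ?_
  induction n generalizing Γ with
  | zero =>
    refine ((Set.countable_range fun p : Term Γ Ty.nat × Term Γ Ty.nat =>
      Formula.eq p.1 p.2).union (Set.countable_singleton Formula.falsum)).mono fun φ h => ?_
    cases φ with
    | eq s t => exact Or.inl ⟨(s, t), rfl⟩
    | falsum => exact Or.inr rfl
    | _ => simp [Formula.size] at h
  | succ n ih =>
    refine (((Set.countable_range fun p : Term Γ Ty.nat × Term Γ Ty.nat =>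
      Formula.eq p.1 p.2).union (Set.countable_singleton Formula.falsum)).union
      (((((ih Γ).image2 (ih Γ) Formula.and).union ((ih Γ).image2 (ih Γ) Formula.or)).union
      ((ih Γ).image2 (ih Γ) Formula.imp)).union
      ((Set.countable_iUnion fun σ => (ih (σ :: Γ)).image (Formula.all σ)).union
      (Set.countable_iUnion fun σ => (ih (σ :: Γ)).image (Formula.ex σ))))).mono fun φ h => ?_
    cases φ with
    | eq s t => exact Or.inl (Or.inl ⟨(s, t), rfl⟩)
    | falsum => exact Or.inl (Or.inr rfl)
    | and φ ψ =>
      simp only [Formula.size, Set.mem_ofPred_eq] at h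
      exact Or.inr (Or.inl (Or.inl (Or.inl
        ⟨φ, show φ.size ≤ n by omega, ψ, show ψ.size ≤ n by omega, rfl⟩)))
    | or φ ψ =>
      simp only [Formula.size, Set.mem_ofPred_eq] at h
      exact Or.inr (Or.inl (Or.inl (Or.inr
        ⟨φ, show φ.size ≤ n by omega, ψ, show ψ.size ≤ n by omega, rfl⟩)))
    | imp φ ψ =>
      simp only [Formula.size, Set.mem_ofPred_eq] at h
      exact Or.inr (Or.inl (Or.inr
        ⟨φ, show φ.size ≤ n by omega, ψ, show ψ.size ≤ n by omega, rfl⟩))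
    | all σ φ =>
      simp only [Formula.size, Set.mem_ofPred_eq] at h
      exact Or.inr (Or.inr (Or.inl (Set.mem_iUnion.2 ⟨σ, φ, show φ.size ≤ n by omega, rfl⟩)))
    | ex σ φ =>
      simp only [Formula.size, Set.mem_ofPred_eq] at h
      exact Or.inr (Or.inr (Or.inr (Set.mem_iUnion.2 ⟨σ, φ, show φ.size ≤ n by omega, rfl⟩)))

open Filter

/-! ### Structures -/

/-- Applicative structures for the language of the system. -/
structure Str where
  D : Ty → Type
  ap : {σ τ : Ty} → D (σ ⇒ τ) → D σ → D τ
  co : {τ : Ty} → Const τ → D τ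

namespace Str

variable (𝔐 : Str)

abbrev Env (Γ : List Ty) : Type := ∀ τ : Ty, Var Γ τ → 𝔐.D τ

variable {𝔐}

def Env.nil : 𝔐.Env [] := fun τ x => ((Var.isEmpty τ).false x).elim

def Env.cons {Γ : List Ty} {σ : Ty} (d : 𝔐.D σ) (e : 𝔐.Env Γ) : 𝔐.Env (σ :: Γ)
  | _, Var.here => d
  | _, Var.there x => e _ x

@[simp] theorem Env.cons_here {Γ : List Ty} {σ : Ty} (d : 𝔐.D σ) (e : 𝔐.Env Γ) :
    Env.cons d e σ Var.here = d := rfl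

@[simp] theorem Env.cons_there {Γ : List Ty} {σ τ : Ty} (d : 𝔐.D σ) (e : 𝔐.Env Γ)
    (x : Var Γ τ) : Env.cons d e τ (Var.there x) = e τ x := rfl

theorem Env.ext {Γ : List Ty} {e e' : 𝔐.Env Γ} (h : ∀ τ x, e τ x = e' τ x) : e = e' :=
  funext fun τ => funext fun x => h τ x

theorem Env.eq_nil (e : 𝔐.Env []) : e = Env.nil := Env.ext fun _ x => nomatch x

theorem Env.cons_eta {Γ : List Ty} {σ : Ty} (e : 𝔐.Env (σ :: Γ)) :
    Env.cons (e σ Var.here) (fun τ x => e τ (Var.there x)) = e := by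
  refine Env.ext fun τ x => ?_
  cases x <;> rfl

/-- The value of a term. -/
def tm {Γ : List Ty} (e : 𝔐.Env Γ) : {τ : Ty} → Term Γ τ → 𝔐.D τ
  | _, Term.var x => e _ x
  | _, Term.const c => 𝔐.co c
  | _, Term.app s t => 𝔐.ap (tm e s) (tm e t)

/-- Satisfaction of a formula. -/
def sat : {Γ : List Ty} → 𝔐.Env Γ → Formula Γ → Prop
  | _, e, Formula.eq s t => tm e s = tm e t
  | _, _, Formula.falsum => False
  | _, e, Formula.and φ ψ => sat e φ ∧ sat e ψ
  | _, e, Formula.or φ ψ => sat e φ ∨ sat e ψ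
  | _, e, Formula.imp φ ψ => sat e φ → sat e ψ
  | _, e, Formula.all σ φ => ∀ d : 𝔐.D σ, sat (Env.cons d e) φ
  | _, e, Formula.ex σ φ => ∃ d : 𝔐.D σ, sat (Env.cons d e) φ

@[simp] theorem tm_var {Γ : List Ty} (e : 𝔐.Env Γ) {τ : Ty} (x : Var Γ τ) :
    tm e (Term.var x) = e _ x := by simp only [tm]

@[simp] theorem tm_const {Γ : List Ty} (e : 𝔐.Env Γ) {τ : Ty} (c : Const τ) :
    tm e (Term.const c) = 𝔐.co c := by simp only [tm]

@[simp] theorem tm_app {Γ : List Ty} (e : 𝔐.Env Γ) {σ τ : Ty} (s : Term Γ (σ ⇒ τ))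
    (t : Term Γ σ) : tm e (Term.app s t) = 𝔐.ap (tm e s) (tm e t) := by simp only [tm]

theorem tm_subst {Γ Δ : List Ty} (e : 𝔐.Env Δ) (θ : Sub Γ Δ) {τ : Ty} (t : Term Γ τ) :
    tm e (t.subst θ) = tm (fun _ x => tm e (θ _ x)) t := by
  induction t with
  | var x => simp
  | const c => simp
  | app s t hs ht => simp [hs, ht]

@[simp] theorem tm_wk {Γ : List Ty} {σ τ : Ty} (d : 𝔐.D σ) (e : 𝔐.Env Γ) (t : Term Γ τ) :
    tm (Env.cons d e) t.wk = tm e t := by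
  simp [Term.wk, tm_subst]

theorem env_lift {Γ Δ : List Ty} {σ : Ty} (d : 𝔐.D σ) (e : 𝔐.Env Δ) (θ : Sub Γ Δ) :
    (fun τ x => tm (Env.cons d e) (θ.lift (σ := σ) τ x)) =
      Env.cons d (fun τ x => tm e (θ τ x)) := by
  refine Env.ext fun τ x => ?_
  cases x <;> simp

theorem sat_subst {Γ Δ : List Ty} (e : 𝔐.Env Δ) (θ : Sub Γ Δ) (φ : Formula Γ) :
    sat e (φ.subst θ) ↔ sat (fun _ x => tm e (θ _ x)) φ := by
  induction φ generalizing Δ with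
  | eq s t => simp [Formula.subst, sat, tm_subst]
  | falsum => simp [Formula.subst, sat]
  | and φ ψ h1 h2 => simp [Formula.subst, sat, h1, h2]
  | or φ ψ h1 h2 => simp [Formula.subst, sat, h1, h2]
  | imp φ ψ h1 h2 => simp [Formula.subst, sat, h1, h2]
  | all σ φ h => simp [Formula.subst, sat, h, env_lift]
  | ex σ φ h => simp [Formula.subst, sat, h, env_lift]

theorem sat_closeAll {Γ : List Ty} (φ : Formula Γ) :
    sat (𝔐 := 𝔐) Env.nil (φ.closeAll Γ) ↔ ∀ e : 𝔐.Env Γ, sat e φ := by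
  induction Γ with
  | nil => exact ⟨fun h e => by rwa [Env.eq_nil e], fun h => h _⟩
  | cons σ Γ ih =>
    rw [Formula.closeAll, ih]
    refine ⟨fun h e => ?_, fun h e d => h _⟩
    rw [← Env.cons_eta e]
    exact h _ _

end Str

/-- Models of the system in which numbers are equal only if they are identical and in which the
combinators and the recursor satisfy their defining equations literally. -/
structure Model extends Str where
  proj_eq : ∀ {σ τ : Ty} (x : D σ) (y : D τ), ap (ap (co (Const.proj σ τ)) x) y = x
  dist_eq : ∀ {δ ρ τ : Ty} (x : D (δ ⇒ ρ ⇒ τ)) (y : D (δ ⇒ ρ)) (z : D δ),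
    ap (ap (ap (co (Const.dist δ ρ τ)) x) y) z = ap (ap x z) (ap y z)
  rec_zero : ∀ {ρ : Ty} (a : D ρ) (f : D (ρ ⇒ Ty.nat ⇒ ρ)),
    ap (ap (ap (co (Const.recur [ρ] Var.here)) (co Const.zero)) a) f = a
  rec_succ : ∀ {ρ : Ty} (n : D Ty.nat) (a : D ρ) (f : D (ρ ⇒ Ty.nat ⇒ ρ)),
    ap (ap (ap (co (Const.recur [ρ] Var.here)) (ap (co Const.succ) n)) a) f =
      ap (ap f (ap (ap (ap (co (Const.recur [ρ] Var.here)) n) a) f)) n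
  sound : ∀ φ : Formula [], Derivable [] φ → Str.sat (𝔐 := toStr) Str.Env.nil φ

/-! ### Completeness -/

namespace Completeness

open Formula (ofSentence)

/-- Sets of assumptions that are consistent with all theorems of the system. -/
def Good {Γ : List Ty} (Δ : List (Formula Γ)) : Prop :=
  ∀ L : List (Formula []), (∀ χ ∈ L, Derivable [] χ) →
    ¬ Derivable (Δ ++ L.map ofSentence) Formula.falsum

theorem Good.not_derivable {Γ : List Ty} {Δ : List (Formula Γ)} (h : Good Δ) :
    ¬ Derivable Δ Formula.falsum := by
  simpa using h [] (by simp)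

/-- The auxiliary assumptions are theorems of the empty context, so they can be cut away one by one.
-/
theorem good_neg {φ : Formula []} (h : ¬ Derivable [] φ) : Good [φ.neg] := by
  intro L hL hd
  refine h (Derivable.raa ?_)
  induction L with
  | nil => simpa using hd
  | cons χ L ih =>
    refine ih (fun χ' h' => hL _ (List.mem_cons_of_mem _ h')) ?_
    refine Derivable.cut (φ := χ) (hL χ (by simp)).weaken (hd.mono ?_)
    intro ψ hψ
    simp only [Formula.ofSentence_nil, List.map_cons, List.mem_append, List.mem_cons,
      List.not_mem_nil, or_false] at hψ ⊢
    tauto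

theorem map_wk_append {Γ : List Ty} {σ : Ty} (Δ : List (Formula Γ)) (L : List (Formula [])) :
    (Δ ++ L.map ofSentence).map (Formula.wk (σ := σ)) =
      Δ.map Formula.wk ++ L.map ofSentence := by
  simp [Formula.ofSentence_wk]

/-- A fresh variable cannot create an inconsistency: quantify it universally and instantiate with a
closed term, which exists at every type. -/
theorem Good.wk {Γ : List Ty} {Δ : List (Formula Γ)} (h : Good Δ) (σ : Ty) :
    Good (Δ.map (Formula.wk (σ := σ))) := by
  intro L hL hd
  rw [← map_wk_append] at hd
  exact h L hL (Derivable.allE (Term.default σ) (Derivable.allI hd))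

/-- One Henkin step. If `χ` cannot be added, then finitely many theorems together with `Δ` refute
it, and merging these with any further theorems shows that its negation can be added. If `χ` is
existential over the type of the new variable, that variable becomes the witness; it does not occur
in the old assumptions, so existential elimination returns an inconsistency to the old context. -/
theorem good_step {Γ : List Ty} {Δ : List (Formula Γ)} (h : Good Δ) (χ : Formula Γ) (σ : Ty) :
    ∃ Δ' : List (Formula (σ :: Γ)), Good Δ' ∧ (∀ ψ ∈ Δ, ψ.wk ∈ Δ') ∧
      (χ.wk ∈ Δ' ∨ χ.neg.wk ∈ Δ') ∧
      ∀ φ, χ = Formula.ex σ φ → χ.wk ∈ Δ' → φ ∈ Δ' := by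
  by_cases hχ : Good (χ :: Δ)
  · by_cases hex : ∃ φ, χ = Formula.ex σ φ
    · obtain ⟨φ, rfl⟩ := hex
      refine ⟨φ :: (Formula.ex σ φ :: Δ).map Formula.wk, ?_, ?_, ?_, ?_⟩
      · intro L hL hd
        rw [List.cons_append, ← map_wk_append] at hd
        exact hχ L hL (Derivable.exE (Derivable.hyp (by simp)) hd)
      · intro ψ hψ
        exact List.mem_cons_of_mem _ (List.mem_map_of_mem (List.mem_cons_of_mem _ hψ))
      · exact Or.inl (List.mem_cons_of_mem _ (List.mem_map_of_mem (by simp)))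
      · rintro φ' h' -
        cases h'
        simp
    · refine ⟨(χ :: Δ).map Formula.wk, hχ.wk σ, ?_, Or.inl (by simp), ?_⟩
      · intro ψ hψ
        exact List.mem_map_of_mem (List.mem_cons_of_mem _ hψ)
      · exact fun φ h' => absurd ⟨φ, h'⟩ hex
  · have hneg : Good (χ.neg :: Δ) := by
      simp only [Good, not_forall, not_not] at hχ
      obtain ⟨L, hL, hd⟩ := hχ
      intro L' hL' hd'
      refine h (L ++ L') (by
        intro ψ hψ
        rcases List.mem_append.1 hψ with h | h
        · exact hL _ h
        · exact hL' _ h) ?_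
      refine Derivable.cut (φ := χ.neg) (Derivable.impI (hd.mono ?_)) (hd'.mono ?_)
      · intro ψ hψ
        simp only [List.cons_append, List.mem_cons, List.mem_append, List.map_append] at hψ ⊢
        tauto
      · intro ψ hψ
        simp only [List.cons_append, List.mem_cons, List.mem_append, List.map_append] at hψ ⊢
        tauto
    refine ⟨(χ.neg :: Δ).map Formula.wk, hneg.wk σ, ?_, Or.inr (by simp), ?_⟩
    · intro ψ hψ
      exact List.mem_map_of_mem (List.mem_cons_of_mem _ hψ)
    · intro φ _ hmem
      refine ((hneg.wk σ).not_derivable ?_).elim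
      exact Derivable.impE (φ := χ.wk) (Derivable.hyp (by
        rw [List.map_cons]; exact List.mem_cons_self)) (Derivable.hyp hmem)

/-- The sequence of iterated steps from `x`. -/
def liftSeq {X : ℕ → Type*} (step : ∀ n, X n → X (n + 1)) (x₀ : X 0) (m : ℕ) (x : X m) :
    ∀ n, X n
  | 0 => if h : m = 0 then h ▸ x else x₀
  | n + 1 => if h : m = n + 1 then h ▸ x else step n (liftSeq step x₀ m x n)

theorem liftSeq_self {X : ℕ → Type*} (step : ∀ n, X n → X (n + 1)) (x₀ : X 0) (m : ℕ) (x : X m) :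
    liftSeq step x₀ m x m = x := by
  cases m <;> simp [liftSeq]

theorem liftSeq_succ {X : ℕ → Type*} (step : ∀ n, X n → X (n + 1)) (x₀ : X 0) (m : ℕ) (x : X m)
    (n : ℕ) (h : m ≤ n) :
    liftSeq step x₀ m x (n + 1) = step n (liftSeq step x₀ m x n) := by
  rw [liftSeq, dif_neg (by omega)]

/-- The contexts of a chain. -/
def ctx (ν : ℕ → Ty) : ℕ → List Ty
  | 0 => []
  | n + 1 => ν n :: ctx ν n

/-- A sequence of formulas that is eventually given by weakening. -/
def Coh {ν : ℕ → Ty} (ψ : ∀ n, Formula (ctx ν n)) : Prop :=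
  ∀ᶠ n in atTop, ψ (n + 1) = (ψ n).wk (σ := ν n)

/-- Chains of sets of assumptions that decide all formulas and contain witnesses. -/
structure Chain where
  ν : ℕ → Ty
  Δ : ∀ n, List (Formula (ctx ν n))
  mono : ∀ n, ∀ ψ ∈ Δ n, ψ.wk (σ := ν n) ∈ Δ (n + 1)
  good : ∀ n, Good (Δ n)
  task : ∀ ψ : (∀ n, Formula (ctx ν n)), Coh ψ → ∀ (σ : Ty) (N : ℕ), ∃ n ≥ N, ν n = σ ∧
    ((ψ n).wk (σ := ν n) ∈ Δ (n + 1) ∨ (ψ n).neg.wk (σ := ν n) ∈ Δ (n + 1)) ∧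
    ∀ φ : Formula (ν n :: ctx ν n), ψ n = Formula.ex (ν n) φ →
      (ψ n).wk (σ := ν n) ∈ Δ (n + 1) → φ ∈ Δ (n + 1)

theorem exists_chain (Δ₀ : List (Formula [])) (h : Good Δ₀) : ∃ C : Chain, C.Δ 0 = Δ₀ := by
  have : Nonempty Ty := ⟨Ty.nat⟩
  obtain ⟨eT, heT⟩ := exists_surjective_nat Ty
  have hF : ∀ Γ : List Ty, ∃ f : ℕ → Formula Γ, Function.Surjective f := fun Γ =>
    haveI : Nonempty (Formula Γ) := ⟨Formula.falsum⟩
    exists_surjective_nat (Formula Γ)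
  choose eF heF using hF
  let ν : ℕ → Ty := fun n => eT n.unpair.1
  let lift : ∀ m, Formula (ctx ν m) → ∀ n, Formula (ctx ν n) :=
    liftSeq (X := fun n => Formula (ctx ν n)) (fun n ψ => ψ.wk (σ := ν n)) Formula.falsum
  let task : ∀ n, Formula (ctx ν n) := fun n =>
    lift n.unpair.2.unpair.1 (eF _ n.unpair.2.unpair.2) n
  let st : ∀ n, {Δ : List (Formula (ctx ν n)) // Good Δ} := fun n =>
    Nat.rec ⟨Δ₀, h⟩ (fun n Δ => ⟨(good_step Δ.2 (task n) (ν n)).choose,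
      (good_step Δ.2 (task n) (ν n)).choose_spec.1⟩) n
  have hst := fun n => (good_step (st n).2 (task n) (ν n)).choose_spec.2
  refine ⟨⟨ν, fun n => (st n).1, fun n => (hst n).1, fun n => (st n).2, ?_⟩, rfl⟩
  intro ψ hψ σ N
  obtain ⟨N₀, hN₀⟩ := eventually_atTop.1 hψ
  obtain ⟨a, ha⟩ := heT σ
  obtain ⟨k, hk⟩ := heF _ (ψ (max N N₀))
  have hlift : ∀ n ≥ max N N₀, lift (max N N₀) (ψ (max N N₀)) n = ψ n := by
    intro n hn
    induction n, hn using Nat.le_induction with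
    | base => exact liftSeq_self _ _ _ _
    | succ n hn ih =>
      rw [hN₀ n (by omega), ← ih]
      exact liftSeq_succ _ _ _ _ _ hn
  have hle : max N N₀ ≤ Nat.pair a (Nat.pair (max N N₀) k) :=
    (Nat.left_le_pair _ _).trans (Nat.right_le_pair _ _)
  -- Stage n is read as a pair of a type for the new variable and a formula over an earlier context.
  -- A coherent sequence of formulas can be picked up at any late stage, so its task recurs
  -- arbitrarily late. The number n is kept as a variable because the type of `task n` depends on
  -- it.
  have htask : ∀ n, n = Nat.pair a (Nat.pair (max N N₀) k) → task n = ψ n := by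
    intro n hn
    have h1 : n.unpair.2.unpair.1 = max N N₀ := by simp [hn]
    have h2 : n.unpair.2.unpair.2 = k := by simp [hn]
    show lift n.unpair.2.unpair.1 (eF _ n.unpair.2.unpair.2) n = ψ n
    rw [h2, h1, hk]
    exact hlift n (hn ▸ hle)
  refine ⟨Nat.pair a (Nat.pair (max N N₀) k), (le_max_left _ _).trans hle, ?_, ?_⟩
  · show eT _ = σ
    simp [ha]
  · rw [← htask _ rfl]
    exact (hst _).2

end Completeness

open Filter

/-! ### The term model of a chain and the truth lemma -/

namespace Completeness

namespace Chain

variable (C : Chain)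

abbrev Γ (n : ℕ) : List Ty := ctx C.ν n

/-- Eventual membership in a chain. -/
def Th (ψ : ∀ n, Formula (C.Γ n)) : Prop := ∀ᶠ n in atTop, ψ n ∈ C.Δ n

variable {C}

theorem th_of_mem {ψ : ∀ n, Formula (C.Γ n)} {n : ℕ}
    (hc : ∀ k ≥ n, ψ (k + 1) = (ψ k).wk (σ := C.ν k)) (h : ψ n ∈ C.Δ n) : C.Th ψ := by
  refine eventually_atTop.2 ⟨n, fun k hk => ?_⟩
  induction k, hk using Nat.le_induction with
  | base => exact h
  | succ k hk ih => rw [hc k hk]; exact C.mono k _ ih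

theorem coh_neg {ψ : ∀ n, Formula (C.Γ n)} (hc : Coh ψ) : Coh fun n => (ψ n).neg :=
  hc.mono fun n h => by
    show (ψ (n + 1)).neg = _
    rw [h]; rfl

theorem th_or_neg {ψ : ∀ n, Formula (C.Γ n)} (hc : Coh ψ) :
    C.Th ψ ∨ C.Th fun n => (ψ n).neg := by
  obtain ⟨N, hN⟩ := eventually_atTop.1 hc
  obtain ⟨N', hN'⟩ := eventually_atTop.1 (coh_neg hc)
  obtain ⟨n, hn, -, h, -⟩ := C.task ψ hc Ty.nat (max N N')
  refine h.imp (fun h => ?_) (fun h => ?_)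
  · rw [← hN n (by omega)] at h
    exact th_of_mem (fun k hk => hN k (by omega)) h
  · exact th_of_mem (n := n + 1) (fun k hk => hN' k (by omega)) (by
      rw [show (ψ (n + 1)).neg = (ψ n).neg.wk from hN' n (by omega)]; exact h)

theorem th_of_derivable {ψ : ∀ n, Formula (C.Γ n)} (hc : Coh ψ)
    (h : ∃ᶠ n in atTop, Derivable (C.Δ n) (ψ n)) : C.Th ψ := by
  refine (th_or_neg hc).resolve_right fun hn => ?_
  obtain ⟨n, h1, h2⟩ := (h.and_eventually hn).exists
  exact (C.good n).not_derivable (Derivable.impE (Derivable.hyp h2) h1)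

theorem th_of_eventually {ψ : ∀ n, Formula (C.Γ n)} (hc : Coh ψ)
    (h : ∀ᶠ n in atTop, Derivable (C.Δ n) (ψ n)) : C.Th ψ :=
  th_of_derivable hc h.frequently

theorem th_neg {ψ : ∀ n, Formula (C.Γ n)} (hc : Coh ψ) :
    (C.Th fun n => (ψ n).neg) ↔ ¬ C.Th ψ := by
  refine ⟨fun h h' => ?_, fun h => (th_or_neg hc).resolve_left h⟩
  obtain ⟨n, h1, h2⟩ := (h.and h').exists
  exact (C.good n).not_derivable (Derivable.impE (Derivable.hyp h1) (Derivable.hyp h2))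

/-- Derivations in the empty context are not transported to larger contexts here. Instead `Good`
counts the weakened theorems among the assumptions, so no stage can contain the negation of one. -/
theorem th_ofSentence {φ : Formula []} (h : Derivable [] φ) :
    C.Th fun _ => φ.ofSentence := by
  have hc : Coh fun n => (φ.ofSentence : Formula (C.Γ n)) :=
    Eventually.of_forall fun n => (Formula.ofSentence_wk φ).symm
  refine (th_or_neg hc).resolve_right fun hn => ?_
  obtain ⟨n, hn⟩ := hn.exists
  refine C.good n [φ] (by simpa using h) (Derivable.impE (φ := φ.ofSentence) ?_ ?_)
  · exact Derivable.hyp (List.mem_append_left _ hn)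
  · exact Derivable.hyp (by simp)

variable (C)

/-- Sequences of terms that are eventually given by weakening. -/
structure Germ (τ : Ty) where
  val : ∀ n, Term (C.Γ n) τ
  coh : ∀ᶠ n in atTop, val (n + 1) = (val n).wk (σ := C.ν n)

namespace Germ

variable {C}

def app {σ τ : Ty} (s : C.Germ (σ ⇒ τ)) (t : C.Germ σ) : C.Germ τ where
  val n := Term.app (s.val n) (t.val n)
  coh := by
    filter_upwards [s.coh, t.coh] with n h1 h2
    rw [h1, h2, Term.wk_app]; rfl

def const {τ : Ty} (c : Const τ) : C.Germ τ where
  val n := Term.const c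
  coh := Eventually.of_forall fun n => by rw [Term.wk_const]; rfl

theorem coh_eq (s t : C.Germ Ty.nat) : Coh fun n => Formula.eq (s.val n) (t.val n) := by
  filter_upwards [s.coh, t.coh] with n h1 h2
  rw [h1, h2]; rfl

/-- Equality of germs of numbers. -/
def Eqv (s t : C.Germ Ty.nat) : Prop := C.Th fun n => Formula.eq (s.val n) (t.val n)

theorem eqv_of_derivable {s t : C.Germ Ty.nat}
    (h : ∀ n, Derivable (C.Δ n) (Formula.eq (s.val n) (t.val n))) : Eqv s t :=
  th_of_eventually (coh_eq s t) (Eventually.of_forall h)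

theorem Eqv.symm {s t : C.Germ Ty.nat} (h : Eqv s t) : Eqv t s :=
  th_of_eventually (coh_eq t s) (h.mono fun _ h => (Derivable.hyp h).eq_symm)

theorem Eqv.trans {s t r : C.Germ Ty.nat} (h : Eqv s t) (h' : Eqv t r) : Eqv s r :=
  th_of_eventually (coh_eq s r) ((h.and h').mono fun _ h =>
    (Derivable.hyp h.1).eq_trans (Derivable.hyp h.2))

theorem derivable_congr {Γ : List Ty} {Δ : List (Formula Γ)} {ρ : Ty} {s t : Term Γ ρ}
    (R : Term Γ (ρ ⇒ Ty.nat)) (h : Derivable [] (Formula.eqT ρ s t)) :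
    Derivable Δ (Formula.eq (Term.app R s) (Term.app R t)) := by
  have := Derivable.congr_of_eqT (Δ := Δ) (Term.app R.wk (Term.var Var.here)) h
  simpa [Sub.single] using this

theorem derivable_congr_arg {Γ : List Ty} {Δ : List (Formula Γ)} {ρ : Ty}
    {s t : Term Γ (ρ ⇒ Ty.nat)} (u : Term Γ ρ) (h : Derivable [] (Formula.eqT _ s t)) :
    Derivable Δ (Formula.eq (Term.app s u) (Term.app t u)) := by
  have := Derivable.congr_of_eqT (Δ := Δ) (Term.app (Term.var Var.here) u.wk) h
  simpa [Sub.single] using this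

/-- Equality in all contexts. -/
instance setoid (τ : Ty) : Setoid (C.Germ τ) where
  r s t := ∀ R : C.Germ (τ ⇒ Ty.nat), Eqv (R.app s) (R.app t)
  iseqv := ⟨fun _ _ => eqv_of_derivable fun _ => Derivable.ax (Postulate.refl _),
    fun h R => (h R).symm, fun h h' R => (h R).trans (h' R)⟩

/-- An equation derivable without assumptions can be moved into every context `R` by the
extensionality rule. This is why combinators and recursors satisfy their equations literally in the
quotient. -/
theorem equiv_of_eqT {τ : Ty} {s t : C.Germ τ}
    (h : ∀ n, Derivable [] (Formula.eqT τ (s.val n) (t.val n))) : s ≈ t :=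
  fun R => eqv_of_derivable fun n => derivable_congr (R.val n) (h n)

theorem equiv_nat {s t : C.Germ Ty.nat} : s ≈ t ↔ Eqv s t := by
  constructor
  · intro h
    -- The identity, as the usual term in the combinators, is among the test contexts, so equivalent
    -- germs of numbers are themselves equal.
    have hI := h (((const (Const.dist Ty.nat (Ty.nat ⇒ Ty.nat) Ty.nat)).app
      (const (Const.proj Ty.nat (Ty.nat ⇒ Ty.nat)))).app (const (Const.proj Ty.nat Ty.nat)))
    have key : ∀ s : C.Germ Ty.nat, Eqv ((((const (Const.dist Ty.nat (Ty.nat ⇒ Ty.nat)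
        Ty.nat)).app (const (Const.proj Ty.nat (Ty.nat ⇒ Ty.nat)))).app
        (const (Const.proj Ty.nat Ty.nat))).app s) s := fun s =>
      eqv_of_derivable fun n => Derivable.eq_trans
        (Derivable.ax (Postulate.dist (τ := Ty.nat) _ _ _))
        (Derivable.ax (Postulate.proj (σ := Ty.nat) _ _))
    exact (key s).symm.trans (hI.trans (key t))
  · intro h R
    refine th_of_eventually (coh_eq _ _) (h.mono fun n h => ?_)
    have := Derivable.congr_of_eq (Term.app (R.val n).wk (Term.var Var.here)) (Derivable.hyp h)
    simpa [Sub.single, app] using this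

/-- `λ f, R (f t)` -/
def precomp {σ τ : Ty} (R : C.Germ (τ ⇒ Ty.nat)) (t : C.Germ σ) : C.Germ ((σ ⇒ τ) ⇒ Ty.nat) :=
  ((const (Const.dist (σ ⇒ τ) τ Ty.nat)).app ((const (Const.proj _ _)).app R)).app
    (((const (Const.dist (σ ⇒ τ) σ τ)).app
      (((const (Const.dist (σ ⇒ τ) ((σ ⇒ τ) ⇒ (σ ⇒ τ)) (σ ⇒ τ))).app
        (const (Const.proj (σ ⇒ τ) ((σ ⇒ τ) ⇒ (σ ⇒ τ))))).app
          (const (Const.proj (σ ⇒ τ) (σ ⇒ τ))))).app ((const (Const.proj _ _)).app t))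

theorem precomp_app {σ τ : Ty} (R : C.Germ (τ ⇒ Ty.nat)) (t : C.Germ σ) (s : C.Germ (σ ⇒ τ)) :
    Eqv ((precomp R t).app s) (R.app (s.app t)) := by
  refine eqv_of_derivable fun n => ?_
  refine (Derivable.ax (Postulate.dist (τ := Ty.nat) _ _ _)).eq_trans ?_
  refine (derivable_congr_arg _ (Derivable.ax (Postulate.proj _ _))).eq_trans ?_
  refine (derivable_congr _ (Derivable.ax (Postulate.dist _ _ _))).eq_trans ?_
  have h1 : ∀ (a b : Term (C.Γ n) (σ ⇒ τ)) (u v : Term (C.Γ n) σ),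
      Derivable [] (Formula.eqT _ a b) → Derivable [] (Formula.eqT _ u v) →
      Derivable (C.Δ n) (Formula.eq (Term.app (R.val n) (Term.app a u))
        (Term.app (R.val n) (Term.app b v))) := by
    intro a b u v h h'
    have e1 := Derivable.congr_of_eqT (Δ := C.Δ n)
      (Term.app (R.val n).wk (Term.app (Term.var Var.here) u.wk)) h
    have e2 := Derivable.congr_of_eqT (Δ := C.Δ n)
      (Term.app (R.val n).wk (Term.app b.wk (Term.var Var.here))) h'
    simp [Sub.single] at e1 e2
    exact e1.eq_trans e2
  have h2 := fun a b h => h1 a b ((const (Const.proj σ (σ ⇒ τ))).app t |>.app s |>.val n)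
    (t.val n) h (Derivable.ax (Postulate.proj _ _))
  refine (h2 _ _ (Derivable.ax (Postulate.dist _ _ _))).eq_trans ?_
  have e1 := Derivable.congr_of_eqT (Δ := C.Δ n)
      (Term.app (R.val n).wk (Term.app (Term.var Var.here) (t.val n).wk))
      (Derivable.ax (Postulate.proj (σ := σ ⇒ τ) (τ := (σ ⇒ τ) ⇒ (σ ⇒ τ)) (s.val n)
        (Term.app (Term.const (Const.proj _ _)) (s.val n))))
  simp [Sub.single] at e1
  exact e1

/-- A test `R` of `s t` is also a test of `s`, namely the one that applies its argument to `t` and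
then uses `R`. The companion for the argument composes `R` with `s` in the same way. -/
theorem app_congr_left {σ τ : Ty} {s s' : C.Germ (σ ⇒ τ)} (t : C.Germ σ) (h : s ≈ s') :
    s.app t ≈ s'.app t := fun R =>
  (precomp_app R t s).symm.trans ((h _).trans (precomp_app R t s'))

theorem app_congr_right {σ τ : Ty} (s : C.Germ (σ ⇒ τ)) {t t' : C.Germ σ} (h : t ≈ t') :
    s.app t ≈ s.app t' := by
  intro R
  have key : ∀ t : C.Germ σ, Eqv ((((const (Const.dist σ τ Ty.nat)).app
      ((const (Const.proj _ _)).app R)).app s).app t) (R.app (s.app t)) := fun t =>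
    eqv_of_derivable fun n => (Derivable.ax (Postulate.dist (τ := Ty.nat) _ _ _)).eq_trans
      (derivable_congr_arg _ (Derivable.ax (Postulate.proj _ _)))
  exact (key t).symm.trans ((h _).trans (key t'))

end Germ

/-- The term model of a chain. -/
def str : Str where
  D τ := Quotient (Germ.setoid (C := C) τ)
  ap := Quotient.map₂ Germ.app fun _ _ h _ _ h' =>
    Setoid.trans (Germ.app_congr_left _ h) (Germ.app_congr_right _ h')
  co c := Quotient.mk _ (Germ.const c)

variable {C}

def cls {τ : Ty} (t : C.Germ τ) : C.str.D τ := Quotient.mk _ t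

theorem exists_cls {τ : Ty} (d : C.str.D τ) : ∃ t : C.Germ τ, cls t = d := Quotient.exists_rep d

/-- The substitutions given by an assignment of germs. -/
def subAt {Γ : List Ty} (θ : ∀ τ, Var Γ τ → C.Germ τ) (n : ℕ) : Sub Γ (C.Γ n) :=
  fun τ x => (θ τ x).val n

/-- A context has finitely many variables, so one stage bounds all the stages from which the
individual germs are coherent. -/
theorem subAt_coh {Γ : List Ty} (θ : ∀ τ, Var Γ τ → C.Germ τ) :
    ∀ᶠ n in atTop, subAt θ (n + 1) = fun τ x => (subAt θ n τ x).wk (σ := C.ν n) := by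
  have h : ∀ᶠ n in atTop, ∀ (τ : Ty) (x : Var Γ τ),
      (θ τ x).val (n + 1) = ((θ τ x).val n).wk (σ := C.ν n) := by
    induction Γ with
    | nil => exact Eventually.of_forall fun n τ x => nomatch x
    | cons σ Γ ih =>
      filter_upwards [ih (fun τ x => θ τ (Var.there x)), (θ σ Var.here).coh] with n h1 h2
      intro τ x
      cases x with
      | here => exact h2
      | there x => exact h1 τ x
  exact h.mono fun n h => Sub.ext h

theorem coh_subst {Γ : List Ty} (θ : ∀ τ, Var Γ τ → C.Germ τ) (φ : Formula Γ) :
    Coh fun n => φ.subst (subAt θ n) :=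
  (subAt_coh θ).mono fun n h => by
    show φ.subst (subAt θ (n + 1)) = _
    rw [h, Formula.subst_wk]; rfl

/-- The germ of a substituted term. -/
def germSubst {Γ : List Ty} (θ : ∀ τ, Var Γ τ → C.Germ τ) {τ : Ty} (t : Term Γ τ) :
    C.Germ τ where
  val n := t.subst (subAt θ n)
  coh := (subAt_coh θ).mono fun n h => by
    rw [h, Term.wk, Term.subst_subst]; rfl

theorem tm_cls {Γ : List Ty} (θ : ∀ τ, Var Γ τ → C.Germ τ) {τ : Ty} (t : Term Γ τ) :
    Str.tm (𝔐 := C.str) (fun τ x => cls (θ τ x)) t = cls (germSubst θ t) := by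
  induction t with
  | var x => simp [germSubst, subAt]
  | const c => simp [germSubst, str, cls, Germ.const]
  | app s t hs ht =>
    simp only [Str.tm_app, hs, ht, germSubst, Term.subst_app]
    rfl

def consGerm {Γ : List Ty} {σ : Ty} (c : C.Germ σ) (θ : ∀ τ, Var Γ τ → C.Germ τ) :
    ∀ τ, Var (σ :: Γ) τ → C.Germ τ
  | _, Var.here => c
  | _, Var.there x => θ _ x

theorem cls_consGerm {Γ : List Ty} {σ : Ty} (c : C.Germ σ) (θ : ∀ τ, Var Γ τ → C.Germ τ) :
    (fun τ x => cls (consGerm c θ τ x)) =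
      Str.Env.cons (𝔐 := C.str) (cls c) (fun τ x => cls (θ τ x)) := by
  refine Str.Env.ext fun τ x => ?_
  cases x <;> rfl

theorem subAt_consGerm {Γ : List Ty} {σ : Ty} (c : C.Germ σ) (θ : ∀ τ, Var Γ τ → C.Germ τ)
    (n : ℕ) : subAt (consGerm c θ) n = Sub.cons (c.val n) (subAt θ n) := by
  refine Sub.ext fun τ x => ?_
  cases x <;> rfl

theorem exists_witness {Γ : List Ty} (θ : ∀ τ, Var Γ τ → C.Germ τ) (σ : Ty)
    (φ : Formula (σ :: Γ)) (h : C.Th fun n => (Formula.ex σ φ).subst (subAt θ n)) :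
    ∃ c : C.Germ σ, C.Th fun n => φ.subst (subAt (consGerm c θ) n) := by
  obtain ⟨N, hN⟩ := eventually_atTop.1 ((subAt_coh θ).and (h.and (coh_subst θ (.ex σ φ))))
  obtain ⟨n, hn, rfl, -, hw⟩ := C.task _ (coh_subst θ (.ex σ φ)) σ N
  have hmem := hw (φ.subst (subAt θ n).lift) rfl (by
    rw [← (hN n hn).2.2]
    exact (hN (n + 1) (by omega)).2.1)
  -- The witness is the variable added at stage n, innermost in the context of stage n + 1 and
  -- weakened afterwards; its entries at earlier stages are dummies.
  let lift := liftSeq (X := fun k => Term (C.Γ k) (C.ν n)) (fun k t => t.wk (σ := C.ν k))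
    (Term.default _) (n + 1) (Term.var Var.here)
  refine ⟨⟨lift, eventually_atTop.2 ⟨n + 1, fun k hk => liftSeq_succ _ _ _ _ k hk⟩⟩, ?_⟩
  refine th_of_mem (n := n + 1) (fun k hk => ?_) ?_
  · rw [Formula.subst_wk]
    congr 1
    rw [subAt_consGerm, subAt_consGerm, (hN k (by omega)).1]
    refine Sub.ext fun τ x => ?_
    cases x with
    | here => exact liftSeq_succ _ _ _ _ k hk
    | there x => rfl
  · refine Eq.subst (motive := fun ψ => ψ ∈ C.Δ (n + 1)) ?_ hmem
    rw [subAt_consGerm, (hN n hn).1]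
    congr 1
    refine Sub.ext fun τ x => ?_
    cases x with
    | here => exact (liftSeq_self (X := fun k => Term (C.Γ k) (C.ν n)) _ _ (n + 1) _).symm
    | there x => rfl

/-- Henkin's truth lemma. The connectives use that the theory `Th` is complete, consistent and
closed under derivability. The existential case uses the witnesses of the chain, and the universal
case reduces to it: a refuted universal formula yields a witness of the negated matrix. -/
theorem truth {Γ : List Ty} (φ : Formula Γ) (θ : ∀ τ, Var Γ τ → C.Germ τ) :
    Str.sat (𝔐 := C.str) (fun τ x => cls (θ τ x)) φ ↔ C.Th fun n => φ.subst (subAt θ n) := by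
  induction φ with
  | eq s t =>
    rw [Str.sat, tm_cls, tm_cls]
    exact Quotient.eq.trans Germ.equiv_nat
  | falsum =>
    simp only [Str.sat, false_iff]
    intro h
    obtain ⟨n, hn⟩ := h.exists
    exact (C.good n).not_derivable (Derivable.hyp hn)
  | and φ ψ h1 h2 =>
    rw [Str.sat, h1, h2]
    constructor
    · rintro ⟨h, h'⟩
      exact th_of_eventually (coh_subst θ _) ((h.and h').mono fun n h =>
        Derivable.andI (Derivable.hyp h.1) (Derivable.hyp h.2))
    · intro h
      exact ⟨th_of_eventually (coh_subst θ _) (h.mono fun n h =>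
        Derivable.andL (Derivable.hyp h)), th_of_eventually (coh_subst θ _) (h.mono fun n h =>
        Derivable.andR (Derivable.hyp h))⟩
  | or φ ψ h1 h2 =>
    rw [Str.sat, h1, h2]
    constructor
    · rintro (h | h)
      · exact th_of_eventually (coh_subst θ _) (h.mono fun n h =>
          Derivable.orL (Derivable.hyp h))
      · exact th_of_eventually (coh_subst θ _) (h.mono fun n h =>
          Derivable.orR (Derivable.hyp h))
    · intro h
      by_contra hcon
      push Not at hcon
      have e1 := (th_neg (coh_subst θ φ)).2 hcon.1
      have e2 := (th_neg (coh_subst θ ψ)).2 hcon.2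
      obtain ⟨n, h, e1, e2⟩ := (h.and (e1.and e2)).exists
      refine (C.good n).not_derivable (Derivable.orE (Derivable.hyp h) ?_ ?_)
      · exact Derivable.impE (Derivable.hyp (List.mem_cons_of_mem _ e1)) Derivable.hyp0
      · exact Derivable.impE (Derivable.hyp (List.mem_cons_of_mem _ e2)) Derivable.hyp0
  | imp φ ψ h1 h2 =>
    rw [Str.sat, h1, h2]
    constructor
    · intro h
      by_cases hφ : C.Th fun n => φ.subst (subAt θ n)
      · exact th_of_eventually (coh_subst θ _) ((h hφ).mono fun n h =>
          Derivable.impI (Derivable.hyp (List.mem_cons_of_mem _ h)))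
      · rw [← th_neg (coh_subst θ φ)] at hφ
        exact th_of_eventually (coh_subst θ _) (hφ.mono fun n h =>
          Derivable.impI (Derivable.exfalso (Derivable.impE
            (Derivable.hyp (List.mem_cons_of_mem _ h)) Derivable.hyp0)))
    · intro h h'
      exact th_of_eventually (coh_subst θ _) ((h.and h').mono fun n h =>
        Derivable.impE (Derivable.hyp h.1) (Derivable.hyp h.2))
  | all σ φ ih =>
    rw [Str.sat]
    constructor
    · intro h
      refine (th_or_neg (coh_subst θ (.all σ φ))).resolve_right fun hn => ?_
      have hex : C.Th fun n => (Formula.ex σ φ.neg).subst (subAt θ n) := by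
        refine th_of_eventually (coh_subst θ _) (hn.mono fun n hn => ?_)
        refine Derivable.raa (Derivable.impE (Derivable.hyp (List.mem_cons_of_mem _ hn)) ?_)
        refine Derivable.allI (Derivable.raa (Derivable.impE (φ := ((Formula.ex σ φ.neg).subst
          (subAt θ n)).wk) (Derivable.hyp (by
            rw [List.map_cons]
            exact List.mem_cons_of_mem _ List.mem_cons_self)) ?_))
        refine Derivable.exI (Term.var Var.here) ?_
        have e := Formula.subst_lift_there_inst (φ.subst (subAt θ n).lift).neg
        exact Eq.subst (motive := fun ψ => Derivable (_ :: _) ψ) e.symm Derivable.hyp0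
      obtain ⟨c, hc⟩ := exists_witness θ σ φ.neg hex
      refine (th_neg (coh_subst (consGerm c θ) φ)).1 hc ?_
      rw [← ih, cls_consGerm]
      exact h _
    · intro h d
      obtain ⟨c, rfl⟩ := exists_cls d
      rw [← cls_consGerm, ih]
      refine th_of_eventually (coh_subst _ _) (h.mono fun n h => ?_)
      rw [subAt_consGerm, ← Formula.subst_lift_inst]
      exact Derivable.allE _ (Derivable.hyp h)
  | ex σ φ ih =>
    rw [Str.sat]
    constructor
    · rintro ⟨d, hd⟩
      obtain ⟨c, rfl⟩ := exists_cls d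
      rw [← cls_consGerm, ih] at hd
      refine th_of_eventually (coh_subst _ _) (hd.mono fun n h => ?_)
      refine Derivable.exI (c.val n) (Derivable.hyp ?_)
      rwa [Formula.subst_lift_inst, ← subAt_consGerm]
    · intro h
      obtain ⟨c, hc⟩ := exists_witness θ σ φ h
      refine ⟨cls c, ?_⟩
      rwa [← cls_consGerm, ih]

theorem truth_sentence (φ : Formula []) :
    Str.sat (𝔐 := C.str) Str.Env.nil φ ↔ C.Th fun _ => φ.ofSentence := by
  have h := truth (C := C) φ (fun τ x => ((Var.isEmpty τ).false x).elim)
  rw [Str.Env.eq_nil (fun τ x => _)] at h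
  rw [h]
  have e : ∀ n, subAt (C := C) (fun τ (x : Var [] τ) => ((Var.isEmpty τ).false x).elim) n =
    fun τ x => ((Var.isEmpty τ).false x).elim := fun n => Sub.ext fun τ x => nomatch x
  simp only [e]
  rfl

/-- The term model of a chain is a model of the system. -/
def model (C : Chain) : Model where
  toStr := C.str
  proj_eq x y := by
    obtain ⟨x, rfl⟩ := exists_cls x
    obtain ⟨y, rfl⟩ := exists_cls y
    exact Quotient.sound (Germ.equiv_of_eqT fun n => Derivable.ax (Postulate.proj _ _))
  dist_eq x y z := by
    obtain ⟨x, rfl⟩ := exists_cls x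
    obtain ⟨y, rfl⟩ := exists_cls y
    obtain ⟨z, rfl⟩ := exists_cls z
    exact Quotient.sound (Germ.equiv_of_eqT fun n => Derivable.ax (Postulate.dist _ _ _))
  rec_zero a f := by
    rename_i ρ
    obtain ⟨a, rfl⟩ := exists_cls a
    obtain ⟨f, rfl⟩ := exists_cls f
    exact Quotient.sound (Germ.equiv_of_eqT fun n => Derivable.ax
      (Postulate.recur_zero [ρ] Var.here (Sub.cons (a.val n) (fun _ x => nomatch x))
        (Sub.cons (f.val n) (fun _ x => nomatch x))))
  rec_succ k a f := by
    rename_i ρ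
    obtain ⟨k, rfl⟩ := exists_cls k
    obtain ⟨a, rfl⟩ := exists_cls a
    obtain ⟨f, rfl⟩ := exists_cls f
    exact Quotient.sound (Germ.equiv_of_eqT fun n => Derivable.ax
      (Postulate.recur_succ [ρ] Var.here (k.val n) (Sub.cons (a.val n) (fun _ x => nomatch x))
        (Sub.cons (f.val n) (fun _ x => nomatch x))))
  sound φ h := (truth_sentence φ).2 (th_ofSentence h)

end Chain

end Completeness

/-- Completeness: a sentence that holds in all models is derivable. -/
theorem proves_of_models (φ : Formula [])
    (h : ∀ 𝔐 : Model, Str.sat (𝔐 := 𝔐.toStr) Str.Env.nil φ) : Proves φ := by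
  by_contra hφ
  obtain ⟨C, hC⟩ := Completeness.exists_chain _ (Completeness.good_neg hφ)
  have h1 := (Completeness.Chain.truth_sentence φ).1 (h C.model)
  have h2 : C.Th fun n => (φ.neg).ofSentence := by
    refine Completeness.Chain.th_of_mem (n := 0) (fun k _ => (Formula.ofSentence_wk _).symm) ?_
    rw [hC]
    exact List.mem_singleton.2 (Formula.ofSentence_nil _)
  obtain ⟨n, h1, h2⟩ := (h1.and h2).exists
  exact (C.good n).not_derivable (Derivable.impE (Derivable.hyp h2) (Derivable.hyp h1))

/-! ### Definability with parameters -/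

namespace Str

variable {𝔐 : Str}

def Env.append : {Γ Δ : List Ty} → 𝔐.Env Γ → 𝔐.Env Δ → 𝔐.Env (Γ ++ Δ)
  | [], _, _, e => e
  | _ :: _, _, a, e => Env.cons (a _ Var.here) (Env.append (fun τ x => a τ (Var.there x)) e)

theorem Env.append_inl {Γ Δ : List Ty} (a : 𝔐.Env Γ) (e : 𝔐.Env Δ) {τ : Ty} (x : Var Γ τ) :
    Env.append a e τ x.inl = a τ x := by
  induction x with
  | here => simp [Env.append, Var.inl]
  | there x ih => simp [Env.append, Var.inl, ih]

theorem Env.append_inr {Γ Δ : List Ty} (a : 𝔐.Env Γ) (e : 𝔐.Env Δ) {τ : Ty} (x : Var Δ τ) :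
    Env.append a e τ (x.inr Γ) = e τ x := by
  induction Γ with
  | nil => rfl
  | cons σ Γ ih => simp [Env.append, Var.inr, ih]

theorem Env.append_subAppend {Γ Δ Θ : List Ty} (α : Sub Γ Θ) (β : Sub Δ Θ) (e : 𝔐.Env Θ) :
    (fun τ x => tm e (Sub.append α β τ x)) =
      Env.append (fun τ x => tm e (α τ x)) (fun τ x => tm e (β τ x)) := by
  induction Γ with
  | nil => rfl
  | cons σ Γ ih =>
    refine Env.ext fun τ x => ?_
    cases x with
    | here => rfl
    | there x =>
      have := congrFun (congrFun (ih (fun _ y => α _ (Var.there y))) τ) x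
      simpa [Sub.append, Env.append] using this

/-- Types of tuples of elements of a structure. -/
class Coord (𝔐 : outParam Str) (X : Type) where
  Γ : List Ty
  env : X → 𝔐.Env Γ

/-- The type of the empty tuple. -/
inductive Tail (𝔐 : Str) : Type
  | nil : Tail 𝔐

instance : Coord 𝔐 (Tail 𝔐) := ⟨[], fun _ => Env.nil⟩

instance (σ : Ty) (X : Type) [Coord 𝔐 X] : Coord 𝔐 (𝔐.D σ × X) :=
  ⟨σ :: Coord.Γ X, fun p => Env.cons p.1 (Coord.env p.2)⟩

variable {X : Type} [Coord 𝔐 X]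

/-- Functions that are definable by a term with parameters. -/
class IsDef {τ : Ty} (f : X → 𝔐.D τ) : Prop where
  out : ∃ (Δ : List Ty) (e : 𝔐.Env Δ) (t : Term (Coord.Γ X ++ Δ) τ),
    ∀ x, f x = tm (Env.append (Coord.env x) e) t

/-- Relations that are definable by a formula with parameters. -/
class IsDefRel (P : X → Prop) : Prop where
  out : ∃ (Δ : List Ty) (e : 𝔐.Env Δ) (φ : Formula (Coord.Γ X ++ Δ)),
    ∀ x, P x ↔ sat (Env.append (Coord.env x) e) φ

/-- Two definitions come with parameter lists of their own. The lists are concatenated, and `renL`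
and `renR` rename each definition into the common context. -/
def renL (Γ Δ Δ' : List Ty) : Sub (Γ ++ Δ) (Γ ++ (Δ ++ Δ')) :=
  Sub.append (fun _ x => Term.var x.inl) (fun _ x => Term.var (x.inl.inr Γ))

def renR (Γ Δ Δ' : List Ty) : Sub (Γ ++ Δ') (Γ ++ (Δ ++ Δ')) :=
  Sub.append (fun _ x => Term.var x.inl) (fun _ x => Term.var ((x.inr Δ).inr Γ))

theorem renL_env {Γ Δ Δ' : List Ty} (a : 𝔐.Env Γ) (e : 𝔐.Env Δ) (e' : 𝔐.Env Δ') :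
    (fun τ x => tm (Env.append a (Env.append e e')) (renL Γ Δ Δ' τ x)) = Env.append a e := by
  rw [renL, Env.append_subAppend]
  simp [Env.append_inl, Env.append_inr]

theorem renR_env {Γ Δ Δ' : List Ty} (a : 𝔐.Env Γ) (e : 𝔐.Env Δ) (e' : 𝔐.Env Δ') :
    (fun τ x => tm (Env.append a (Env.append e e')) (renR Γ Δ Δ' τ x)) = Env.append a e' := by
  rw [renR, Env.append_subAppend]
  simp [Env.append_inl, Env.append_inr]

theorem IsDefRel.of_iff {P : X → Prop} (Q : X → Prop) [h : IsDefRel Q]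
    (hPQ : ∀ x, P x ↔ Q x) : IsDefRel P := by
  rwa [show P = Q from funext fun x => propext (hPQ x)]

instance IsDef.const {τ : Ty} (d : 𝔐.D τ) : IsDef (fun _ : X => d) :=
  ⟨[τ], Env.cons d Env.nil, Term.var (Var.here.inr _), fun x => by
    rw [tm_var, Env.append_inr, Env.cons_here]⟩

theorem IsDef.of_var {τ : Ty} (v : Var (Coord.Γ X) τ) :
    IsDef (fun x : X => Coord.env x τ v) :=
  ⟨[], Env.nil, Term.var v.inl, fun x => by rw [tm_var, Env.append_inl]⟩

instance IsDef.fst {σ : Ty} : IsDef (fun p : 𝔐.D σ × X => p.1) :=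
  IsDef.of_var (X := 𝔐.D σ × X) (Var.here : Var (σ :: Coord.Γ X) σ)

theorem IsDef.comp_snd {σ τ : Ty} (f : X → 𝔐.D τ) [h : IsDef f] :
    IsDef (fun p : 𝔐.D σ × X => f p.2) := by
  obtain ⟨Δ, e, t, ht⟩ := h.out
  exact ⟨Δ, e, t.wk, fun p => (ht p.2).trans (tm_wk _ _ _).symm⟩

instance IsDef.snd_fst {σ τ : Ty} : IsDef (fun p : 𝔐.D σ × 𝔐.D τ × X => p.2.1) :=
  IsDef.comp_snd (fun x : 𝔐.D τ × X => x.1)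

instance IsDef.snd_snd_fst {σ τ ρ : Ty} :
    IsDef (fun p : 𝔐.D σ × 𝔐.D τ × 𝔐.D ρ × X => p.2.2.1) :=
  IsDef.comp_snd (fun x : 𝔐.D τ × 𝔐.D ρ × X => x.2.1)

instance IsDef.app {σ τ : Ty} (f : X → 𝔐.D (σ ⇒ τ)) (g : X → 𝔐.D σ) [hf : IsDef f]
    [hg : IsDef g] : IsDef (fun x => 𝔐.ap (f x) (g x)) := by
  obtain ⟨Δ, e, s, hs⟩ := hf.out
  obtain ⟨Δ', e', t, ht⟩ := hg.out
  refine ⟨Δ ++ Δ', Env.append e e', Term.app (s.subst (renL _ _ _)) (t.subst (renR _ _ _)),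
    fun x => ?_⟩
  rw [tm_app, tm_subst, tm_subst, renL_env, renR_env, ← hs, ← ht]

instance IsDefRel.eq (f g : X → 𝔐.D Ty.nat) [hf : IsDef f] [hg : IsDef g] :
    IsDefRel (fun x => f x = g x) := by
  obtain ⟨Δ, e, s, hs⟩ := hf.out
  obtain ⟨Δ', e', t, ht⟩ := hg.out
  refine ⟨Δ ++ Δ', Env.append e e', Formula.eq (s.subst (renL _ _ _)) (t.subst (renR _ _ _)),
    fun x => ?_⟩
  rw [sat, tm_subst, tm_subst, renL_env, renR_env, ← hs, ← ht]

instance IsDefRel.false : IsDefRel (fun _ : X => False) :=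
  ⟨[], Env.nil, Formula.falsum, fun _ => Iff.rfl⟩

instance IsDefRel.and (P Q : X → Prop) [hP : IsDefRel P] [hQ : IsDefRel Q] :
    IsDefRel (fun x => P x ∧ Q x) := by
  obtain ⟨Δ, e, φ, hφ⟩ := hP.out
  obtain ⟨Δ', e', ψ, hψ⟩ := hQ.out
  refine ⟨Δ ++ Δ', Env.append e e', Formula.and (φ.subst (renL _ _ _)) (ψ.subst (renR _ _ _)),
    fun x => ?_⟩
  rw [sat, sat_subst, sat_subst, renL_env, renR_env, ← hφ, ← hψ]

instance IsDefRel.or (P Q : X → Prop) [hP : IsDefRel P] [hQ : IsDefRel Q] :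
    IsDefRel (fun x => P x ∨ Q x) := by
  obtain ⟨Δ, e, φ, hφ⟩ := hP.out
  obtain ⟨Δ', e', ψ, hψ⟩ := hQ.out
  refine ⟨Δ ++ Δ', Env.append e e', Formula.or (φ.subst (renL _ _ _)) (ψ.subst (renR _ _ _)),
    fun x => ?_⟩
  rw [sat, sat_subst, sat_subst, renL_env, renR_env, ← hφ, ← hψ]

instance IsDefRel.imp (P Q : X → Prop) [hP : IsDefRel P] [hQ : IsDefRel Q] :
    IsDefRel (fun x => P x → Q x) := by
  obtain ⟨Δ, e, φ, hφ⟩ := hP.out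
  obtain ⟨Δ', e', ψ, hψ⟩ := hQ.out
  refine ⟨Δ ++ Δ', Env.append e e', Formula.imp (φ.subst (renL _ _ _)) (ψ.subst (renR _ _ _)),
    fun x => ?_⟩
  rw [sat, sat_subst, sat_subst, renL_env, renR_env, ← hφ, ← hψ]

instance IsDefRel.not (P : X → Prop) [hP : IsDefRel P] : IsDefRel (fun x => ¬ P x) :=
  IsDefRel.imp P (fun _ => False)

instance IsDefRel.iff (P Q : X → Prop) [hP : IsDefRel P] [hQ : IsDefRel Q] :
    IsDefRel (fun x => P x ↔ Q x) :=
  IsDefRel.of_iff (fun x => (P x → Q x) ∧ (Q x → P x)) fun _ => iff_def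

instance IsDefRel.ne (f g : X → 𝔐.D Ty.nat) [hf : IsDef f] [hg : IsDef g] :
    IsDefRel (fun x => f x ≠ g x) :=
  IsDefRel.not _

instance IsDefRel.all {σ : Ty} (P : X → 𝔐.D σ → Prop)
    [hP : IsDefRel (fun p : 𝔐.D σ × X => P p.2 p.1)] : IsDefRel (fun x => ∀ d, P x d) := by
  obtain ⟨Δ, e, φ, hφ⟩ := hP.out
  exact ⟨Δ, e, Formula.all σ φ, fun x => forall_congr' fun d => hφ (d, x)⟩

instance IsDefRel.ex {σ : Ty} (P : X → 𝔐.D σ → Prop)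
    [hP : IsDefRel (fun p : 𝔐.D σ × X => P p.2 p.1)] : IsDefRel (fun x => ∃ d, P x d) := by
  obtain ⟨Δ, e, φ, hφ⟩ := hP.out
  exact ⟨Δ, e, Formula.ex σ φ, fun x => exists_congr fun d => hφ (d, x)⟩

end Str

namespace Model

open Str

variable {𝔐 : Model}

theorem sound' {Γ : List Ty} {φ : Formula Γ} (h : Derivable [] φ) (e : 𝔐.Env Γ) : sat e φ :=
  (sat_closeAll φ).1 (𝔐.sound _ h.closeAll) e

theorem sat_postulate {Γ : List Ty} {φ : Formula Γ} (h : Postulate φ) (e : 𝔐.Env Γ) : sat e φ :=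
  sound' (Derivable.ax h) e

/-! ### Abstraction -/

/-- Bracket abstraction is correct because the combinator equations hold literally in a model. The
context is generalised to an equal one so that induction on the indexed family of terms applies. -/
theorem ap_tm_lam {Γ : List Ty} {σ τ : Ty} (e : 𝔐.Env Γ) (t : Term (σ :: Γ) τ) (d : 𝔐.D σ) :
    𝔐.ap (tm e (Term.lam t)) d = tm (Env.cons d e) t := by
  suffices H : ∀ {Γ' : List Ty} {τ : Ty} (t : Term Γ' τ) (h : Γ' = σ :: Γ),
      𝔐.ap (tm e (Term.lam (h ▸ t))) d = tm (Env.cons d e) (h ▸ t : Term (σ :: Γ) τ) from H t rfl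
  intro Γ' τ t
  induction t with
  | var x =>
    rintro rfl
    cases x with
    | here => simp [Term.lam, Term.lamVar, 𝔐.dist_eq, 𝔐.proj_eq]
    | there x => simp [Term.lam, Term.lamVar, 𝔐.proj_eq]
  | const c => rintro rfl; simp [Term.lam, 𝔐.proj_eq]
  | app s t hs ht =>
    rintro rfl
    have h1 := hs rfl
    have h2 := ht rfl
    simp only at h1 h2
    simp [Term.lam, 𝔐.dist_eq, h1, h2]

theorem exists_lam {σ τ : Ty} (f : 𝔐.D σ → 𝔐.D τ)
    [hf : IsDef (fun p : 𝔐.D σ × Tail 𝔐.toStr => f p.1)] :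
    ∃ F : 𝔐.D (σ ⇒ τ), ∀ d, 𝔐.ap F d = f d := by
  obtain ⟨Δ, e, t, ht⟩ := hf.out
  exact ⟨tm e (Term.lam t), fun d => by rw [ap_tm_lam, ht (d, Tail.nil)]; rfl⟩

/-! ### Induction -/

abbrev N (𝔐 : Model) : Type := 𝔐.D Ty.nat

/-- The axiom scheme covers formulas with parameters, so induction in a model is restricted to
definable predicates, though it reaches nonstandard numbers as well. -/
theorem ind {P : 𝔐.N → Prop} [hP : IsDefRel (fun p : 𝔐.N × Tail 𝔐.toStr => P p.1)]
    (h0 : P (𝔐.co Const.zero)) (hs : ∀ n, P n → P (𝔐.ap (𝔐.co Const.succ) n)) (n : 𝔐.N) : P n := by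
  obtain ⟨Δ, e, φ, hφ⟩ := hP.out
  have h := sat_postulate (Postulate.induction (Γ := Δ) φ) e
  simp only [sat] at h
  refine (hφ (n, Tail.nil)).2 (h ⟨?_, fun d hd => ?_⟩ n)
  · rw [Formula.inst, sat_subst]
    refine (congrArg (fun E : 𝔐.Env (Ty.nat :: Δ) => sat E φ) (Env.ext fun τ x => ?_)).mpr
      ((hφ (_, Tail.nil)).1 h0)
    cases x <;> rfl
  · rw [sat_subst]
    refine (congrArg (fun E : 𝔐.Env (Ty.nat :: Δ) => sat E φ) (Env.ext fun τ x => ?_)).mpr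
      ((hφ (_, Tail.nil)).1 (hs d ((hφ (d, Tail.nil)).2 hd)))
    cases x <;> rfl

/-- Countable choice for arbitrary definable relations, taken from dependent choice with a relation
that ignores the previous value. Quantifier-free choice would not suffice, since the relation used
later contains quantifiers. -/
theorem exists_seq {P : 𝔐.N → 𝔐.N → Prop}
    [hP : IsDefRel (fun p : 𝔐.N × 𝔐.N × Tail 𝔐.toStr => P p.2.1 p.1)] (h : ∀ m, ∃ k, P m k) :
    ∃ F : 𝔐.D Ty.one, ∀ m, P m (𝔐.ap F m) := by
  obtain ⟨Δ, e, φ, hφ⟩ := hP.out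
  let θ : Sub (Ty.nat :: Ty.nat :: Δ) (Ty.nat :: Ty.nat :: Ty.nat :: Δ) :=
    Sub.cons Term.v0 (Sub.cons Term.v2 fun _ x => Term.var (Var.there (Var.there (Var.there x))))
  have key : ∀ (z y x : 𝔐.N), sat (Env.cons z (Env.cons y (Env.cons x e))) (φ.subst θ) ↔
      P x z := by
    intro z y x
    rw [sat_subst, hφ (z, x, Tail.nil)]
    refine iff_of_eq (congrArg (fun E => sat E φ) (Env.ext fun τ v => ?_))
    cases v with
    | here => rfl
    | there v => cases v <;> rfl
  have hdc := sat_postulate (Postulate.dc (Γ := Δ) [Ty.nat] (φ.subst θ)) e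
  obtain ⟨f, hf⟩ := hdc fun x y => by
    obtain ⟨z, hz⟩ := h x
    exact ⟨z, (key z y x).2 hz⟩
  -- Dependent choice relates x to the value at x + 1, hence the shift by one.
  obtain ⟨F, hF⟩ := exists_lam (𝔐 := 𝔐) (fun x : 𝔐.N => 𝔐.ap f (𝔐.ap (𝔐.co Const.succ) x))
  refine ⟨F, fun m => ?_⟩
  rw [hF, ← key _ (𝔐.ap f m)]
  have := hf m
  simp only [depMatrix] at this
  rw [sat_subst] at this
  refine (congrArg (fun E : 𝔐.Env (Ty.nat :: Ty.nat :: Ty.nat :: Δ) => sat E (φ.subst θ))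
    (Env.ext fun τ v => ?_)).mpr this
  cases v with
  | here => rfl
  | there v =>
    cases v with
    | here => rfl
    | there v =>
      cases v with
      | here => rfl
      | there v => rfl

end Model

namespace Str

variable {𝔐 : Str} {X : Type} [Coord 𝔐 X]

/-- Operations of the model that are introduced as values of terms become definable at once. -/
theorem IsDef.tm1 {σ τ : Ty} (t : Term [σ] τ) (f : X → 𝔐.D σ) [hf : IsDef f] :
    IsDef (fun x => tm (Env.cons (f x) Env.nil) t) := by
  obtain ⟨Δ, e, s, hs⟩ := hf.out
  refine ⟨Δ, e, t.subst (Sub.cons s fun τ x => ((Var.isEmpty τ).false x).elim), fun x => ?_⟩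
  rw [tm_subst]
  congr 1
  refine Env.ext fun τ v => ?_
  cases v with
  | here => exact hs x
  | there v => exact nomatch v

theorem IsDef.tm2 {σ ρ τ : Ty} (t : Term [σ, ρ] τ) (f : X → 𝔐.D σ) (g : X → 𝔐.D ρ)
    [hf : IsDef f] [hg : IsDef g] :
    IsDef (fun x => tm (Env.cons (f x) (Env.cons (g x) Env.nil)) t) := by
  obtain ⟨Δ, e, s, hs⟩ := hf.out
  obtain ⟨Δ', e', r, hr⟩ := hg.out
  refine ⟨Δ ++ Δ', Env.append e e', t.subst (Sub.cons (s.subst (renL _ _ _))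
    (Sub.cons (r.subst (renR _ _ _)) fun τ x => ((Var.isEmpty τ).false x).elim)), fun x => ?_⟩
  rw [tm_subst]
  congr 1
  refine Env.ext fun τ v => ?_
  cases v with
  | here => rw [Sub.cons_here, tm_subst, renL_env, Env.cons_here, hs]
  | there v =>
    cases v with
    | here => rw [Sub.cons_there, Sub.cons_here, tm_subst, renR_env, Env.cons_there,
        Env.cons_here, hr]
    | there v => exact nomatch v

end Str

namespace Model

open Str

variable {𝔐 : Model}

/-! ### Primitive recursion -/

def recC (ρ : Ty) : 𝔐.D (Ty.nat ⇒ ρ ⇒ (ρ ⇒ Ty.nat ⇒ ρ) ⇒ ρ) :=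
  𝔐.co (Const.recur [ρ] Var.here)

def recur {ρ : Ty} (n : 𝔐.N) (a : 𝔐.D ρ) (f : 𝔐.D (ρ ⇒ Ty.nat ⇒ ρ)) : 𝔐.D ρ :=
  𝔐.ap (𝔐.ap (𝔐.ap (recC ρ) n) a) f

def S (n : 𝔐.N) : 𝔐.N := 𝔐.ap (𝔐.co Const.succ) n

instance : Zero 𝔐.N := ⟨𝔐.co Const.zero⟩
instance : One 𝔐.N := ⟨S 0⟩

instance isDef_S {X : Type} [Coord 𝔐.toStr X] (f : X → 𝔐.N) [IsDef f] :
    IsDef (fun x => S (f x)) :=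
  inferInstanceAs (IsDef fun x => 𝔐.ap (𝔐.co Const.succ) (f x))

instance isDef_recur {X : Type} [Coord 𝔐.toStr X] {ρ : Ty} (n : X → 𝔐.N) (a : X → 𝔐.D ρ)
    (f : X → 𝔐.D (ρ ⇒ Ty.nat ⇒ ρ)) [IsDef n] [IsDef a] [IsDef f] :
    IsDef (fun x => recur (n x) (a x) (f x)) :=
  inferInstanceAs (IsDef fun x => 𝔐.ap (𝔐.ap (𝔐.ap (recC ρ) (n x)) (a x)) (f x))

@[simp] theorem recur_zero {ρ : Ty} (a : 𝔐.D ρ) (f : 𝔐.D (ρ ⇒ Ty.nat ⇒ ρ)) :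
    recur 0 a f = a := 𝔐.rec_zero a f

@[simp] theorem recur_S {ρ : Ty} (n : 𝔐.N) (a : 𝔐.D ρ) (f : 𝔐.D (ρ ⇒ Ty.nat ⇒ ρ)) :
    recur (S n) a f = 𝔐.ap (𝔐.ap f (recur n a f)) n := 𝔐.rec_succ n a f

theorem induct {P : 𝔐.N → Prop}
    (isDef : IsDefRel (fun p : 𝔐.N × Tail 𝔐.toStr => P p.1)) (h0 : P 0)
    (hs : ∀ n, P n → P (S n)) (n : 𝔐.N) : P n := ind h0 hs n

/-- Pointwise equal step functionals need not be identical elements of a model, so replacing one by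
the other inside a recursor takes an induction. The value of an arithmetical term is seen in this
way to depend only on the values of its parts. -/
theorem recur_congr {n : 𝔐.N} {a : 𝔐.N} {f g : 𝔐.D (Ty.nat ⇒ Ty.nat ⇒ Ty.nat)}
    (h : ∀ p k, 𝔐.ap (𝔐.ap f p) k = 𝔐.ap (𝔐.ap g p) k) : recur n a f = recur n a g := by
  induction n using induct with
  | isDef => infer_instance
  | h0 => simp
  | hs n ih => simp [ih, h]

section
variable {Γ : List Ty} (e : 𝔐.Env Γ)

@[simp] theorem tm_recT {ρ : Ty} (n : Term Γ Ty.nat) (a : Term Γ ρ)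
    (f : Term Γ (ρ ⇒ Ty.nat ⇒ ρ)) :
    tm e (Term.recT n a f) = recur (tm e n) (tm e a) (tm e f) := by
  simp only [Term.recT]; rfl

@[simp] theorem tm_zero : tm e Term.zero = (0 : 𝔐.N) := by
  simp only [Term.zero, tm_const]; rfl

@[simp] theorem tm_succ (t : Term Γ Ty.nat) : tm e (Term.succ t) = S (tm e t) := by
  simp [Term.succ, S]

@[simp] theorem ap_lam {σ τ : Ty} (t : Term (σ :: Γ) τ) (d : 𝔐.D σ) :
    𝔐.ap (tm e (Term.lam t)) d = tm (Env.cons d e) t := ap_tm_lam e t d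

theorem caseZero_zero {ρ : Ty} {c : Term Γ Ty.nat} (a b : Term Γ ρ) (h : tm e c = 0) :
    tm e (Term.caseZero c a b) = tm e a := by
  simp [Term.caseZero, h]

theorem caseZero_S {ρ : Ty} {c : Term Γ Ty.nat} (a b : Term Γ ρ) {k : 𝔐.N}
    (h : tm e c = S k) : tm e (Term.caseZero c a b) = tm e b := by
  simp [Term.caseZero, h]

end

theorem S_ne_zero (n : 𝔐.N) : S n ≠ 0 := by
  have := sat_postulate (𝔐 := 𝔐) (Postulate.succ_ne_zero (Γ := [Ty.nat]) Term.v0)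
    (Env.cons n Env.nil)
  simpa [sat, Formula.neg] using this

theorem S_inj {m n : 𝔐.N} (h : S m = S n) : m = n := by
  have := sat_postulate (𝔐 := 𝔐) (Postulate.succ_inj (Γ := [Ty.nat, Ty.nat]) Term.v0 Term.v1)
    (Env.cons m (Env.cons n Env.nil))
  simp only [sat, tm_succ, tm_var, Env.cons_here, Env.cons_there] at this
  exact this h

theorem eq_zero_or_S (n : 𝔐.N) : n = 0 ∨ ∃ k, n = S k := by
  induction n using induct with
  | isDef => infer_instance
  | h0 => exact Or.inl rfl
  | hs n _ => exact Or.inr ⟨n, rfl⟩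

/-! ### Addition and multiplication -/

def pair2 (a b : 𝔐.N) : 𝔐.Env [Ty.nat, Ty.nat] := Env.cons a (Env.cons b Env.nil)

instance : Add 𝔐.N := ⟨fun a b => tm (pair2 a b) (Term.add Term.v0 Term.v1)⟩
instance : Mul 𝔐.N := ⟨fun a b => tm (pair2 a b) (Term.mul Term.v0 Term.v1)⟩
instance : _root_.Sub 𝔐.N := ⟨fun a b => tm (pair2 a b) (Term.sub Term.v0 Term.v1)⟩
def pred (a : 𝔐.N) : 𝔐.N := tm (Env.cons a Env.nil) (Term.pred Term.v0)
def pow2 (a : 𝔐.N) : 𝔐.N := tm (Env.cons a Env.nil) (Term.pow2 Term.v0)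
def parity (a : 𝔐.N) : 𝔐.N := tm (Env.cons a Env.nil) (Term.parity Term.v0)
def half (a : 𝔐.N) : 𝔐.N := tm (Env.cons a Env.nil) (Term.half Term.v0)

section
variable {X : Type} [Coord 𝔐.toStr X] (f g : X → 𝔐.N) [IsDef f] [IsDef g]

instance isDef_add : IsDef (fun x => f x + g x) := IsDef.tm2 _ f g
instance isDef_mul : IsDef (fun x => f x * g x) := IsDef.tm2 _ f g
instance isDef_sub : IsDef (fun x => f x - g x) := IsDef.tm2 _ f g
instance isDef_pred : IsDef (fun x => pred (f x)) := IsDef.tm1 _ f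
instance isDef_pow2 : IsDef (fun x => pow2 (f x)) := IsDef.tm1 _ f
instance isDef_parity : IsDef (fun x => parity (f x)) := IsDef.tm1 _ f
instance isDef_half : IsDef (fun x => half (f x)) := IsDef.tm1 _ f

end

section
variable {Γ : List Ty} (e : 𝔐.Env Γ) (s t : Term Γ Ty.nat)

theorem add_def (a b : 𝔐.N) : a + b = tm (pair2 a b) (Term.add Term.v0 Term.v1) := rfl
theorem mul_def (a b : 𝔐.N) : a * b = tm (pair2 a b) (Term.mul Term.v0 Term.v1) := rfl
theorem sub_def (a b : 𝔐.N) : a - b = tm (pair2 a b) (Term.sub Term.v0 Term.v1) := rfl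

@[simp] theorem tm_add : tm e (Term.add s t) = tm e s + tm e t := by
  simp only [add_def, Term.add, tm_recT, pair2]
  exact recur_congr (by simp)

@[simp] theorem tm_pred : tm e (Term.pred t) = pred (tm e t) := by
  simp only [pred, Term.pred, tm_recT, tm_zero]
  exact recur_congr (by simp)

@[simp] theorem tm_sub : tm e (Term.sub s t) = tm e s - tm e t := by
  simp only [sub_def, Term.sub, tm_recT, pair2]
  exact recur_congr (by simp)

@[simp] theorem tm_mul : tm e (Term.mul s t) = tm e s * tm e t := by
  simp only [mul_def, Term.mul, tm_recT, pair2, tm_zero]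
  exact recur_congr (by simp)

@[simp] theorem tm_one : tm e Term.one = (1 : 𝔐.N) := by
  simp only [Term.one, tm_succ, tm_zero]; rfl

@[simp] theorem tm_pow2 : tm e (Term.pow2 t) = pow2 (tm e t) := by
  simp only [pow2, Term.pow2, tm_recT, tm_one]
  exact recur_congr (by simp)

@[simp] theorem tm_parity : tm e (Term.parity t) = parity (tm e t) := by
  simp only [parity, Term.parity, tm_recT, tm_zero]
  exact recur_congr (by simp)

@[simp] theorem tm_half : tm e (Term.half t) = half (tm e t) := by
  simp only [half, Term.half, tm_recT, tm_zero]
  exact recur_congr (by simp)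

end

theorem add_zero' (a : 𝔐.N) : a + 0 = a := by simp [add_def, Term.add, pair2]

theorem add_S (a b : 𝔐.N) : a + S b = S (a + b) := by
  have h := tm_add (pair2 a b) Term.v0 (Term.succ Term.v1)
  rw [add_def a b]
  simp [Term.add, pair2] at h ⊢
  exact h.symm

theorem mul_zero' (a : 𝔐.N) : a * 0 = 0 := by simp [mul_def, Term.mul, pair2]

theorem mul_S (a b : 𝔐.N) : a * S b = a * b + a := by
  have h := tm_mul (pair2 a b) Term.v0 (Term.succ Term.v1)
  rw [mul_def a b]
  simp [Term.mul, pair2] at h ⊢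
  exact h.symm

@[simp] theorem pred_zero : pred (0 : 𝔐.N) = 0 := by simp [pred, Term.pred]

@[simp] theorem pred_S (a : 𝔐.N) : pred (S a) = a := by simp [pred, Term.pred]

theorem sub_zero' (a : 𝔐.N) : a - 0 = a := by simp [sub_def, Term.sub, pair2]

theorem sub_S (a b : 𝔐.N) : a - S b = pred (a - b) := by
  have h := tm_sub (pair2 a b) Term.v0 (Term.succ Term.v1)
  rw [sub_def a b]
  simp [Term.sub, pair2] at h ⊢
  exact h.symm

@[simp] theorem pow2_zero : pow2 (0 : 𝔐.N) = 1 := by simp [pow2, Term.pow2]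

theorem pow2_S (a : 𝔐.N) : pow2 (S a) = pow2 a + pow2 a := by
  have h := tm_pow2 (Env.cons a Env.nil) (Term.succ Term.v0)
  have e : pow2 a = tm (Env.cons a Env.nil) (Term.pow2 Term.v0) := rfl
  rw [e]
  simp [Term.pow2] at h ⊢
  exact h.symm

@[simp] theorem parity_zero : parity (0 : 𝔐.N) = 0 := by simp [parity, Term.parity]

theorem parity_S (a : 𝔐.N) : parity (S a) = 1 - parity a := by
  have h := tm_parity (Env.cons a Env.nil) (Term.succ Term.v0)
  have e : parity a = tm (Env.cons a Env.nil) (Term.parity Term.v0) := rfl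
  rw [e]
  simp [Term.parity] at h ⊢
  exact h.symm

@[simp] theorem half_zero : half (0 : 𝔐.N) = 0 := by simp [half, Term.half]

theorem half_S (a : 𝔐.N) : half (S a) = half a + parity a := by
  have h := tm_half (Env.cons a Env.nil) (Term.succ Term.v0)
  have e : half a = tm (Env.cons a Env.nil) (Term.half Term.v0) := rfl
  rw [e]
  simp [Term.half] at h ⊢
  exact h.symm

theorem zero_add' (a : 𝔐.N) : 0 + a = a := by
  induction a using induct with
  | isDef => infer_instance
  | h0 => exact add_zero' 0
  | hs a ih => rw [add_S, ih]

theorem S_add (a b : 𝔐.N) : S a + b = S (a + b) := by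
  induction b using induct with
  | isDef => infer_instance
  | h0 => simp only [add_zero']
  | hs b ih => rw [add_S, ih, add_S]

theorem add_comm' (a b : 𝔐.N) : a + b = b + a := by
  induction b using induct with
  | isDef => infer_instance
  | h0 => rw [add_zero', zero_add']
  | hs b ih => rw [add_S, ih, S_add]

theorem add_assoc' (a b c : 𝔐.N) : a + b + c = a + (b + c) := by
  induction c using induct with
  | isDef => infer_instance
  | h0 => simp only [add_zero']
  | hs c ih => simp only [add_S, ih]

instance : AddCommMonoid 𝔐.N where
  add_assoc := add_assoc'
  zero_add := zero_add'
  add_zero := add_zero'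
  add_comm := add_comm'
  nsmul := nsmulRec

theorem zero_mul' (a : 𝔐.N) : 0 * a = 0 := by
  induction a using induct with
  | isDef => infer_instance
  | h0 => exact mul_zero' 0
  | hs a ih => rw [mul_S, ih, add_zero]

theorem S_mul (a b : 𝔐.N) : S a * b = a * b + b := by
  induction b using induct with
  | isDef => infer_instance
  | h0 => simp only [mul_zero', add_zero]
  | hs b ih => rw [mul_S, ih, mul_S, add_S, add_S, add_right_comm]

theorem mul_comm' (a b : 𝔐.N) : a * b = b * a := by
  induction b using induct with
  | isDef => infer_instance
  | h0 => rw [mul_zero', zero_mul']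
  | hs b ih => rw [mul_S, ih, S_mul]

theorem mul_add' (a b c : 𝔐.N) : a * (b + c) = a * b + a * c := by
  induction c using induct with
  | isDef => infer_instance
  | h0 => rw [mul_zero', add_zero, add_zero]
  | hs c ih => rw [add_S, mul_S, mul_S, ih, add_assoc]

theorem mul_assoc' (a b c : 𝔐.N) : a * b * c = a * (b * c) := by
  induction c using induct with
  | isDef => infer_instance
  | h0 => simp only [mul_zero']
  | hs c ih => rw [mul_S, mul_S, mul_add', ih]

theorem mul_one' (a : 𝔐.N) : a * 1 = a := by
  rw [show (1 : 𝔐.N) = S 0 from rfl, mul_S, mul_zero', zero_add]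

instance : CommSemiring 𝔐.N where
  mul_assoc := mul_assoc'
  mul_comm := mul_comm'
  left_distrib := mul_add'
  right_distrib a b c := by rw [mul_comm', mul_add', mul_comm' c a, mul_comm' c b]
  zero_mul := zero_mul'
  mul_zero := mul_zero'
  one_mul a := by rw [mul_comm', mul_one']
  mul_one := mul_one'

theorem S_eq (a : 𝔐.N) : S a = a + 1 := by
  rw [show (1 : 𝔐.N) = S 0 from rfl, add_S, add_zero]

theorem induction {P : 𝔐.N → Prop}
    (isDef : IsDefRel (fun p : 𝔐.N × Tail 𝔐.toStr => P p.1))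
    (zero : P 0) (succ : ∀ n, P n → P (n + 1)) (n : 𝔐.N) : P n :=
  induct isDef zero (fun n h => by rw [S_eq]; exact succ n h) n

/-! ### The order -/

instance : LE 𝔐.N := ⟨fun a b => ∃ c, b = a + c⟩

theorem le_iff {a b : 𝔐.N} : a ≤ b ↔ ∃ c, b = a + c := Iff.rfl

theorem add_right_cancel' {a b c : 𝔐.N} (h : a + c = b + c) : a = b := by
  induction c using induct with
  | isDef => infer_instance
  | h0 => simpa using h
  | hs c ih => exact ih (S_inj (by simpa only [add_S] using h))

theorem eq_zero_of_add {a b : 𝔐.N} (h : a + b = 0) : b = 0 := by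
  rcases eq_zero_or_S b with rfl | ⟨k, rfl⟩
  · rfl
  · rw [add_S] at h
    exact absurd h (S_ne_zero _)

theorem le_total' (a b : 𝔐.N) : a ≤ b ∨ b ≤ a := by
  simp only [le_iff]
  induction b using induct with
  | isDef => infer_instance
  | h0 => exact Or.inr ⟨a, (zero_add a).symm⟩
  | hs b ih =>
    rcases ih with ⟨c, rfl⟩ | ⟨c, rfl⟩
    · exact Or.inl ⟨S c, (add_S _ _).symm⟩
    · rcases eq_zero_or_S c with rfl | ⟨k, rfl⟩
      · exact Or.inl ⟨1, by rw [S_eq, add_zero]⟩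
      · exact Or.inr ⟨k, by rw [add_S, S_add]⟩

open Classical in
noncomputable instance : LinearOrder 𝔐.N where
  le_refl a := ⟨0, (add_zero a).symm⟩
  le_trans := by
    rintro a b c ⟨d, rfl⟩ ⟨d', rfl⟩
    exact ⟨d + d', add_assoc _ _ _⟩
  le_antisymm := by
    rintro a b ⟨d, rfl⟩ ⟨d', h⟩
    have : d + d' = 0 := add_right_cancel' (c := a) (by rw [zero_add]; nth_rw 2 [h]; ring)
    rw [add_comm] at this
    rw [eq_zero_of_add this, add_zero]
  le_total := le_total'
  toDecidableLE := inferInstance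

instance : IsOrderedCancelAddMonoid 𝔐.N where
  add_le_add_left := by
    rintro a b ⟨d, rfl⟩ c
    exact ⟨d, by ring⟩
  le_of_add_le_add_left := by
    rintro a b c ⟨d, h⟩
    exact ⟨d, add_right_cancel' (c := a) (by rw [add_comm, h]; ring)⟩

instance : CanonicallyOrderedAdd 𝔐.N where
  exists_add_of_le h := h
  le_add_self _ b := ⟨b, add_comm _ _⟩
  le_self_add _ b := ⟨b, rfl⟩

theorem lt_iff_add_one_le {a b : 𝔐.N} : a < b ↔ a + 1 ≤ b := by
  constructor
  · intro h
    obtain ⟨c, rfl⟩ := h.le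
    rcases eq_zero_or_S c with rfl | ⟨k, rfl⟩
    · simp at h
    · exact ⟨k, by rw [S_eq]; ring⟩
  · rintro ⟨c, rfl⟩
    refine lt_of_le_of_ne ⟨1 + c, by ring⟩ fun h => S_ne_zero c ?_
    have : (c + 1) + a = 0 + a := by rw [zero_add]; nth_rw 2 [h]; ring
    rw [S_eq]
    exact add_right_cancel' this

theorem mul_lt_mul_left' {a b c : 𝔐.N} (ha : 0 < a) (h : b < c) : a * b < a * c := by
  rw [lt_iff_add_one_le] at ha h ⊢
  obtain ⟨d, rfl⟩ := ha
  obtain ⟨e, rfl⟩ := h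
  exact ⟨d + e + d * e, by ring⟩

instance : IsStrictOrderedRing 𝔐.N where
  zero_le_one := zero_le
  exists_pair_ne := ⟨0, 1, fun h => S_ne_zero 0 h.symm⟩
  mul_lt_mul_of_pos_left _ ha _ _ h := mul_lt_mul_left' ha h
  mul_lt_mul_of_pos_right a ha b c h := by
    simp only [mul_comm _ a]
    exact mul_lt_mul_left' ha h

theorem lt_add_one_iff {a b : 𝔐.N} : a < b + 1 ↔ a ≤ b := by
  rw [lt_iff_add_one_le]
  exact add_le_add_iff_right 1

theorem pred_sub (a b : 𝔐.N) : pred (a - b) = pred a - b := by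
  induction b using induct with
  | isDef => infer_instance
  | h0 => simp [sub_zero']
  | hs b ih => rw [sub_S, sub_S, ih]

theorem S_sub_S (a b : 𝔐.N) : S a - S b = a - b := by
  rw [sub_S, pred_sub, pred_S]

theorem sub_self' (a : 𝔐.N) : a - a = 0 := by
  induction a using induct with
  | isDef => infer_instance
  | h0 => exact sub_zero' 0
  | hs a ih => rw [S_sub_S, ih]

theorem add_sub_cancel' (a b : 𝔐.N) : a + b - b = a := by
  induction b using induct with
  | isDef => infer_instance
  | h0 => rw [add_zero, sub_zero']
  | hs b ih => rw [add_S, S_sub_S, ih]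

theorem zero_sub' (b : 𝔐.N) : 0 - b = 0 := by
  induction b using induct with
  | isDef => infer_instance
  | h0 => rw [sub_zero']
  | hs b ih => rw [sub_S, ih, pred_zero]

theorem sub_add' (a b c : 𝔐.N) : a - (b + c) = a - b - c := by
  induction c using induct with
  | isDef => infer_instance
  | h0 => rw [add_zero, sub_zero']
  | hs c ih => rw [add_S, sub_S, ih, sub_S]

theorem sub_eq_zero_iff {a b : 𝔐.N} : a - b = 0 ↔ a ≤ b := by
  constructor
  · intro h
    rcases le_total a b with h' | ⟨c, rfl⟩
    · exact h'
    · rw [add_comm, add_sub_cancel'] at h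
      simp [h]
  · rintro ⟨c, rfl⟩
    rw [sub_add', sub_self', zero_sub']

theorem sub_add_cancel' {a b : 𝔐.N} (h : b ≤ a) : a - b + b = a := by
  obtain ⟨c, rfl⟩ := h
  rw [add_comm b c, add_sub_cancel']

section
variable {X : Type} [Coord 𝔐.toStr X] (f g : X → 𝔐.N) [IsDef f] [IsDef g]

instance isDefRel_le : IsDefRel (fun x => f x ≤ g x) :=
  IsDefRel.of_iff (fun x => f x - g x = 0) fun _ => sub_eq_zero_iff.symm

instance isDefRel_lt : IsDefRel (fun x => f x < g x) :=
  IsDefRel.of_iff (fun x => ¬ g x ≤ f x) fun _ => not_le.symm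

end

section
variable {Γ : List Ty} (e : 𝔐.Env Γ) (s t : Term Γ Ty.nat)

@[simp] theorem sat_le : sat e (Formula.le s t) ↔ tm e s ≤ tm e t := by
  simp [Formula.le, sat, sub_eq_zero_iff]

@[simp] theorem sat_lt : sat e (Formula.lt s t) ↔ tm e s < tm e t := by
  simp [Formula.lt, S_eq, lt_iff_add_one_le]

@[simp] theorem tm_two : tm e Term.two = (2 : 𝔐.N) := by
  simp only [Term.two, tm_succ, tm_one, S_eq]; norm_num

@[simp] theorem tm_three : tm e Term.three = (3 : 𝔐.N) := by
  simp only [Term.three, tm_succ, tm_two, S_eq]; norm_num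

@[simp] theorem tm_dist : tm e (Term.dist s t) = (tm e s - tm e t) + (tm e t - tm e s) := by
  simp [Term.dist]

end

theorem dist_eq_zero {a b : 𝔐.N} : (a - b) + (b - a) = 0 ↔ a = b := by
  rw [add_eq_zero, sub_eq_zero_iff, sub_eq_zero_iff]
  exact ⟨fun h => le_antisymm h.1 h.2, fun h => ⟨h.le, h.ge⟩⟩

theorem parity_two_mul (a : 𝔐.N) : parity (2 * a) = 0 ∧ half (2 * a) = a := by
  induction a using induction with
  | isDef => infer_instance
  | zero => simp
  | succ a ih =>
    have h : 2 * (a + 1) = S (S (2 * a)) := by simp only [S_eq]; ring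
    have h1 : (1 : 𝔐.N) - 1 = 0 := sub_self' 1
    rw [h, parity_S, parity_S, half_S, half_S, parity_S, ih.1, ih.2, sub_zero', h1]
    simp

theorem parity_two_mul_add_one (a : 𝔐.N) :
    parity (2 * a + 1) = 1 ∧ half (2 * a + 1 + 1) = a + 1 := by
  rw [← S_eq, ← S_eq, parity_S, half_S, half_S, parity_S, (parity_two_mul a).1,
    (parity_two_mul a).2, sub_zero', add_zero]
  exact ⟨rfl, rfl⟩

theorem even_or_odd (a : 𝔐.N) : (∃ k, a = 2 * k) ∨ ∃ k, a = 2 * k + 1 := by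
  induction a using induction with
  | isDef => infer_instance
  | zero => exact Or.inl ⟨0, by simp⟩
  | succ a ih =>
    rcases ih with ⟨k, rfl⟩ | ⟨k, rfl⟩
    · exact Or.inr ⟨k, rfl⟩
    · exact Or.inl ⟨k + 1, by ring⟩

theorem pow2_succ (a : 𝔐.N) : pow2 (a + 1) = 2 * pow2 a := by
  rw [← S_eq, pow2_S, two_mul]

theorem pow2_pos (a : 𝔐.N) : 0 < pow2 a := by
  induction a using induction with
  | isDef => infer_instance
  | zero => simp
  | succ a ih => rw [pow2_succ]; positivity

theorem pow2_add (a b : 𝔐.N) : pow2 (a + b) = pow2 a * pow2 b := by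
  induction b using induction with
  | isDef => infer_instance
  | zero => simp
  | succ b ih => rw [← add_assoc, pow2_succ, ih, pow2_succ]; ring

theorem lt_pow2 (a : 𝔐.N) : a < pow2 a := by
  induction a using induction with
  | isDef => infer_instance
  | zero => simp
  | succ a ih =>
    rw [pow2_succ, lt_iff_add_one_le]
    rw [lt_iff_add_one_le] at ih
    calc a + 1 + 1 ≤ pow2 a + 1 := by gcongr
      _ ≤ pow2 a + pow2 a := by gcongr; exact le_trans (by simp) ih
      _ = _ := (two_mul _).symm

theorem pred_add_one {a : 𝔐.N} (h : 0 < a) : pred a + 1 = a := by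
  rcases eq_zero_or_S a with rfl | ⟨k, rfl⟩
  · exact absurd h (lt_irrefl _)
  · rw [pred_S, S_eq]

end Model

/-! ### The ordered field of fractions of a canonically ordered semiring -/

section
variable (M : Type) [CommSemiring M] [LinearOrder M] [IsStrictOrderedRing M]

/-- Formal differences. -/
def diffSetoid : Setoid (M × M) where
  r p q := p.1 + q.2 = q.1 + p.2
  iseqv := ⟨fun _ => rfl, fun h => h.symm, fun {p q r} h h' => by
    have : (p.1 + r.2) + q.2 = (r.1 + p.2) + q.2 := by
      calc (p.1 + r.2) + q.2 = (p.1 + q.2) + r.2 := by ring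
        _ = (q.1 + r.2) + p.2 := by rw [h]; ring
        _ = _ := by rw [h']; ring
    exact add_right_cancel this⟩

def Diff : Type := Quotient (diffSetoid M)

namespace Diff

variable {M}

def mk (a b : M) : Diff M := Quotient.mk (diffSetoid M) (a, b)

theorem ind {P : Diff M → Prop} (h : ∀ a b, P (mk a b)) (x : Diff M) : P x :=
  Quotient.ind (fun p => h p.1 p.2) x

theorem mk_eq {a b c d : M} : mk a b = mk c d ↔ a + d = c + b := Quotient.eq

instance : Zero (Diff M) := ⟨mk 0 0⟩
instance : One (Diff M) := ⟨mk 1 0⟩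

instance : Add (Diff M) := ⟨Quotient.lift₂ (fun p q => mk (p.1 + q.1) (p.2 + q.2)) (by
  rintro ⟨a, b⟩ ⟨c, d⟩ ⟨a', b'⟩ ⟨c', d'⟩ (h : a + b' = a' + b) (h' : c + d' = c' + d)
  rw [mk_eq]
  dsimp only
  linear_combination h + h')⟩

instance : Neg (Diff M) := ⟨Quotient.lift (fun p => mk p.2 p.1) (by
  rintro ⟨a, b⟩ ⟨a', b'⟩ (h : a + b' = a' + b)
  rw [mk_eq]
  dsimp only
  linear_combination h.symm)⟩

instance : Mul (Diff M) :=
  ⟨Quotient.lift₂ (fun p q => mk (p.1 * q.1 + p.2 * q.2) (p.1 * q.2 + p.2 * q.1)) (by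
    rintro ⟨a, b⟩ ⟨c, d⟩ ⟨a', b'⟩ ⟨c', d'⟩ (h : a + b' = a' + b) (h' : c + d' = c' + d)
    rw [mk_eq]
    dsimp only
    have e : (a * c + b * d + (a' * d' + b' * c')) + (b' * c + a' * d) =
        (a' * c' + b' * d' + (a * d + b * c)) + (b' * c + a' * d) := by
      linear_combination c * h + d * h.symm + a' * h' + b' * h'.symm
    exact add_right_cancel e)⟩

theorem mk_add (a b c d : M) : mk a b + mk c d = mk (a + c) (b + d) := rfl
theorem mk_mul (a b c d : M) : mk a b * mk c d = mk (a * c + b * d) (a * d + b * c) := rfl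
theorem neg_mk (a b : M) : -mk a b = mk b a := rfl
theorem zero_def : (0 : Diff M) = mk 0 0 := rfl
theorem one_def : (1 : Diff M) = mk 1 0 := rfl

instance : CommRing (Diff M) where
  add_assoc := Diff.ind fun _ _ => Diff.ind fun _ _ => Diff.ind fun _ _ => by
    simp only [mk_add, add_assoc]
  zero_add := Diff.ind fun _ _ => by simp only [zero_def, mk_add, zero_add]
  add_zero := Diff.ind fun _ _ => by simp only [zero_def, mk_add, add_zero]
  add_comm := Diff.ind fun _ _ => Diff.ind fun _ _ => by
    rw [mk_add, mk_add, mk_eq]; ring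
  nsmul := nsmulRec
  zsmul := zsmulRec
  neg_add_cancel := Diff.ind fun _ _ => by
    rw [neg_mk, mk_add, zero_def, mk_eq]; ring
  mul_assoc := Diff.ind fun _ _ => Diff.ind fun _ _ => Diff.ind fun _ _ => by
    simp only [mk_mul, mk_eq]; ring
  mul_comm := Diff.ind fun _ _ => Diff.ind fun _ _ => by simp only [mk_mul, mk_eq]; ring
  left_distrib := Diff.ind fun _ _ => Diff.ind fun _ _ => Diff.ind fun _ _ => by
    simp only [mk_mul, mk_add, mk_eq]; ring
  right_distrib := Diff.ind fun _ _ => Diff.ind fun _ _ => Diff.ind fun _ _ => by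
    simp only [mk_mul, mk_add, mk_eq]; ring
  zero_mul := Diff.ind fun _ _ => by simp only [zero_def, mk_mul, mk_eq]; ring
  mul_zero := Diff.ind fun _ _ => by simp only [zero_def, mk_mul, mk_eq]; ring
  one_mul := Diff.ind fun _ _ => by simp only [one_def, mk_mul, mk_eq]; ring
  mul_one := Diff.ind fun _ _ => by simp only [one_def, mk_mul, mk_eq]; ring

def of : M →+* Diff M where
  toFun a := mk a 0
  map_zero' := rfl
  map_one' := rfl
  map_add' a b := by rw [mk_add, add_zero]
  map_mul' a b := by simp [mk_mul]

theorem of_injective : Function.Injective (of (M := M)) := fun a b h => by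
  simpa using mk_eq.1 h

variable [CanonicallyOrderedAdd M]

/-- In the canonical order the larger of two elements exceeds the smaller by an element of the
semiring, so every formal difference has a sign. Absence of zero divisors and the linear order on
`Frac` rest on this. -/
theorem eq_of_or (x : Diff M) : ∃ a : M, x = of a ∨ x = -of a := by
  induction x using Diff.ind with
  | h a b =>
    rcases le_total a b with h | h
    · obtain ⟨c, rfl⟩ := exists_add_of_le h
      exact ⟨c, Or.inr (mk_eq.2 (by ring))⟩
    · obtain ⟨c, rfl⟩ := exists_add_of_le h
      exact ⟨c, Or.inl (mk_eq.2 (by ring))⟩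

instance : Nontrivial (Diff M) := of_injective.nontrivial

instance : NoZeroDivisors (Diff M) where
  eq_zero_or_eq_zero_of_mul_eq_zero {x y} h := by
    obtain ⟨a, ha⟩ := eq_of_or x
    obtain ⟨b, hb⟩ := eq_of_or y
    have hab : of (a * b) = (0 : Diff M) := by
      rw [map_mul]
      rcases ha with rfl | rfl <;> rcases hb with rfl | rfl <;> simpa using h
    rw [← map_zero of, of_injective.eq_iff, mul_eq_zero] at hab
    rcases hab with rfl | rfl
    · left; rcases ha with rfl | rfl <;> simp
    · right; rcases hb with rfl | rfl <;> simp

instance : IsDomain (Diff M) := NoZeroDivisors.to_isDomain _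

end Diff

variable [CanonicallyOrderedAdd M]

/-- The field of fractions. -/
def Frac : Type := FractionRing (Diff M)

namespace Frac

variable {M}

noncomputable instance : Field (Frac M) := inferInstanceAs (Field (FractionRing (Diff M)))

noncomputable def of : M →+* Frac M := (algebraMap (Diff M) (FractionRing (Diff M))).comp Diff.of

theorem of_injective : Function.Injective (of (M := M)) :=
  (IsFractionRing.injective (Diff M) (FractionRing (Diff M))).comp Diff.of_injective

theorem of_ne_zero {a : M} (h : a ≠ 0) : of a ≠ (0 : Frac M) := by
  rwa [Ne, ← map_zero of, of_injective.eq_iff]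

theorem exists_eq (x : Frac M) : ∃ a b : M, b ≠ 0 ∧ (x = of a / of b ∨ x = -(of a / of b)) := by
  obtain ⟨y, z, hz, rfl⟩ :=
    IsFractionRing.div_surjective (A := Diff M) (K := FractionRing (Diff M)) x
  obtain ⟨a, ha⟩ := Diff.eq_of_or y
  obtain ⟨b, hb⟩ := Diff.eq_of_or z
  have hb0 : b ≠ 0 := by
    rintro rfl
    rcases hb with rfl | rfl <;> simp at hz
  refine ⟨a, b, hb0, ?_⟩
  rcases ha with rfl | rfl <;> rcases hb with rfl | rfl
  · exact Or.inl rfl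
  · right; rw [map_neg, div_neg]; rfl
  · right; rw [map_neg, neg_div]; rfl
  · left; rw [map_neg, map_neg, neg_div_neg_eq]; rfl

/-- The nonnegative elements. -/
noncomputable def cone : RingCone (Frac M) where
  carrier := {x | ∃ a b : M, b ≠ 0 ∧ x = of a / of b}
  zero_mem' := by simpa using ⟨0, 1, one_ne_zero, by simp⟩
  one_mem' := by simpa using ⟨1, 1, one_ne_zero, by simp⟩
  add_mem' := by
    simp only [Set.mem_ofPred_eq]
    rintro _ _ ⟨a, b, hb, rfl⟩ ⟨c, d, hd, rfl⟩
    refine ⟨a * d + b * c, b * d, mul_ne_zero hb hd, ?_⟩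
    rw [div_add_div _ _ (of_ne_zero hb) (of_ne_zero hd)]
    simp
  mul_mem' := by
    simp only [Set.mem_ofPred_eq]
    rintro _ _ ⟨a, b, hb, rfl⟩ ⟨c, d, hd, rfl⟩
    exact ⟨a * c, b * d, mul_ne_zero hb hd, by rw [div_mul_div_comm]; simp⟩
  eq_zero_of_mem_of_neg_mem' := by
    simp only [Set.mem_ofPred_eq]
    rintro _ ⟨a, b, hb, rfl⟩ ⟨c, d, hd, h⟩
    have hb' := of_ne_zero hb
    have hd' := of_ne_zero hd
    field_simp at h
    have h2 : of (a * d + b * c) = (0 : Frac M) := by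
      rw [map_add, map_mul, map_mul]; linear_combination -h
    rw [← map_zero of, of_injective.eq_iff, add_eq_zero, mul_eq_zero] at h2
    rcases h2.1 with rfl | h
    · simp
    · exact absurd h hd

theorem mem_cone {x : Frac M} : x ∈ cone ↔ ∃ a b : M, b ≠ 0 ∧ x = of a / of b := Iff.rfl

open Classical in
noncomputable instance : LinearOrder (Frac M) :=
  haveI : HasMemOrNegMem (cone (M := M)) := ⟨fun x => by
    obtain ⟨a, b, hb, rfl | rfl⟩ := exists_eq x
    · exact Or.inl (mem_cone.2 ⟨a, b, hb, rfl⟩)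
    · exact Or.inr (mem_cone.2 ⟨a, b, hb, neg_neg _⟩)⟩
  LinearOrder.mkOfAddGroupCone (cone (M := M))

theorem le_def {x y : Frac M} : x ≤ y ↔ ∃ a b : M, b ≠ 0 ∧ y - x = of a / of b := Iff.rfl

instance : IsStrictOrderedRing (Frac M) :=
  haveI : IsOrderedRing (Frac M) := IsOrderedRing.mkOfCone (cone (M := M))
  IsOrderedRing.toIsStrictOrderedRing _

theorem of_nonneg (a : M) : 0 ≤ (of a : Frac M) := le_def.2 ⟨a, 1, one_ne_zero, by simp⟩

theorem of_mono : StrictMono (of (M := M)) := by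
  refine Monotone.strictMono_of_injective (fun a b h => ?_) of_injective
  obtain ⟨c, rfl⟩ := exists_add_of_le h
  rw [map_add]
  exact le_add_of_nonneg_right (of_nonneg c)

end Frac
end

namespace Model

open Str

variable {𝔐 : Model}

/-! ### Bounded search and pairing -/

open Classical in
@[simp] theorem tm_caseZero {Γ : List Ty} (e : 𝔐.Env Γ) {ρ : Ty} (c : Term Γ Ty.nat)
    (a b : Term Γ ρ) :
    tm e (Term.caseZero c a b) = if tm e c = (0 : 𝔐.N) then tm e a else tm e b := by
  rcases eq_zero_or_S (tm e c) with h | ⟨k, h⟩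
  · rw [caseZero_zero e a b h, if_pos h]
  · rw [caseZero_S e a b h, if_neg (by rw [h]; exact S_ne_zero k)]

def least (f : 𝔐.D Ty.one) (n : 𝔐.N) : 𝔐.N :=
  tm (Env.cons f (Env.cons n Env.nil)) (Term.least Term.v0 Term.v1)

theorem tm_least {Γ : List Ty} (e : 𝔐.Env Γ) (f : Term Γ Ty.one) (n : Term Γ Ty.nat) :
    tm e (Term.least f n) = least (tm e f) (tm e n) := by
  simp only [least, Term.least, tm_recT, tm_zero]
  exact recur_congr (by simp)

theorem least_congr {f g : 𝔐.D Ty.one} (h : ∀ k, 𝔐.ap f k = 𝔐.ap g k) (n : 𝔐.N) :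
    least f n = least g n := by
  simp only [least, Term.least, tm_recT, tm_zero]
  exact recur_congr (by simp [h])

theorem least_zero (f : 𝔐.D Ty.one) : least f 0 = 0 := by
  simp [least, Term.least]

open Classical in
theorem least_succ (f : 𝔐.D Ty.one) (n : 𝔐.N) :
    least f (n + 1) = if 𝔐.ap f (least f n) = (0 : 𝔐.N) then least f n else n + 1 := by
  have h := tm_least (Env.cons f (Env.cons n Env.nil)) Term.v0 (Term.succ Term.v1)
  have e : least f n = tm (Env.cons f (Env.cons n Env.nil)) (Term.least Term.v0 Term.v1) := rfl
  rw [← S_eq, e]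
  simp [Term.least] at h ⊢
  exact h.symm

instance isDef_least {X : Type} [Coord 𝔐.toStr X] (f : X → 𝔐.D Ty.one) (n : X → 𝔐.N)
    [IsDef f] [IsDef n] : IsDef (fun x => least (f x) (n x)) := IsDef.tm2 _ f n

theorem least_spec (f : 𝔐.D Ty.one) (n : 𝔐.N) :
    least f n ≤ n ∧ (∀ k, k < least f n → 𝔐.ap f k ≠ (0 : 𝔐.N)) ∧
      (least f n < n → 𝔐.ap f (least f n) = (0 : 𝔐.N)) := by
  induction n using induction with
  | isDef => infer_instance
  | zero => simp [least_zero]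
  | succ n ih =>
    rw [least_succ]
    split_ifs with h
    · exact ⟨ih.1.trans (by simp), ih.2.1, fun _ => h⟩
    · refine ⟨le_rfl, fun k hk => ?_, fun h => absurd h (lt_irrefl _)⟩
      have hn : least f n = n := by
        by_contra hne
        exact h (ih.2.2 (lt_of_le_of_ne ih.1 hne))
      rw [hn] at ih h
      rcases (lt_add_one_iff.1 hk).lt_or_eq with hk | rfl
      · exact ih.2.1 k hk
      · exact h

theorem least_eq_of_ne {f : 𝔐.D Ty.one} {n : 𝔐.N} (h : ∀ k < n, 𝔐.ap f k ≠ (0 : 𝔐.N)) :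
    least f n = n := by
  by_contra hne
  have hlt := lt_of_le_of_ne (least_spec f n).1 hne
  exact h _ hlt ((least_spec f n).2.2 hlt)

theorem tm_bmin_eq {Γ : List Ty} (e : 𝔐.Env Γ) (f : Term Γ Ty.one) (n : Term Γ Ty.nat)
    {k : 𝔐.N} (hk : k ≤ tm e n) (h0 : 𝔐.ap (tm e f) k = (0 : 𝔐.N))
    (hlt : ∀ j < k, 𝔐.ap (tm e f) j ≠ (0 : 𝔐.N)) : tm e (Term.bmin f n) = k := by
  have hs := least_spec (tm e f) (tm e n)
  have hl : least (tm e f) (tm e n) = k := by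
    rcases lt_trichotomy (least (tm e f) (tm e n)) k with h | h | h
    · exact absurd (hs.2.2 (h.trans_le hk)) (hlt _ h)
    · exact h
    · exact absurd h0 (hs.2.1 k h)
  rw [Term.bmin, tm_caseZero, tm_app, tm_least, hl, if_pos h0]

/-- The searched functions are compared by their values only, since the two terms may live in
different contexts and denote different elements. -/
theorem tm_bmin_congr {Γ Δ : List Ty} (e : 𝔐.Env Γ) (e' : 𝔐.Env Δ) (f : Term Γ Ty.one)
    (n : Term Γ Ty.nat) (f' : Term Δ Ty.one) (n' : Term Δ Ty.nat)
    (h : ∀ k, 𝔐.ap (tm e f) k = 𝔐.ap (tm e' f') k) (hn : tm e n = tm e' n') :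
    tm e (Term.bmin f n) = tm e' (Term.bmin f' n') := by
  simp only [Term.bmin, tm_caseZero, tm_app, tm_least, tm_zero, hn, h, least_congr h]

def pair (a b : 𝔐.N) : 𝔐.N := tm (pair2 a b) (Term.pair Term.v0 Term.v1)
def fst (a : 𝔐.N) : 𝔐.N := tm (Env.cons a Env.nil) (Term.fst Term.v0)
def snd (a : 𝔐.N) : 𝔐.N := tm (Env.cons a Env.nil) (Term.snd Term.v0)

section
variable {Γ : List Ty} (e : 𝔐.Env Γ) (s t : Term Γ Ty.nat)

@[simp] theorem tm_pairBound : tm e (Term.pairBound s t) =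
    (tm e s + tm e t) * (tm e s + tm e t) + 3 * tm e s + tm e t := by
  simp [Term.pairBound]

@[simp] theorem tm_pair : tm e (Term.pair s t) = pair (tm e s) (tm e t) := by
  simp only [pair, Term.pair]
  exact tm_bmin_congr _ _ _ _ _ _ (by simp [pair2]) (by simp [pair2])

@[simp] theorem tm_fst : tm e (Term.fst t) = fst (tm e t) := by
  simp only [fst, Term.fst]
  refine tm_bmin_congr _ _ _ _ _ _ (fun k => ?_) (by simp)
  simp only [ap_lam, tm_dist, tm_pair, tm_wk, tm_var, Env.cons_here]
  rw [tm_bmin_congr (e' := Env.cons k (Env.cons (tm e t) Env.nil))]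
  · simp
  · simp

@[simp] theorem tm_snd : tm e (Term.snd t) = snd (tm e t) := by
  simp only [snd, Term.snd]
  exact tm_bmin_congr _ _ _ _ _ _ (by simp) (by simp)

end

theorem two_mul_cancel {a b : 𝔐.N} (h : 2 * a = 2 * b) : a = b := by
  have h1 := congrArg Frac.of h
  simp only [map_mul, map_ofNat] at h1
  exact Frac.of_injective (by linarith)

/-- With s = a + b the right side is s² + s + 2a, and s² + s is even; so the bounded search that
defines the code succeeds, and its result is unique. -/
theorem two_mul_pair (a b : 𝔐.N) : 2 * pair a b = (a + b) * (a + b) + 3 * a + b := by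
  have hex : ∃ u : 𝔐.N, 2 * u = (a + b) * (a + b) + 3 * a + b := by
    rcases even_or_odd (a + b) with ⟨k, hk⟩ | ⟨k, hk⟩
    · exact ⟨2 * k * k + k + a, by
        rw [show (a + b) * (a + b) + 3 * a + b = (a + b) * (a + b) + (a + b) + 2 * a by ring, hk]
        ring⟩
    · exact ⟨2 * k * k + 3 * k + 1 + a, by
        rw [show (a + b) * (a + b) + 3 * a + b = (a + b) * (a + b) + (a + b) + 2 * a by ring, hk]
        ring⟩
  obtain ⟨u, hu⟩ := hex
  have : pair a b = u := by
    refine tm_bmin_eq _ _ _ ?_ ?_ ?_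
    · simp only [tm_pairBound, tm_var, pair2, Env.cons_here, Env.cons_there]
      rw [← hu, two_mul]
      exact le_self_add
    · simp [pair2, hu, sub_self']
    · intro j hj h
      simp only [ap_lam, tm_dist, tm_mul, tm_two, tm_wk, tm_pairBound, tm_var, pair2,
        Env.cons_here, Env.cons_there, dist_eq_zero, ← hu] at h
      exact hj.ne (two_mul_cancel h)
  rw [this, hu]

/-- With s = a + b, twice the code is s² + s + 2a. As a ≤ s, this lies below (s + 1)(s + 2), which
is a lower bound for twice the code of any pair with larger sum. -/
theorem pair_inj_aux {a b c d : 𝔐.N} (h : pair a b = pair c d) : ¬ a + b < c + d := by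
  intro hlt
  have h2 : (a + b) * (a + b) + 3 * a + b = (c + d) * (c + d) + 3 * c + d := by
    rw [← two_mul_pair, h, two_mul_pair]
  rw [lt_iff_add_one_le] at hlt
  have h3 := Frac.of_mono.monotone hlt
  have h4 := congrArg Frac.of h2
  simp only [map_add, map_mul, map_one, map_ofNat] at h3 h4
  have ha := Frac.of_nonneg a
  have hb := Frac.of_nonneg b
  have hc := Frac.of_nonneg c
  have hd := Frac.of_nonneg d
  nlinarith

theorem pair_inj {a b c d : 𝔐.N} (h : pair a b = pair c d) : a = c ∧ b = d := by
  have hs : a + b = c + d := le_antisymm (not_lt.1 (pair_inj_aux h.symm))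
    (not_lt.1 (pair_inj_aux h))
  have h2 : 2 * a = 2 * c := by
    have h3 : (c + d) * (c + d) + (c + d) + 2 * a = (c + d) * (c + d) + (c + d) + 2 * c := by
      have h4 := two_mul_pair a b
      rw [h, two_mul_pair] at h4
      calc _ = (a + b) * (a + b) + 3 * a + b := by rw [← hs]; ring
        _ = _ := by rw [← h4]; ring
    exact add_left_cancel h3
  have hac := two_mul_cancel h2
  subst hac
  exact ⟨rfl, add_left_cancel hs⟩

theorem le_pair (a b : 𝔐.N) : a ≤ pair a b ∧ b ≤ pair a b := by
  have h := two_mul_pair a b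
  have key : ∀ c : 𝔐.N, 2 * c ≤ 2 * pair a b → c ≤ pair a b := fun c hc => by
    exact le_of_mul_le_mul_left hc (by simp)
  constructor
  · refine key a ?_
    rw [h]
    exact ⟨(a + b) * (a + b) + a + b, by ring⟩
  · refine key b ?_
    rw [h]
    rcases eq_zero_or_S b with rfl | ⟨k, rfl⟩
    · simp
    · exact ⟨(a + k) * (a + k) + 5 * a + k, by rw [S_eq]; ring⟩

@[simp] theorem fst_pair (a b : 𝔐.N) : fst (pair a b) = a := by
  refine tm_bmin_eq _ _ _ ?_ ?_ ?_
  · simpa using (le_pair a b).1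
  · simp only [ap_lam, tm_dist, tm_pair, tm_wk, tm_var, Env.cons_here, dist_eq_zero]
    congr 1
    refine tm_bmin_eq _ _ _ ?_ ?_ ?_
    · simpa using (le_pair a b).2
    · simp [sub_self']
    · intro j hj h
      simp only [ap_lam, tm_dist, tm_pair, tm_wk, tm_var, Env.cons_here, Env.cons_there,
        dist_eq_zero] at h
      exact hj.ne (pair_inj h).2
  · intro j hj h
    simp only [ap_lam, tm_dist, tm_pair, tm_wk, tm_var, Env.cons_here, dist_eq_zero] at h
    exact hj.ne (pair_inj h).1

@[simp] theorem snd_pair (a b : 𝔐.N) : snd (pair a b) = b := by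
  refine tm_bmin_eq _ _ _ ?_ ?_ ?_
  · simpa using (le_pair a b).2
  · simp [sub_self']
  · intro j hj h
    simp only [ap_lam, tm_dist, tm_pair, tm_fst, tm_wk, tm_var, Env.cons_here, fst_pair,
      dist_eq_zero] at h
    exact hj.ne (pair_inj h).2

/-! ### Codes of rational numbers -/

abbrev K (𝔐 : Model) : Type := Frac 𝔐.N

def numPos (q : 𝔐.N) : 𝔐.N := tm (Env.cons q Env.nil) (Term.numPos Term.v0)
def numNeg (q : 𝔐.N) : 𝔐.N := tm (Env.cons q Env.nil) (Term.numNeg Term.v0)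
def den (q : 𝔐.N) : 𝔐.N := tm (Env.cons q Env.nil) (Term.den Term.v0)

section
variable {X : Type} [Coord 𝔐.toStr X] (f : X → 𝔐.N) [IsDef f]

instance isDef_numPos : IsDef (fun x => numPos (f x)) := IsDef.tm1 _ f
instance isDef_numNeg : IsDef (fun x => numNeg (f x)) := IsDef.tm1 _ f
instance isDef_den : IsDef (fun x => den (f x)) := IsDef.tm1 _ f

end

section
variable {Γ : List Ty} (e : 𝔐.Env Γ) (s t : Term Γ Ty.nat)

@[simp] theorem tm_numPos : tm e (Term.numPos t) = numPos (tm e t) := by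
  simp [numPos, Term.numPos]

@[simp] theorem tm_numNeg : tm e (Term.numNeg t) = numNeg (tm e t) := by
  simp [numNeg, Term.numNeg]

@[simp] theorem tm_den : tm e (Term.den t) = den (tm e t) := by
  simp [den, Term.den]

end

theorem den_pos (q : 𝔐.N) : 0 < den q := by
  rw [den, Term.den, tm_succ, S_eq]
  exact add_pos_of_nonneg_of_pos zero_le one_pos

/-- The value of a code of a rational number. -/
noncomputable def qval (q : 𝔐.N) : 𝔐.K :=
  (Frac.of (numPos q) - Frac.of (numNeg q)) / Frac.of (den q)

theorem of_pos {a : 𝔐.N} (h : 0 < a) : (0 : 𝔐.K) < Frac.of a := by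
  simpa using Frac.of_mono h

theorem of_sub_of (a b : 𝔐.N) :
    (Frac.of (a - b) - Frac.of (b - a) : 𝔐.K) = Frac.of a - Frac.of b := by
  rcases le_total a b with h | h
  · rw [sub_eq_zero_iff.2 h]
    nth_rw 2 [← sub_add_cancel' h]
    simp
  · rw [sub_eq_zero_iff.2 h]
    nth_rw 2 [← sub_add_cancel' h]
    simp

theorem numPos_or_numNeg (q : 𝔐.N) : numPos q = 0 ∨ numNeg q = 0 := by
  simp only [numPos, numNeg, Term.numPos, Term.numNeg, tm_caseZero, tm_zero]
  split_ifs
  · exact Or.inr rfl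
  · exact Or.inl rfl

/-- One of the two truncated differences vanishes. The first component of the code is therefore
either the even number 2(a - b) or the odd number 2(b - a) - 1, and its parity recovers the sign. -/
theorem qMk_spec {Γ : List Ty} (e : 𝔐.Env Γ) (a b d : Term Γ Ty.nat) (hd : 0 < tm e d) :
    numPos (tm e (Term.qMk a b d)) = tm e a - tm e b ∧
    numNeg (tm e (Term.qMk a b d)) = tm e b - tm e a ∧ den (tm e (Term.qMk a b d)) = tm e d := by
  set q := tm e (Term.qMk a b d) with hq
  have hf : fst q = 2 * (tm e a - tm e b) + pred (2 * (tm e b - tm e a)) := by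
    simp [hq, Term.qMk]
  have hs : snd q = pred (tm e d) := by simp [hq, Term.qMk]
  refine ⟨?_, ?_, ?_⟩
  · simp only [numPos, Term.numPos, tm_caseZero, tm_parity, tm_fst, tm_var, Env.cons_here,
      tm_half, tm_zero, hf]
    rcases le_or_gt (tm e b) (tm e a) with h | h
    · rw [sub_eq_zero_iff.2 h]
      simp [(parity_two_mul _).1, (parity_two_mul _).2]
    · have h1 : (0 : 𝔐.N) < tm e b - tm e a := by
        rw [pos_iff_ne_zero, Ne, sub_eq_zero_iff, not_le]; exact h
      obtain ⟨k, hk⟩ := (eq_zero_or_S (tm e b - tm e a)).resolve_left h1.ne'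
      have h2 : pred (2 * (tm e b - tm e a)) = 2 * k + 1 := by
        rw [hk, S_eq, show 2 * (k + 1) = S (2 * k + 1) by rw [S_eq]; ring, pred_S]
      rw [sub_eq_zero_iff.2 h.le, h2]
      simp [(parity_two_mul_add_one k).1]
  · simp only [numNeg, Term.numNeg, tm_caseZero, tm_parity, tm_fst, tm_var, Env.cons_here,
      tm_half, tm_zero, tm_succ, hf]
    rcases le_or_gt (tm e b) (tm e a) with h | h
    · rw [sub_eq_zero_iff.2 h]
      simp [(parity_two_mul _).1]
    · have h1 : (0 : 𝔐.N) < tm e b - tm e a := by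
        rw [pos_iff_ne_zero, Ne, sub_eq_zero_iff, not_le]; exact h
      obtain ⟨k, hk⟩ := (eq_zero_or_S (tm e b - tm e a)).resolve_left h1.ne'
      have h2 : pred (2 * (tm e b - tm e a)) = 2 * k + 1 := by
        rw [hk, S_eq, show 2 * (k + 1) = S (2 * k + 1) by rw [S_eq]; ring, pred_S]
      rw [sub_eq_zero_iff.2 h.le, h2, hk]
      simp [(parity_two_mul_add_one k).1, S_eq, (parity_two_mul_add_one k).2]
  · simp only [den, Term.den, tm_succ, tm_snd, tm_var, Env.cons_here, hs, S_eq]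
    exact pred_add_one hd

section
variable {Γ : List Ty} (e : 𝔐.Env Γ) (q r : Term Γ Ty.nat)

theorem qval_qMk (a b d : Term Γ Ty.nat) (hd : 0 < tm e d) :
    qval (tm e (Term.qMk a b d)) = (Frac.of (tm e a) - Frac.of (tm e b)) / Frac.of (tm e d) := by
  obtain ⟨h1, h2, h3⟩ := qMk_spec e a b d hd
  rw [qval, h1, h2, h3, of_sub_of]

@[simp] theorem qval_qAdd : qval (tm e (Term.qAdd q r)) = qval (tm e q) + qval (tm e r) := by
  have h1 := (of_pos (den_pos (tm e q))).ne'
  have h2 := (of_pos (den_pos (tm e r))).ne'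
  rw [Term.qAdd, qval_qMk]
  · simp only [tm_add, tm_mul, tm_numPos, tm_numNeg, tm_den, map_add, map_mul, qval]
    field_simp
    ring
  · simpa using ⟨den_pos (tm e q), den_pos (tm e r)⟩

@[simp] theorem qval_qNeg : qval (tm e (Term.qNeg q)) = -qval (tm e q) := by
  rw [Term.qNeg, qval_qMk]
  · simp only [tm_numPos, tm_numNeg, tm_den, qval]
    rw [← neg_div, neg_sub]
  · simpa using den_pos (tm e q)

@[simp] theorem qval_qSub : qval (tm e (Term.qSub q r)) = qval (tm e q) - qval (tm e r) := by
  rw [Term.qSub, qval_qAdd, qval_qNeg, sub_eq_add_neg]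

@[simp] theorem qval_qAbs : qval (tm e (Term.qAbs q)) = |qval (tm e q)| := by
  rw [Term.qAbs, qval_qMk]
  · simp only [tm_numPos, tm_numNeg, tm_den, tm_add, tm_zero, qval, abs_div,
      abs_of_pos (of_pos (den_pos (tm e q)))]
    have habs : ∀ a : 𝔐.N, |(Frac.of a : 𝔐.K)| = Frac.of a := fun a =>
      abs_of_nonneg (Frac.of_nonneg a)
    rcases numPos_or_numNeg (tm e q) with h | h
    · rw [h]; simp [habs]
    · rw [h]; simp [habs]
  · simpa using den_pos (tm e q)

/-- The rational `2 ^ (-k)`. -/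
noncomputable def e2 (k : 𝔐.N) : 𝔐.K := (Frac.of (pow2 k))⁻¹

theorem qval_pair_two (a b : 𝔐.N) : qval (pair (2 * a) b) = Frac.of a / Frac.of (b + 1) := by
  simp [qval, numPos, numNeg, den, Term.numPos, Term.numNeg, Term.den, (parity_two_mul a).1,
    (parity_two_mul a).2, S_eq]

@[simp] theorem qval_qPow : qval (tm e (Term.qPow q)) = e2 (tm e q) := by
  have := qval_pair_two (1 : 𝔐.N) (pred (pow2 (tm e q)))
  rw [mul_one, pred_add_one (pow2_pos _)] at this
  simp [Term.qPow, this, e2]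

theorem tm_qCross_le : tm e (Term.qCross q r) ≤ tm e (Term.qCross r q) ↔
    qval (tm e q) ≤ qval (tm e r) := by
  have h1 := of_pos (den_pos (tm e q))
  have h2 := of_pos (den_pos (tm e r))
  rw [qval, qval, div_le_div_iff₀ h1 h2, ← Frac.of_mono.le_iff_le]
  simp only [Term.qCross, tm_add, tm_mul, tm_numPos, tm_numNeg, tm_den, map_add, map_mul]
  constructor <;> intro h <;> linarith

@[simp] theorem sat_qLe : sat e (Formula.qLe q r) ↔ qval (tm e q) ≤ qval (tm e r) := by
  rw [Formula.qLe, sat_le, tm_qCross_le]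

@[simp] theorem sat_qLt : sat e (Formula.qLt q r) ↔ qval (tm e q) < qval (tm e r) := by
  rw [Formula.qLt, sat_lt, ← not_le, tm_qCross_le, not_le]

theorem tm_qLeChar : tm e (Term.qLeChar q r) = (0 : 𝔐.N) ↔ qval (tm e q) ≤ qval (tm e r) := by
  rw [Term.qLeChar, tm_sub, sub_eq_zero_iff, tm_qCross_le]

end

/-! ### Definability of functions with rational values -/

/-- The field `K` is not a sort of the structure, so definability is asked of numerators and of a
denominator. Comparisons then become definable by cross-multiplication, which admits inequalities
between rationals into internal induction. -/
class IsDefK {X : Type} [Coord 𝔐.toStr X] (f : X → 𝔐.K) : Prop where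
  out : ∃ a b d : X → 𝔐.N, IsDef a ∧ IsDef b ∧ IsDef d ∧ (∀ x, d x ≠ 0) ∧
    ∀ x, f x = (Frac.of (a x) - Frac.of (b x)) / Frac.of (d x)

section
variable {X : Type} [Coord 𝔐.toStr X]

instance IsDefK.of (f : X → 𝔐.N) [hf : IsDef f] : IsDefK (fun x => (Frac.of (f x) : 𝔐.K)) :=
  ⟨f, fun _ => 0, fun _ => 1, hf, inferInstance, inferInstance, fun _ => one_ne_zero,
    fun x => by simp⟩

instance IsDefK.e2 (f : X → 𝔐.N) [hf : IsDef f] : IsDefK (fun x => e2 (f x)) :=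
  ⟨fun _ => 1, fun _ => 0, fun x => pow2 (f x), inferInstance, inferInstance, inferInstance,
    fun _ => (pow2_pos _).ne', fun x => by simp [Model.e2]⟩

instance IsDefK.qval (f : X → 𝔐.N) [hf : IsDef f] : IsDefK (fun x => qval (f x)) :=
  ⟨fun x => numPos (f x), fun x => numNeg (f x), fun x => den (f x), inferInstance,
    inferInstance, inferInstance, fun _ => (den_pos _).ne', fun _ => rfl⟩

instance IsDefK.const (c : 𝔐.K) : IsDefK (fun _ : X => c) := by
  obtain ⟨a, b, hb, rfl | rfl⟩ := Frac.exists_eq c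
  · exact ⟨fun _ => a, fun _ => 0, fun _ => b, inferInstance, inferInstance, inferInstance,
      fun _ => hb, fun _ => by simp⟩
  · exact ⟨fun _ => 0, fun _ => a, fun _ => b, inferInstance, inferInstance, inferInstance,
      fun _ => hb, fun _ => by simp [neg_div]⟩

instance IsDefK.add (f g : X → 𝔐.K) [hf : IsDefK f] [hg : IsDefK g] :
    IsDefK (fun x => f x + g x) := by
  obtain ⟨a, b, d, ha, hb, hd, h0, h⟩ := hf.out
  obtain ⟨a', b', d', ha', hb', hd', h0', h'⟩ := hg.out
  refine ⟨fun x => a x * d' x + a' x * d x, fun x => b x * d' x + b' x * d x,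
    fun x => d x * d' x, inferInstance, inferInstance, inferInstance,
    fun x => mul_ne_zero (h0 x) (h0' x), fun x => ?_⟩
  have e1 : (Frac.of (d x) : 𝔐.K) ≠ 0 := Frac.of_ne_zero (h0 x)
  have e2 : (Frac.of (d' x) : 𝔐.K) ≠ 0 := Frac.of_ne_zero (h0' x)
  rw [h, h']
  simp only [map_add, map_mul]
  field_simp
  ring

instance IsDefK.mul (f g : X → 𝔐.K) [hf : IsDefK f] [hg : IsDefK g] :
    IsDefK (fun x => f x * g x) := by
  obtain ⟨a, b, d, ha, hb, hd, h0, h⟩ := hf.out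
  obtain ⟨a', b', d', ha', hb', hd', h0', h'⟩ := hg.out
  refine ⟨fun x => a x * a' x + b x * b' x, fun x => a x * b' x + b x * a' x,
    fun x => d x * d' x, inferInstance, inferInstance, inferInstance,
    fun x => mul_ne_zero (h0 x) (h0' x), fun x => ?_⟩
  have e1 : (Frac.of (d x) : 𝔐.K) ≠ 0 := Frac.of_ne_zero (h0 x)
  have e2 : (Frac.of (d' x) : 𝔐.K) ≠ 0 := Frac.of_ne_zero (h0' x)
  rw [h, h']
  simp only [map_add, map_mul]
  field_simp
  ring

theorem IsDefK.of_eq {f : X → 𝔐.K} (g : X → 𝔐.K) [h : IsDefK g] (hfg : ∀ x, f x = g x) :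
    IsDefK f := by
  rwa [funext hfg]

instance IsDefK.neg (f : X → 𝔐.K) [hf : IsDefK f] : IsDefK (fun x => -f x) :=
  IsDefK.of_eq (h := IsDefK.mul (fun _ => -1) f (hf := IsDefK.const (-1))) _ (by simp)

instance IsDefK.sub (f g : X → 𝔐.K) [hf : IsDefK f] [hg : IsDefK g] :
    IsDefK (fun x => f x - g x) :=
  IsDefK.of_eq (fun x => f x + -g x) (by simp [sub_eq_add_neg])

instance isDefRel_leK (f g : X → 𝔐.K) [hf : IsDefK f] [hg : IsDefK g] :
    IsDefRel (fun x => f x ≤ g x) := by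
  obtain ⟨a, b, d, ha, hb, hd, h0, h⟩ := hf.out
  obtain ⟨a', b', d', ha', hb', hd', h0', h'⟩ := hg.out
  refine IsDefRel.of_iff
    (fun x => a x * d' x + b' x * d x ≤ a' x * d x + b x * d' x) fun x => ?_
  have h1 := of_pos (pos_iff_ne_zero.2 (h0 x))
  have h2 := of_pos (pos_iff_ne_zero.2 (h0' x))
  rw [h, h', div_le_div_iff₀ h1 h2, ← (Frac.of_mono (M := 𝔐.N)).le_iff_le (a := _ + _)]
  simp only [map_add, map_mul]
  constructor <;> intro h <;> linarith

end

/-! ### Powers of two -/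

theorem e2_pos (n : 𝔐.N) : 0 < e2 n := inv_pos.2 (of_pos (pow2_pos n))

theorem e2_succ (n : 𝔐.N) : e2 n = e2 (n + 1) + e2 (n + 1) := by
  have := (of_pos (pow2_pos n)).ne'
  rw [e2, e2, pow2_succ, map_mul, map_ofNat]
  field_simp
  norm_num

theorem e2_add (m n : 𝔐.N) : e2 (m + n) = e2 m * e2 n := by
  rw [e2, e2, e2, pow2_add, map_mul, mul_inv]

theorem e2_anti {m n : 𝔐.N} (h : m ≤ n) : e2 n ≤ e2 m := by
  obtain ⟨k, rfl⟩ := h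
  rw [e2_add]
  refine mul_le_of_le_one_right (e2_pos m).le (inv_le_one_of_one_le₀ ?_)
  have : 1 ≤ pow2 k := by simpa [lt_iff_add_one_le] using pow2_pos k
  simpa using Frac.of_mono.monotone this

/-- The Archimedean property relative to the numbers of the model: a/b ≥ 1/b ≥ 2^(-b), because b <
2^b. -/
theorem exists_e2_le {x : 𝔐.K} (hx : 0 < x) : ∃ n : 𝔐.N, e2 n ≤ x := by
  obtain ⟨a, b, hb, h⟩ := Frac.exists_eq x
  have hb' := of_pos (pos_iff_ne_zero.2 hb)
  have ha := div_nonneg (Frac.of_nonneg a) hb'.le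
  have hx' : x = Frac.of a / Frac.of b := h.resolve_right fun h => by linarith
  have ha0 : a ≠ 0 := by rintro rfl; simp [hx'] at hx
  refine ⟨b, ?_⟩
  have h1 : (1 : 𝔐.K) ≤ Frac.of a := by
    have : 1 ≤ a := by simpa [lt_iff_add_one_le] using pos_iff_ne_zero.2 ha0
    simpa using Frac.of_mono.monotone this
  rw [hx', e2, inv_eq_one_div]
  exact div_le_div₀ (Frac.of_nonneg a) h1 hb' (Frac.of_mono (lt_pow2 b)).le

/-! ### Codes of real numbers -/

section
variable {Γ : List Ty} (e : 𝔐.Env Γ) (q r : Term Γ Ty.nat)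

variable {Δ : List Ty} {e' : 𝔐.Env Δ} {q' r' : Term Δ Ty.nat}

theorem tm_qAdd_congr (hq : tm e q = tm e' q') (hr : tm e r = tm e' r') :
    tm e (Term.qAdd q r) = tm e' (Term.qAdd q' r') := by
  simp only [Term.qAdd, Term.qMk, tm_pair, tm_add, tm_mul, tm_sub, tm_pred, tm_numPos, tm_numNeg,
    tm_den, tm_two, hq, hr]

theorem tm_qNeg_congr (hq : tm e q = tm e' q') : tm e (Term.qNeg q) = tm e' (Term.qNeg q') := by
  simp only [Term.qNeg, Term.qMk, tm_pair, tm_add, tm_mul, tm_sub, tm_pred, tm_numPos, tm_numNeg,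
    tm_den, tm_two, hq]

theorem tm_qAbs_congr (hq : tm e q = tm e' q') : tm e (Term.qAbs q) = tm e' (Term.qAbs q') := by
  simp only [Term.qAbs, Term.qMk, tm_pair, tm_add, tm_mul, tm_sub, tm_pred, tm_numPos, tm_numNeg,
    tm_den, tm_two, tm_zero, hq]

theorem tm_qPow : tm e (Term.qPow q) = pair 2 (pred (pow2 (tm e q))) := by
  simp only [Term.qPow, tm_pair, tm_pred, tm_two, tm_pow2]

theorem tm_qLeChar_congr (hq : tm e q = tm e' q') (hr : tm e r = tm e' r') :
    tm e (Term.qLeChar q r) = tm e' (Term.qLeChar q' r') := by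
  simp only [Term.qLeChar, Term.qCross, tm_add, tm_mul, tm_sub, tm_numPos, tm_numNeg, tm_den,
    hq, hr]

end

def gapChar (a b n : 𝔐.N) : 𝔐.N :=
  tm (Env.cons n (pair2 a b)) (Term.qLeChar (Term.qPow (Term.succ Term.v0))
    (Term.qAbs (Term.qSub Term.v1 Term.v2)))

theorem gapChar_eq_zero {a b n : 𝔐.N} :
    gapChar a b n = 0 ↔ e2 (n + 1) ≤ |qval a - qval b| := by
  rw [gapChar, tm_qLeChar, qval_qPow, qval_qAbs, qval_qSub]
  simp only [tm_succ, tm_var, pair2, Env.cons_here, Env.cons_there, S_eq]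

theorem tm_gapChar {Γ : List Ty} (e : 𝔐.Env Γ) (q r t : Term Γ Ty.nat) :
    tm e (Term.qLeChar (Term.qPow (Term.succ t)) (Term.qAbs (Term.qSub q r))) =
      gapChar (tm e q) (tm e r) (tm e t) := by
  refine tm_qLeChar_congr _ _ _ ?_ ?_
  · simp only [tm_qPow, tm_succ, tm_var, Env.cons_here]
  · exact tm_qAbs_congr _ _ (tm_qAdd_congr _ _ _ rfl (tm_qNeg_congr _ _ rfl))

def hatAt (x : 𝔐.D Ty.one) (n : 𝔐.N) : 𝔐.N :=
  tm (Env.cons x (Env.cons n Env.nil)) (Term.hatAt Term.v0 Term.v1)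

instance isDef_hatAt {X : Type} [Coord 𝔐.toStr X] (x : X → 𝔐.D Ty.one) (n : X → 𝔐.N)
    [IsDef x] [IsDef n] : IsDef (fun p => hatAt (x p) (n p)) := IsDef.tm2 _ x n

@[simp] theorem tm_hatAt {Γ : List Ty} (e : 𝔐.Env Γ) (x : Term Γ Ty.one) (n : Term Γ Ty.nat) :
    tm e (Term.hatAt x n) = hatAt (tm e x) (tm e n) := by
  simp only [hatAt, Term.hatAt, tm_app, tm_least, tm_var, Env.cons_here, Env.cons_there]
  refine congrArg (𝔐.ap (tm e x)) (least_congr (fun k => ?_) _)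
  rw [ap_lam, ap_lam, tm_gapChar, tm_gapChar]
  simp only [tm_app, tm_succ, tm_wk, tm_var, Env.cons_here]

/-- The rational approximations of a real number. -/
noncomputable def appr (x : 𝔐.D Ty.one) (n : 𝔐.N) : 𝔐.K := qval (hatAt x n)

instance isDefK_appr {X : Type} [Coord 𝔐.toStr X] (x : X → 𝔐.D Ty.one) (n : X → 𝔐.N)
    [IsDef x] [IsDef n] : IsDefK (fun p => appr (x p) (n p)) :=
  inferInstanceAs (IsDefK fun p => qval (hatAt (x p) (n p)))

/-- The search inside `hatAt` is run by an element `f` of the model whose zeros are the places where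
the Cauchy condition fails; naming it makes the search lemmas applicable. -/
theorem exists_hatAt (x : 𝔐.D Ty.one) : ∃ f : 𝔐.D Ty.one,
    (∀ n, hatAt x n = 𝔐.ap x (least f n)) ∧ ∀ k, 𝔐.ap f k = (0 : 𝔐.N) ↔
      e2 (k + 1) ≤ |qval (𝔐.ap x k) - qval (𝔐.ap x (k + 1))| := by
  refine ⟨tm (Env.cons x Env.nil) (Term.lam (Term.qLeChar (Term.qPow (Term.succ Term.v0))
    (Term.qAbs (Term.qSub (Term.app Term.v1 Term.v0)
      (Term.app Term.v1 (Term.succ Term.v0)))))), fun n => ?_, fun k => ?_⟩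
  · rw [hatAt, Term.hatAt, tm_app, tm_least]
    simp only [tm_var, Env.cons_here, Env.cons_there]
    refine congrArg (𝔐.ap x) (least_congr (fun k => ?_) _)
    rw [ap_lam, ap_lam, tm_gapChar, tm_gapChar]
    simp only [tm_app, tm_succ, tm_wk, tm_var, Env.cons_here, Env.cons_there]
  · rw [ap_lam, tm_gapChar, gapChar_eq_zero]
    simp only [tm_app, tm_succ, tm_var, Env.cons_here, Env.cons_there, S_eq]

theorem appr_step (x : 𝔐.D Ty.one) (n : 𝔐.N) : |appr x n - appr x (n + 1)| < e2 (n + 1) := by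
  obtain ⟨f, hf, h⟩ := exists_hatAt x
  rw [appr, appr, hf, hf, least_succ]
  split_ifs with h0
  · simpa using e2_pos (n + 1)
  · have hn : least f n = n := by
      by_contra hne
      exact h0 ((least_spec f n).2.2 (lt_of_le_of_ne (least_spec f n).1 hne))
    rw [hn] at h0 ⊢
    rw [h] at h0
    exact not_le.1 h0

theorem appr_eq {x : 𝔐.D Ty.one}
    (hx : ∀ k, |qval (𝔐.ap x k) - qval (𝔐.ap x (k + 1))| < e2 (k + 1)) (n : 𝔐.N) :
    appr x n = qval (𝔐.ap x n) := by
  obtain ⟨f, hf, h⟩ := exists_hatAt x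
  rw [appr, hf, least_eq_of_ne]
  exact fun k _ h0 => absurd ((h k).1 h0) (not_le.2 (hx k))

/-- The bounds on the single steps telescope, since 2^(-n) - 2^(-(n+1)) = 2^(-(n+1)). -/
theorem appr_sub_le (x : 𝔐.D Ty.one) (n k : 𝔐.N) :
    appr x n - appr x (n + k) ≤ e2 n - e2 (n + k) ∧
      appr x (n + k) - appr x n ≤ e2 n - e2 (n + k) := by
  induction k using induction with
  | isDef => infer_instance
  | zero => simp
  | succ k ih =>
    have h1 := abs_lt.1 (appr_step x (n + k))
    have h2 := e2_succ (n + k)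
    rw [← add_assoc]
    constructor <;> linarith

/-- The approximations at `n` are closer than `2 ^ (-n)` to the limit, by a fixed amount. -/
theorem exists_appr_gap (x : 𝔐.D Ty.one) (n : 𝔐.N) : ∃ j : 𝔐.N, ∀ m ≥ n + 1,
    |appr x m - appr x n| ≤ e2 n - e2 j := by
  -- The slack comes from the strict inequality of the first step alone; the remaining steps
  -- together stay below 2^(-(n+1)).
  obtain ⟨j, hj⟩ := exists_e2_le (sub_pos.2 (appr_step x n))
  refine ⟨j, fun m hm => ?_⟩
  obtain ⟨k, rfl⟩ := hm
  have h1 := appr_sub_le x (n + 1) k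
  have h2 := abs_le.1 (le_refl |appr x n - appr x (n + 1)|)
  have h3 := e2_succ n
  have h4 := e2_pos (n + 1 + k)
  rw [abs_le]
  constructor <;> linarith

/-! ### Nonstandard values of real numbers -/

-- Rational approximations need not converge in `K`. In the ultrapower along an ultrafilter finer
-- than `atTop` every code of a real has a value in a linearly ordered field, close to its n-th
-- approximation within 2^(-n). The ultrafilter is external to the model, so statements about `R`
-- must be translated back before induction applies to them.
open Filter in
noncomputable def ultra (𝔐 : Model) : Ultrafilter 𝔐.N := Ultrafilter.of atTop

abbrev R (𝔐 : Model) : Type := (ultra 𝔐 : Filter 𝔐.N).Germ 𝔐.K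

/-- The embedding of the rationals into the nonstandard rationals. -/
noncomputable def toR (q : 𝔐.K) : 𝔐.R := (q : 𝔐.R)

theorem toR_le {a b : 𝔐.K} : toR a ≤ toR b ↔ a ≤ b := Filter.Germ.const_le_iff
theorem toR_add (a b : 𝔐.K) : toR (a + b) = toR a + toR b := rfl
theorem toR_sub (a b : 𝔐.K) : toR (a - b) = toR a - toR b := rfl
theorem toR_zero : toR (0 : 𝔐.K) = 0 := rfl
theorem toR_one : toR (1 : 𝔐.K) = 1 := rfl

theorem eventually_ge (n : 𝔐.N) : ∀ᶠ m in (ultra 𝔐 : Filter 𝔐.N), n ≤ m :=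
  (Ultrafilter.of_le Filter.atTop) (Filter.eventually_ge_atTop n)

noncomputable def val (x : 𝔐.D Ty.one) : 𝔐.R := ((fun n => appr x n : 𝔐.N → 𝔐.K) : 𝔐.R)

noncomputable def eps (n : 𝔐.N) : 𝔐.R := toR (e2 n)

theorem eps_pos (n : 𝔐.N) : 0 < eps n := Filter.Germ.const_lt (e2_pos n)

theorem eps_succ (n : 𝔐.N) : eps n = eps (n + 1) + eps (n + 1) := by
  rw [eps, e2_succ, toR_add, eps]

theorem eps_anti {m n : 𝔐.N} (h : m ≤ n) : eps n ≤ eps m :=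
  Filter.Germ.const_le (e2_anti h)

theorem val_gap (x : 𝔐.D Ty.one) (n : 𝔐.N) : ∃ j : 𝔐.N,
    |val x - toR (appr x n)| ≤ eps n - eps j := by
  obtain ⟨j, hj⟩ := exists_appr_gap x n
  refine ⟨j, abs_le.2 ⟨?_, ?_⟩⟩
  · refine Filter.Germ.coe_le.2 ((eventually_ge (n + 1)).mono fun m hm => ?_)
    exact (abs_le.1 (hj m hm)).1
  · refine Filter.Germ.coe_le.2 ((eventually_ge (n + 1)).mono fun m hm => ?_)
    exact (abs_le.1 (hj m hm)).2

theorem val_appr (x : 𝔐.D Ty.one) (n : 𝔐.N) : |val x - toR (appr x n)| ≤ eps n := by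
  obtain ⟨j, hj⟩ := val_gap x n
  linarith [eps_pos j]

section
variable {Γ : List Ty} (e : 𝔐.Env Γ) (s t : Term Γ Ty.one)

/-- The formal order coincides with strict inequality of values by a margin 2^(-n), with n a number
of the model; inequalities by smaller margins are invisible to the formal system. -/
theorem sat_rLt : sat e (Formula.rLt s t) ↔ ∃ n : 𝔐.N, val (tm e s) + eps n < val (tm e t) := by
  have key : sat e (Formula.rLt s t) ↔
      ∃ n : 𝔐.N, e2 n ≤ appr (tm e t) (n + 1) - appr (tm e s) (n + 1) := by
    simp [Formula.rLt, sat, S_eq, appr]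
  rw [key]
  constructor
  · rintro ⟨n, hn⟩
    -- The two errors at n + 1 could consume the whole gap 2^(-n); the strict slack in `val_gap` is
    -- what leaves a margin.
    obtain ⟨j, hj⟩ := val_gap (tm e s) (n + 1)
    obtain ⟨j', hj'⟩ := val_gap (tm e t) (n + 1)
    refine ⟨j, ?_⟩
    have hn' : eps n ≤ toR (appr (tm e t) (n + 1)) - toR (appr (tm e s) (n + 1)) :=
      toR_le.2 hn
    have h1 := abs_le.1 hj
    have h2 := abs_le.1 hj'
    have h3 := eps_succ n
    have h4 := eps_pos j'
    linarith [h1.1, h1.2, h2.1, h2.2]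
  · rintro ⟨n, hn⟩
    refine ⟨n + 1, toR_le.1 ?_⟩
    have h1 := abs_le.1 (val_appr (tm e s) (n + 1 + 1))
    have h2 := abs_le.1 (val_appr (tm e t) (n + 1 + 1))
    have h3 := eps_succ n
    have h4 := eps_succ (n + 1)
    show eps (n + 1) ≤ toR (appr (tm e t) (n + 1 + 1)) - toR (appr (tm e s) (n + 1 + 1))
    linarith [h1.1, h1.2, h2.1, h2.2]

theorem sat_rLe : sat e (Formula.rLe s t) ↔ ∀ n : 𝔐.N, val (tm e s) ≤ val (tm e t) + eps n := by
  rw [Formula.rLe, Formula.neg, sat, sat_rLt]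
  simp [sat, not_exists, not_lt]

theorem abs_le_of_sat_rEq (h : sat e (Formula.rEq s t)) (n : 𝔐.N) :
    |val (tm e s) - val (tm e t)| ≤ eps n := by
  have key : ∀ n : 𝔐.N, |appr (tm e s) (n + 1) - appr (tm e t) (n + 1)| < e2 n := by
    simpa [Formula.rEq, sat, S_eq, appr] using h
  have h0 := abs_lt.1 (key (n + 1))
  have h01 : -eps (n + 1) ≤ toR (appr (tm e s) (n + 1 + 1)) - toR (appr (tm e t) (n + 1 + 1)) :=
    toR_le.2 h0.1.le
  have h02 : toR (appr (tm e s) (n + 1 + 1)) - toR (appr (tm e t) (n + 1 + 1)) ≤ eps (n + 1) :=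
    toR_le.2 h0.2.le
  have h1 := abs_le.1 (val_appr (tm e s) (n + 1 + 1))
  have h2 := abs_le.1 (val_appr (tm e t) (n + 1 + 1))
  have h3 := eps_succ n
  have h4 := eps_succ (n + 1)
  rw [abs_le]
  constructor <;> linarith [h1.1, h1.2, h2.1, h2.2]

theorem appr_rOfQ (q : Term Γ Ty.nat) (n : 𝔐.N) : appr (tm e (Term.rOfQ q)) n = qval (tm e q) := by
  rw [appr_eq]
  · simp [Term.rOfQ]
  · intro k
    simp [Term.rOfQ, e2_pos]

theorem val_rOfQ (q : Term Γ Ty.nat) : val (tm e (Term.rOfQ q)) = toR (qval (tm e q)) := by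
  simp only [val, appr_rOfQ]; rfl

@[simp] theorem val_rPow (k : Term Γ Ty.nat) : val (tm e (Term.rPow k)) = eps (tm e k) := by
  rw [Term.rPow, val_rOfQ, qval_qPow]; rfl

@[simp] theorem val_rZero : val (tm e Term.rZero) = 0 := by
  rw [Term.rZero, val_rOfQ]
  have := qval_pair_two (0 : 𝔐.N) 0
  simp only [mul_zero, map_zero, zero_div] at this
  simp [this, toR_zero]

@[simp] theorem val_rOne : val (tm e Term.rOne) = 1 := by
  rw [Term.rOne, val_rOfQ]
  have := qval_pair_two (1 : 𝔐.N) 0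
  simp only [mul_one, map_one, zero_add, div_one] at this
  simp [this, toR_one]

theorem appr_rNeg (n : 𝔐.N) : appr (tm e (Term.rNeg t)) n = -appr (tm e t) n := by
  have h : ∀ k, qval (𝔐.ap (tm e (Term.rNeg t)) k) = -appr (tm e t) k := fun k => by
    simp [Term.rNeg, appr]
  rw [appr_eq, h]
  intro k
  rw [h, h, ← abs_neg]
  convert appr_step (tm e t) k using 2
  ring

theorem val_rNeg : val (tm e (Term.rNeg t)) = -val (tm e t) := by
  simp only [val, appr_rNeg]; rfl

theorem appr_rAdd (n : 𝔐.N) :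
    appr (tm e (Term.rAdd s t)) n = appr (tm e s) (n + 1) + appr (tm e t) (n + 1) := by
  have h : ∀ k, qval (𝔐.ap (tm e (Term.rAdd s t)) k) =
      appr (tm e s) (k + 1) + appr (tm e t) (k + 1) := fun k => by
    simp [Term.rAdd, appr, S_eq]
  rw [appr_eq, h]
  intro k
  rw [h, h]
  have h1 := abs_lt.1 (appr_step (tm e s) (k + 1))
  have h2 := abs_lt.1 (appr_step (tm e t) (k + 1))
  have h3 := e2_succ (k + 1)
  rw [abs_lt]
  constructor <;> linarith

/-- The formal sum shifts the index by one to keep the Cauchy condition, so its germ need not be the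
sum of the two germs; they agree only up to 2^(-n) for every n of the model. -/
theorem val_rAdd (n : 𝔐.N) :
    |val (tm e (Term.rAdd s t)) - (val (tm e s) + val (tm e t))| ≤ eps n := by
  have h0 := abs_le.1 (val_appr (tm e (Term.rAdd s t)) (n + 1))
  have h1 := abs_le.1 (val_appr (tm e s) (n + 1 + 1))
  have h2 := abs_le.1 (val_appr (tm e t) (n + 1 + 1))
  have h3 := eps_succ n
  have h4 := eps_succ (n + 1)
  have h5 : toR (appr (tm e (Term.rAdd s t)) (n + 1)) =
      toR (appr (tm e s) (n + 1 + 1)) + toR (appr (tm e t) (n + 1 + 1)) := by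
    rw [appr_rAdd, toR_add]
  rw [abs_le]
  constructor <;> linarith [h1.1, h1.2, h2.1, h2.2]

end

/-- The relation `x ≤ y + q` for codes of reals `x`, `y` and a rational `q`. -/
def Rle (x y : 𝔐.D Ty.one) (q : 𝔐.K) : Prop := ∀ n : 𝔐.N, val x ≤ val y + toR q + eps n

/-- Each approximation at n is off by at most 2^(-n), which accounts for the term added twice. The
right side no longer mentions the ultrafilter and so makes the relation definable. -/
theorem rle_iff {x y : 𝔐.D Ty.one} {q : 𝔐.K} :
    Rle x y q ↔ ∀ n : 𝔐.N, appr x n ≤ appr y n + q + (e2 n + e2 n) := by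
  constructor
  · intro h n
    obtain ⟨j, hj⟩ := val_gap x n
    have h1 := abs_le.1 hj
    have h2 := abs_le.1 (val_appr y n)
    have h3 := h j
    refine toR_le.1 ?_
    show toR (appr x n) ≤ toR (appr y n) + toR q + (eps n + eps n)
    linarith [h1.1, h1.2, h2.1, h2.2]
  · intro h n
    have h1 := abs_le.1 (val_appr x (n + 1 + 1))
    have h2 := abs_le.1 (val_appr y (n + 1 + 1))
    have h3 : toR (appr x (n + 1 + 1)) ≤ toR (appr y (n + 1 + 1)) + toR q +
      (eps (n + 1 + 1) + eps (n + 1 + 1)) := toR_le.2 (h (n + 1 + 1))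
    have h4 := eps_succ n
    have h5 := eps_succ (n + 1)
    linarith [h1.1, h1.2, h2.1, h2.2]

instance isDefRel_rle {X : Type} [Coord 𝔐.toStr X] (x y : X → 𝔐.D Ty.one) (q : X → 𝔐.K)
    [IsDef x] [IsDef y] [IsDefK q] : IsDefRel (fun p => Rle (x p) (y p) (q p)) := by
  have : IsDefRel (fun p => ∀ n : 𝔐.N,
      appr (x p) n ≤ appr (y p) n + q p + (e2 n + e2 n)) := by
    have h1 : IsDef (fun p : 𝔐.N × X => x p.2) := IsDef.comp_snd x
    have h2 : IsDef (fun p : 𝔐.N × X => y p.2) := IsDef.comp_snd y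
    have h3 : IsDefK (fun p : 𝔐.N × X => q p.2) := by
      obtain ⟨a, b, d, ha, hb, hd, h0, h⟩ := ‹IsDefK q›.out
      exact ⟨fun p => a p.2, fun p => b p.2, fun p => d p.2, IsDef.comp_snd a, IsDef.comp_snd b,
        IsDef.comp_snd d, fun p => h0 p.2, fun p => h p.2⟩
    infer_instance
  exact IsDefRel.of_iff _ fun p => rle_iff

/-! ### Events -/

def Mem (x : 𝔐.D Ty.pt) (A : 𝔐.D Ty.ev) : Prop := 𝔐.ap (𝔐.ap (𝔐.co Const.mem) x) A = (0 : 𝔐.N)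

def union (A B : 𝔐.D Ty.ev) : 𝔐.D Ty.ev := 𝔐.ap (𝔐.ap (𝔐.co Const.union) A) B

def compl (A : 𝔐.D Ty.ev) : 𝔐.D Ty.ev := 𝔐.ap (𝔐.co Const.compl) A

def inter (A B : 𝔐.D Ty.ev) : 𝔐.D Ty.ev := compl (union (compl A) (compl B))

def prob (A : 𝔐.D Ty.ev) : 𝔐.D Ty.one := 𝔐.ap (𝔐.co Const.prob) A

section
variable {X : Type} [Coord 𝔐.toStr X] (x : X → 𝔐.D Ty.pt) (A B : X → 𝔐.D Ty.ev)
  [IsDef x] [IsDef A] [IsDef B]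

instance isDefRel_mem : IsDefRel (fun p => Mem (x p) (A p)) :=
  inferInstanceAs (IsDefRel fun p => 𝔐.ap (𝔐.ap (𝔐.co Const.mem) (x p)) (A p) = (0 : 𝔐.N))

instance isDef_union : IsDef (fun p => union (A p) (B p)) :=
  inferInstanceAs (IsDef fun p => 𝔐.ap (𝔐.ap (𝔐.co Const.union) (A p)) (B p))

instance isDef_compl : IsDef (fun p => compl (A p)) :=
  inferInstanceAs (IsDef fun p => 𝔐.ap (𝔐.co Const.compl) (A p))

instance isDef_inter : IsDef (fun p => inter (A p) (B p)) :=
  inferInstanceAs (IsDef fun p => compl (union (compl (A p)) (compl (B p))))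

instance isDef_prob : IsDef (fun p => prob (A p)) :=
  inferInstanceAs (IsDef fun p => 𝔐.ap (𝔐.co Const.prob) (A p))

end

theorem not_mem_empty (x : 𝔐.D Ty.pt) : ¬ Mem x (𝔐.co Const.empty) := fun h => by
  simpa [sat, Formula.neg, Formula.mem, Term.memT, Term.empty] using
    sat_postulate (Postulate.mem_empty (Term.v0 : Term [Ty.pt] _)) (Env.cons x Env.nil) h

@[simp] theorem mem_union {x : 𝔐.D Ty.pt} {A B : 𝔐.D Ty.ev} :
    Mem x (union A B) ↔ Mem x A ∨ Mem x B := by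
  have h := sat_postulate (Postulate.mem_union (Term.v0 : Term [Ty.pt, Ty.ev, Ty.ev] _)
    Term.v1 Term.v2) (Env.cons x (Env.cons A (Env.cons B Env.nil)))
  exact ⟨h.1, h.2⟩

@[simp] theorem mem_compl {x : 𝔐.D Ty.pt} {A : 𝔐.D Ty.ev} : Mem x (compl A) ↔ ¬ Mem x A := by
  have h := sat_postulate (Postulate.mem_compl (Term.v0 : Term [Ty.pt, Ty.ev] _)
    Term.v1) (Env.cons x (Env.cons A Env.nil))
  exact ⟨h.1, h.2⟩

@[simp] theorem mem_inter {x : 𝔐.D Ty.pt} {A B : 𝔐.D Ty.ev} :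
    Mem x (inter A B) ↔ Mem x A ∧ Mem x B := by
  simp [inter, not_or]

theorem mem_bigUnion {Γ : List Ty} (e : 𝔐.Env Γ) (A : Term Γ (Ty.nat ⇒ Ty.ev))
    (n m : Term Γ Ty.nat) (x : 𝔐.D Ty.pt) :
    Mem x (tm e (Term.bigUnion A n m)) ↔
      ∃ i : 𝔐.N, tm e n ≤ i ∧ i ≤ tm e m ∧ Mem x (𝔐.ap (tm e A) i) := by
  rw [Term.bigUnion, tm_caseZero, tm_sub, tm_recT, tm_app, tm_sub]
  set f := tm e (Term.lam (Term.lam (Term.union Term.v1 (Term.app A.wk.wk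
    (Term.succ (Term.add n.wk.wk Term.v0)))))) with hf
  have hf' : ∀ (B : 𝔐.D Ty.ev) (d : 𝔐.N),
      𝔐.ap (𝔐.ap f B) d = union B (𝔐.ap (tm e A) (tm e n + d + 1)) := fun B d => by
    rw [hf, ap_lam, ap_lam]
    simp [Term.union, union, S_eq]
  have key : ∀ d : 𝔐.N, Mem x (recur d (𝔐.ap (tm e A) (tm e n)) f) ↔
      ∃ i : 𝔐.N, tm e n ≤ i ∧ i ≤ tm e n + d ∧ Mem x (𝔐.ap (tm e A) i) := fun d => by
    induction d using induction with
    | isDef => infer_instance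
    | zero =>
      simp only [recur_zero, add_zero]
      exact ⟨fun h => ⟨_, le_rfl, le_rfl, h⟩, fun ⟨i, h1, h2, h⟩ => le_antisymm h1 h2 ▸ h⟩
    | succ d ih =>
      rw [← S_eq, recur_S, hf', mem_union, ih, S_eq, ← add_assoc]
      constructor
      · rintro (⟨i, h1, h2, h⟩ | h)
        · exact ⟨i, h1, h2.trans le_self_add, h⟩
        · exact ⟨_, le_self_add.trans le_self_add, le_rfl, h⟩
      · rintro ⟨i, h1, h2, h⟩
        rcases h2.eq_or_lt with rfl | h2
        · exact Or.inr h
        · exact Or.inl ⟨i, h1, lt_add_one_iff.1 h2, h⟩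
  split_ifs with h
  · rw [key, add_comm (tm e n) (_ - _), sub_add_cancel' (sub_eq_zero_iff.1 h)]
  · refine iff_of_false (not_mem_empty x) ?_
    rintro ⟨i, h1, h2, -⟩
    exact h (sub_eq_zero_iff.2 (h1.trans h2))

theorem mem_bigInter {Γ : List Ty} (e : 𝔐.Env Γ) (A : Term Γ (Ty.nat ⇒ Ty.ev))
    (n m : Term Γ Ty.nat) (x : 𝔐.D Ty.pt) :
    Mem x (tm e (Term.bigInter A n m)) ↔
      ∀ i : 𝔐.N, tm e n ≤ i → i ≤ tm e m → Mem x (𝔐.ap (tm e A) i) := by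
  have h : tm e (Term.bigInter A n m) =
    compl (tm e (Term.bigUnion (Term.lam (Term.compl (Term.app A.wk Term.v0))) n m)) := rfl
  have h' : ∀ i : 𝔐.N, 𝔐.ap (tm e (Term.lam (Term.compl (Term.app A.wk Term.v0)))) i =
      compl (𝔐.ap (tm e A) i) := fun i => by
    rw [ap_lam]; simp [Term.compl, compl]
  rw [h, mem_compl, mem_bigUnion]
  simp [h']

/-! ### Probabilities -/

noncomputable def pr (A : 𝔐.D Ty.ev) : 𝔐.R := val (prob A)

theorem pr_nonneg (A : 𝔐.D Ty.ev) (n : 𝔐.N) : 0 ≤ pr A + eps n := by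
  have h := (sat_postulate (Postulate.prob_bounds (Term.v0 : Term [Ty.ev] _))
    (Env.cons A Env.nil)).1
  simpa [pr, prob, Term.prob] using (sat_rLe _ _ _).1 h n

theorem pr_le_one (A : 𝔐.D Ty.ev) (n : 𝔐.N) : pr A ≤ 1 + eps n := by
  have h := (sat_postulate (Postulate.prob_bounds (Term.v0 : Term [Ty.ev] _))
    (Env.cons A Env.nil)).2
  simpa [pr, prob, Term.prob] using (sat_rLe _ _ _).1 h n

theorem pr_empty (n : 𝔐.N) : |pr (𝔐.co Const.empty)| ≤ eps n := by
  have h := sat_postulate (𝔐 := 𝔐) (Postulate.prob_empty (Γ := [])) Env.nil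
  simpa [pr, prob, Term.prob, Term.empty] using abs_le_of_sat_rEq _ _ _ h n

theorem pr_union (A B : 𝔐.D Ty.ev) (n : 𝔐.N) :
    |pr (union A B) - (pr A + pr B - pr (inter A B))| ≤ eps n := by
  have h := sat_postulate (Postulate.prob_union (Term.v0 : Term [Ty.ev, Ty.ev] _) Term.v1)
    (Env.cons A (Env.cons B Env.nil))
  set e : 𝔐.Env _ := Env.cons A (Env.cons B Env.nil)
  have h0 := abs_le.1 (abs_le_of_sat_rEq _ _ _ h (n + 1))
  have h1 := abs_le.1 (val_rAdd e (Term.rAdd (Term.prob Term.v0) (Term.prob Term.v1))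
    (Term.rNeg (Term.prob (Term.inter Term.v0 Term.v1))) (n + 1 + 1))
  have h2 := abs_le.1 (val_rAdd e (Term.prob Term.v0) (Term.prob Term.v1) (n + 1 + 1))
  rw [val_rNeg] at h1
  have h3 := eps_succ n
  have h4 := eps_succ (n + 1)
  have e1 : pr (union A B) = val (tm e (Term.prob (Term.union Term.v0 Term.v1))) := rfl
  have e2 : pr A = val (tm e (Term.prob Term.v0)) := rfl
  have e3 : pr B = val (tm e (Term.prob Term.v1)) := rfl
  have e4 : pr (inter A B) = val (tm e (Term.prob (Term.inter Term.v0 Term.v1))) := rfl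
  rw [e1, e2, e3, e4, abs_le]
  simp only [Term.rSub] at h0
  constructor <;> linarith [h0.1, h0.2, h1.1, h1.2, h2.1, h2.2]

/-- The monotonicity axiom is used in contrapositive form: a strict excess of probability would
produce a point of `A` outside `B`. -/
theorem pr_mono {A B : 𝔐.D Ty.ev} (h : ∀ x, Mem x A → Mem x B) (n : 𝔐.N) :
    pr A ≤ pr B + eps n := by
  by_contra! hn
  obtain ⟨x, hx⟩ := sat_postulate (Postulate.prob_mono (Term.v0 : Term [Ty.ev, Ty.ev] _) Term.v1)
    (Env.cons A (Env.cons B Env.nil))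
  obtain ⟨h1, h2⟩ := hx ((sat_rLt _ _ _).2 ⟨n, by simpa [pr, prob, Term.prob] using hn⟩)
  exact h2 (h x h1)

theorem pr_subadditive {A B C : 𝔐.D Ty.ev} (h : ∀ x, Mem x C → Mem x A ∨ Mem x B) (n : 𝔐.N) :
    pr C ≤ pr A + pr B + eps n := by
  have h1 := pr_mono (A := C) (B := union A B) (fun x hx => mem_union.2 (h x hx)) (n + 1)
  have h2 := abs_le.1 (pr_union A B (n + 1 + 1))
  have h3 := pr_nonneg (inter A B) (n + 1 + 1)
  have h4 := eps_succ n
  have h5 := eps_succ (n + 1)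
  linarith [h2.1, h2.2]

theorem pr_superadditive {A B C : 𝔐.D Ty.ev} (hA : ∀ x, Mem x A → Mem x C)
    (hB : ∀ x, Mem x B → Mem x C) (hAB : ∀ x, Mem x A → ¬ Mem x B) (n : 𝔐.N) :
    pr A + pr B ≤ pr C + eps n := by
  have h1 := pr_mono (A := union A B) (B := C)
    (fun x hx => (mem_union.1 hx).elim (hA x) (hB x)) (n + 1)
  have h2 := abs_le.1 (pr_union A B (n + 1 + 1))
  have h3 := pr_mono (A := inter A B) (B := 𝔐.co Const.empty)
    (fun x hx => absurd (mem_inter.1 hx).2 (hAB x (mem_inter.1 hx).1)) (n + 1 + 1 + 1)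
  have h4 := eps_succ n
  have h5 := eps_succ (n + 1)
  have h6 := eps_succ (n + 1 + 1)
  have h7 := abs_le.1 (pr_empty (𝔐 := 𝔐) (n + 1 + 1 + 1))
  linarith [h2.1, h2.2, h7.1, h7.2]

/-- Increasing sequences of events have probabilities that are eventually almost constant. -/
theorem exists_pr_sup (B : 𝔐.D (Ty.nat ⇒ Ty.ev)) (c : 𝔐.N) :
    ∃ k₀ : 𝔐.N, ∀ k, k₀ ≤ k → Rle (prob (𝔐.ap B k)) (prob (𝔐.ap B k₀)) (e2 c) := by
  by_contra! H
  -- The bound P(B k) ≥ i · 2^(-c) is written as an instance of `Rle`, with 0 on the left and a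
  -- negative rational, so that internal induction on i applies.
  have key : ∀ i : 𝔐.N, ∃ k : 𝔐.N,
      Rle (tm (Env.nil : 𝔐.Env []) Term.rZero) (prob (𝔐.ap B k)) (-(Frac.of i * e2 c)) := by
    intro i
    induction i using induction with
    | isDef => infer_instance
    | zero =>
      refine ⟨0, fun n => ?_⟩
      have := pr_nonneg (𝔐.ap B (0 : 𝔐.N)) n
      simpa [toR_zero, pr] using this
    | succ i ih =>
      obtain ⟨k, hk⟩ := ih
      obtain ⟨k', -, h⟩ := H k
      refine ⟨k', fun n => ?_⟩
      simp only [Rle, not_forall, not_le] at h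
      obtain ⟨j, hj⟩ := h
      have h1 := hk n
      have h2 : -(Frac.of (i + 1) * e2 c) = -(Frac.of i * e2 c) - e2 c := by
        rw [map_add, map_one]; ring
      rw [h2, toR_sub]
      linarith [eps_pos j]
  -- After 2^c + 1 increases by 2^(-c) the probability would be at least 1 + 2^(-c), up to the usual
  -- errors.
  obtain ⟨k, hk⟩ := key (pow2 c + 1)
  have h1 := hk (c + 1 + 1)
  have h2 : -(Frac.of (pow2 c + 1) * e2 c) = -1 - e2 c := by
    rw [map_add, map_one, add_mul, e2, mul_inv_cancel₀ (of_pos (pow2_pos c)).ne']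
    ring
  have h3 : toR (-1 - e2 c) = -1 - eps c := rfl
  rw [h2, h3, val_rZero] at h1
  have h4 := pr_le_one (𝔐.ap B k) (c + 1 + 1)
  rw [pr] at h4
  have h5 := eps_succ c
  have h6 := eps_succ (c + 1)
  linarith [eps_pos (c + 1)]

/-- The range of m may be nonstandard, so the maximum is found by internal induction and not over a
finite set. -/
theorem exists_bound (F : 𝔐.D Ty.one) (j : 𝔐.N) : ∃ L : 𝔐.N, ∀ m ≤ j, 𝔐.ap F m ≤ L := by
  induction j using induction with
  | isDef => infer_instance
  | zero => exact ⟨𝔐.ap F (0 : 𝔐.N), fun m hm => by rw [le_antisymm hm zero_le]⟩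
  | succ j ih =>
    obtain ⟨L, hL⟩ := ih
    refine ⟨L + 𝔐.ap F (j + 1), fun m hm => ?_⟩
    rcases hm.eq_or_lt with rfl | hm
    · exact le_add_self
    · exact (hL m (lt_add_one_iff.1 hm)).trans le_self_add

/-- The step of the measure-theoretic argument: `L \ D` is small if `D ∪ L ⊆ C` and `C` is only
slightly larger than `D`. -/
theorem pr_inter_step {J L D C J' : 𝔐.D Ty.ev} {q : 𝔐.K}
    (hJL : ∀ x, Mem x J → Mem x L) (hLC : ∀ x, Mem x L → Mem x C) (hDC : ∀ x, Mem x D → Mem x C)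
    (hJ' : ∀ x, Mem x J → Mem x D → Mem x J') (h : Rle (prob C) (prob D) q) (n : 𝔐.N) :
    pr J ≤ pr J' + toR q + eps n := by
  have h1 := pr_subadditive (A := J') (B := inter J (compl D)) (C := J)
    (fun x hx => by
      by_cases hd : Mem x D
      · exact Or.inl (hJ' x hx hd)
      · exact Or.inr (mem_inter.2 ⟨hx, mem_compl.2 hd⟩)) (n + 1)
  have h2 := pr_superadditive (A := inter J (compl D)) (B := D) (C := C)
    (fun x hx => hLC x (hJL x (mem_inter.1 hx).1)) hDC
    (fun x hx => mem_compl.1 (mem_inter.1 hx).2) (n + 1 + 1)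
  have h3 : pr C ≤ pr D + toR q + eps (n + 1 + 1) := h (n + 1 + 1)
  have h4 := eps_succ n
  have h5 := eps_succ (n + 1)
  linarith

/-! ### The combinatorial argument inside a model -/

def interUpTo (D : 𝔐.D (Ty.nat ⇒ Ty.ev)) (k : 𝔐.N) : 𝔐.D Ty.ev :=
  tm (Env.cons D (Env.cons k Env.nil)) (Term.bigInter Term.v0 Term.zero Term.v1)

instance isDef_interUpTo {X : Type} [Coord 𝔐.toStr X] (D : X → 𝔐.D (Ty.nat ⇒ Ty.ev))
    (k : X → 𝔐.N) [IsDef D] [IsDef k] : IsDef (fun p => interUpTo (D p) (k p)) :=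
  IsDef.tm2 _ D k

@[simp] theorem mem_interUpTo {D : 𝔐.D (Ty.nat ⇒ Ty.ev)} {k : 𝔐.N} {x : 𝔐.D Ty.pt} :
    Mem x (interUpTo D k) ↔ ∀ i ≤ k, Mem x (𝔐.ap D i) := by
  rw [interUpTo, mem_bigInter]
  simp

/-- The argument with the unions W(m,k), carried out in the model: `F` comes from choice, the index
`L` dominates `M F` and all `F m` with m ≤ `M F`. The event `I` enters only through its elements, so
the intersection denoted by the formal sentence can be inserted directly. -/
theorem exists_pr_lt (A : 𝔐.D (Ty.nat ⇒ Ty.ev)) (M : 𝔐.D (Ty.one ⇒ Ty.nat)) {u v : 𝔐.N}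
    (huv : u < v) : ∃ (n : 𝔐.N) (F : 𝔐.D Ty.one), ∀ I : 𝔐.D Ty.ev,
      (∀ x, Mem x I ↔ ∀ m ≤ 𝔐.ap M F, ∃ i, m ≤ i ∧ i ≤ 𝔐.ap F m ∧ Mem x (𝔐.ap A i)) →
      (∀ j, pr I ≤ eps v + eps j) → ∃ j, pr (𝔐.ap A n) + eps j < eps u := by
  set W := tm (Env.cons A Env.nil) (Term.lam (Term.lam (Term.bigUnion Term.v2 Term.v1 Term.v0)))
    with hW
  have memW : ∀ (m k : 𝔐.N) x, Mem x (𝔐.ap (𝔐.ap W m) k) ↔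
      ∃ i : 𝔐.N, m ≤ i ∧ i ≤ k ∧ Mem x (𝔐.ap A i) := fun m k x => by
    rw [hW, ap_lam, ap_lam, mem_bigUnion]; rfl
  obtain ⟨F, hF⟩ := exists_seq (P := fun m k₀ : 𝔐.N => ∀ k, k₀ ≤ k →
    Rle (prob (𝔐.ap (𝔐.ap W m) k)) (prob (𝔐.ap (𝔐.ap W m) k₀)) (e2 (v + m + 1)))
    fun m => exists_pr_sup _ _
  obtain ⟨L₀, hL₀⟩ := exists_bound F (𝔐.ap M F)
  set L := L₀ + 𝔐.ap M F with hL
  obtain ⟨D, hD⟩ := exists_lam (fun m : 𝔐.N => 𝔐.ap (𝔐.ap W m) (𝔐.ap F m))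
  refine ⟨L, F, fun I hI hIv => ?_⟩
  -- The errors 2^(-(v+i+1)) for i ≤ k add up to 2^(-v) - 2^(-(v+k+1)). The sum is carried in closed
  -- form, since k may be nonstandard and the claim must be definable.
  have key : ∀ k : 𝔐.N, k ≤ 𝔐.ap M F → Rle (prob (𝔐.ap A L))
      (prob (inter (𝔐.ap A L) (interUpTo D k))) (e2 v - e2 (v + k + 1)) := by
    have step : ∀ k : 𝔐.N, k ≤ 𝔐.ap M F →
        (∀ x, Mem x (𝔐.ap A L) → Mem x (𝔐.ap (𝔐.ap W k) L)) ∧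
        (∀ x, Mem x (𝔐.ap D k) → Mem x (𝔐.ap (𝔐.ap W k) L)) ∧
        Rle (prob (𝔐.ap (𝔐.ap W k) L)) (prob (𝔐.ap D k)) (e2 (v + k + 1)) := fun k hk => by
      have hFL := (hL₀ k hk).trans (le_self_add : L₀ ≤ L)
      refine ⟨fun x hx => (memW _ _ _).2 ⟨L, hk.trans le_add_self, le_rfl, hx⟩, fun x hx => ?_, ?_⟩
      · rw [hD, memW] at hx
        obtain ⟨i, h1, h2, h⟩ := hx
        exact (memW _ _ _).2 ⟨i, h1, h2.trans hFL, h⟩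
      · rw [hD]
        exact hF k L hFL
    intro k
    induction k using induction with
    | isDef => infer_instance
    | zero =>
      intro h0 n
      obtain ⟨h1, h2, h3⟩ := step 0 h0
      have h4 := pr_inter_step (J := 𝔐.ap A L) (J' := inter (𝔐.ap A L) (interUpTo D 0))
        (fun x hx => hx) h1 h2 (fun x hx hd => mem_inter.2 ⟨hx, mem_interUpTo.2 fun i hi => by
          rwa [le_antisymm hi zero_le]⟩) h3 n
      have h5 : e2 v - e2 (v + 0 + 1) = e2 (v + 0 + 1) := by
        rw [add_zero]; linarith [e2_succ v]
      rw [h5]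
      exact h4
    | succ k ih =>
      intro hk n
      obtain ⟨h1, h2, h3⟩ := step _ hk
      have h0 := ih (le_self_add.trans hk) (n + 1)
      have h4 := pr_inter_step (J := inter (𝔐.ap A L) (interUpTo D k))
        (J' := inter (𝔐.ap A L) (interUpTo D (k + 1)))
        (fun x hx => (mem_inter.1 hx).1) h1 h2 (fun x hx hd => by
          rw [mem_inter, mem_interUpTo] at hx
          refine mem_inter.2 ⟨hx.1, mem_interUpTo.2 fun i hi => ?_⟩
          rcases hi.eq_or_lt with rfl | hi
          · exact hd
          · exact hx.2 i (lt_add_one_iff.1 hi)) h3 (n + 1)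
      have h5 : e2 v - e2 (v + (k + 1) + 1) = e2 v - e2 (v + k + 1) + e2 (v + (k + 1) + 1) := by
        have := e2_succ (v + k + 1)
        rw [← add_assoc]
        linarith
      rw [h5, toR_add]
      have h6 := eps_succ n
      simp only [pr] at h4
      linarith
  set w := v + 𝔐.ap M F + 1 with hw
  have h1 : pr (𝔐.ap A L) ≤ _ := key _ le_rfl (w + 1 + 1 + 1)
  rw [toR_sub] at h1
  have h2 := pr_mono (A := inter (𝔐.ap A L) (interUpTo D (𝔐.ap M F))) (B := I)
    (fun x hx => (hI x).2 fun m hm => by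
      have := mem_interUpTo.1 (mem_inter.1 hx).2 m hm
      rwa [hD, memW] at this) (w + 1 + 1 + 1)
  have h3 := hIv (w + 1 + 1 + 1)
  have h4 := eps_anti (lt_iff_add_one_le.1 huv)
  have h5 := eps_succ u
  have h6 := eps_succ w
  have h7 := eps_succ (w + 1)
  have h9 := eps_succ (w + 1 + 1)
  have h10 := eps_pos (w + 1 + 1)
  have h8 : toR (e2 v) - toR (e2 w) = eps v - eps w := rfl
  rw [← hw, h8] at h1
  rw [pr] at h2
  -- The geometric sum misses 2^(-v) by 2^(-w). The three approximate inequalities and the required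
  -- margin cost 4 · 2^(-(w+3)) = 2^(-(w+1)), which is less.
  exact ⟨w + 1 + 1 + 1, by linarith⟩

end Model

open Model Str in
theorem proves_combinatorialSentence : Proves combinatorialSentence := by
  refine proves_of_models _ fun 𝔐 => ?_
  intro A M u v huv
  have huv' : (u : 𝔐.N) < v := by simpa using huv
  obtain ⟨n, F, h⟩ := exists_pr_lt A M huv'
  refine ⟨n, fun hF => ?_⟩
  set e : 𝔐.Env _ := Env.cons F (Env.cons n (Env.cons v (Env.cons u (Env.cons M
    (Env.cons A Env.nil))))) with he
  set t := Term.bigInter (Γ := [Ty.one, Ty.nat, Ty.nat, Ty.nat, Ty.one ⇒ Ty.nat, Ty.nat ⇒ Ty.ev])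
    (Term.lam (Term.bigUnion (Term.wk (Term.wk Term.v4)) Term.v0 (Term.app Term.v1 Term.v0)))
      Term.zero (Term.app Term.v4 Term.v0) with ht
  have hF' : ∀ j, pr (tm e t) ≤ eps v + eps j := fun j => by
    have := (sat_rLe e (Term.prob t) (Term.rPow Term.v2)).1 (hF F) j
    rwa [val_rPow] at this
  have hI : ∀ x, Mem x (tm e t) ↔
      ∀ m : 𝔐.N, m ≤ 𝔐.ap M F → ∃ i : 𝔐.N, m ≤ i ∧ i ≤ 𝔐.ap F m ∧ Mem x (𝔐.ap A i) := fun x => by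
    rw [ht, mem_bigInter]
    simp only [ap_lam, mem_bigUnion, tm_wk, tm_zero, tm_app, tm_var]
    exact ⟨fun H m hm => H m zero_le hm, fun H m _ hm => H m hm⟩
  obtain ⟨j, hj⟩ := h (tm e t) hI hF'
  rw [sat_rLt]
  refine ⟨j, ?_⟩
  rw [val_rPow]
  exact hj

/-! ### Computable functionals -/

/-- Computations are deterministic; for an application of `Y` the tabulated function is itself
determined pointwise. Hence any output of an index equals a value already exhibited for it. -/
theorem Computes.unique {Y : (ℕ → ℕ) → ℕ} {e x y : ℕ} (h : Computes Y e x y) :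
    ∀ {y' : ℕ}, Computes Y e x y' → y' = y := by
  induction h with
  | zero x | succ x | left x | right x =>
    intro y' h'
    generalize he : Nat.pair _ 0 = e at h'
    cases h' <;> simp [Nat.pair_eq_pair] at he
    rfl
  | pair _ _ ih₁ ih₂ =>
    intro y' h'
    generalize he : Nat.pair 4 _ = e at h'
    cases h' <;> simp [Nat.pair_eq_pair] at he
    next h₁ h₂ =>
      obtain ⟨rfl, rfl⟩ := he
      rw [ih₁ h₁, ih₂ h₂]
  | comp _ _ ih₁ ih₂ =>
    intro y' h'
    generalize he : Nat.pair 5 _ = e at h'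
    cases h' <;> simp [Nat.pair_eq_pair] at he
    next h₁ h₂ =>
      obtain ⟨rfl, rfl⟩ := he
      rw [ih₁ h₁] at h₂
      exact ih₂ h₂
  | prec_zero _ ih =>
    intro y' h'
    generalize he : Nat.pair 6 _ = e at h'
    generalize hx : Nat.pair _ 0 = x at h'
    cases h' <;> simp [Nat.pair_eq_pair] at he hx
    next h₁ =>
      obtain ⟨rfl, rfl⟩ := he
      subst hx
      exact ih h₁
  | prec_succ _ _ ih₁ ih₂ =>
    intro y' h'
    generalize he : Nat.pair 6 _ = e at h'
    generalize hx : Nat.pair _ (_ + 1) = x at h'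
    cases h' <;> simp [Nat.pair_eq_pair] at he hx
    next h₁ h₂ =>
      obtain ⟨rfl, rfl⟩ := he
      obtain ⟨rfl, rfl⟩ := hx
      rw [ih₁ h₁] at h₂
      exact ih₂ h₂
  | call f _ ih =>
    intro y' h'
    generalize he : Nat.pair 7 _ = e at h'
    cases h' <;> simp [Nat.pair_eq_pair] at he
    next f' h₁ =>
      subst he
      rw [show f' = f from funext fun n => ih n (h₁ n)]
  | eval _ ih =>
    intro y' h'
    generalize he : Nat.pair 8 0 = e at h'
    generalize hx : Nat.pair _ _ = x at h'
    cases h' <;> simp [Nat.pair_eq_pair] at he hx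
    next h₁ =>
      obtain ⟨rfl, rfl⟩ := hx
      exact ih h₁
  | find g _ _ ih₁ ih₂ =>
    intro y' h'
    generalize he : Nat.pair 9 _ = e at h'
    cases h' <;> simp [Nat.pair_eq_pair] at he
    next n g' h₁ h₂ =>
      subst he
      rcases lt_trichotomy y' _ with h | h | h
      · exact absurd (ih₁ _ h h₂) (by simp)
      · exact h
      · exact absurd (ih₂ (h₁ _ h)) (by simp)

theorem Computes.of_natPrimrec {f : ℕ → ℕ} (hf : Nat.Primrec f) :
    ∃ c, ∀ Y x, Computes Y c x (f x) := by
  induction hf with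
  | zero => exact ⟨_, fun Y x => .zero x⟩
  | succ => exact ⟨_, fun Y x => .succ x⟩
  | left => exact ⟨_, fun Y x => .left x⟩
  | right => exact ⟨_, fun Y x => .right x⟩
  | pair _ _ ihf ihg =>
    obtain ⟨c, hc⟩ := ihf
    obtain ⟨d, hd⟩ := ihg
    exact ⟨_, fun Y x => .pair (hc Y x) (hd Y x)⟩
  | comp _ _ ihf ihg =>
    obtain ⟨c, hc⟩ := ihf
    obtain ⟨d, hd⟩ := ihg
    exact ⟨_, fun Y x => .comp (hd Y x) (hc Y _)⟩
  | prec _ _ ihf ihg =>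
    obtain ⟨c, hc⟩ := ihf
    obtain ⟨d, hd⟩ := ihg
    refine ⟨Nat.pair 6 (Nat.pair c d), fun Y x => ?_⟩
    rw [← Nat.pair_unpair x]
    generalize x.unpair.1 = a
    generalize x.unpair.2 = n
    simp only [Nat.unpaired, Nat.unpair_pair]
    induction n with
    | zero => exact .prec_zero (hc Y a)
    | succ n ih => exact .prec_succ ih (hd Y _)

/-- Primitive recursive functions are computable; tuples are coded by the pairing function. -/
theorem Computes.of_primrec {f : ℕ → ℕ} (hf : Primrec f) :
    ∃ c, ∀ Y x, Computes Y c x (f x) := of_natPrimrec (Primrec.nat_iff.1 hf)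

/-! ### A bar recursive functional -/

/-- The function that runs through the stack `s` from the bottom to the top, and then remains
constant. -/
def stackFun (s : List ℕ) (i : ℕ) : ℕ := s.getD (s.length - 1 - i) 0

/-- The number of recursive calls at the stack `s`. -/
def calls (v y l : ℕ) : ℕ := if y < l then 0 else 2 ^ (v + l + 1)

/-- The graph of the functional. -/
inductive BarValue (Y : (ℕ → ℕ) → ℕ) (v : ℕ) : List ℕ → ℕ → Prop
  | intro (s : List ℕ) (g h : ℕ → ℕ) (h0 : g 0 = max (s.headI) s.length)
      (hg : ∀ i < calls v (Y (stackFun s)) s.length, g (i + 1) = max (g i) (h i))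
      (hh : ∀ i < calls v (Y (stackFun s)) s.length, BarValue Y v (g i :: s) (h i)) :
      BarValue Y v s (g (calls v (Y (stackFun s)) s.length))

theorem stackFun_mono {s : List ℕ} (hs : s.Pairwise (· ≥ ·)) : Monotone (stackFun s) := by
  intro i j hij
  rcases s with _ | ⟨a, s⟩
  · simp [stackFun]
  · have hi : (a :: s).length - 1 - i < (a :: s).length := by rw [List.length_cons]; omega
    have hj : (a :: s).length - 1 - j < (a :: s).length := by rw [List.length_cons]; omega
    rw [stackFun, stackFun, List.getD_eq_getElem _ _ hi, List.getD_eq_getElem _ _ hj]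
    rcases (show (a :: s).length - 1 - j ≤ (a :: s).length - 1 - i by omega).eq_or_lt with h | h
    · simp only [h, le_refl]
    · exact List.pairwise_iff_getElem.1 hs _ _ hj hi h

theorem maj1_self {f : ℕ → ℕ} (hf : Monotone f) : Maj1 f f := fun _ _ h => ⟨hf h, hf h⟩

/-- Bar induction in which majorizability replaces continuity. If the empty stack had no value, an
infinite branch of increasing stacks without value would exist. A majorant of `Y`, evaluated at that
branch, bounds `Y` on all nonempty initial segments, yet a stack longer than this bound needs no
recursive calls. -/
theorem exists_barValue {Y : (ℕ → ℕ) → ℕ} (hY : ∃ Z, Maj2 Z Y) (v : ℕ) :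
    ∃ k, BarValue Y v [] k := by
  obtain ⟨Z, hZ⟩ := hY
  by_contra hnil
  let Bad : List ℕ → Prop := fun s => s.Pairwise (· ≥ ·) ∧ ¬ ∃ k, BarValue Y v s k
  have hcalls : ∀ s, Bad s → calls v (Y (stackFun s)) s.length ≠ 0 := by
    rintro s ⟨-, hs⟩ h0
    exact hs ⟨_, .intro s (fun _ => max (s.headI) s.length) id rfl
      (fun i hi => by omega) fun i hi => by omega⟩
  have step : ∀ s : {s // Bad s}, ∃ x, Bad (x :: s.1) := by
    rintro ⟨s, hs, hns⟩
    by_contra! H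
    -- Entries not below the head keep the stack monotone, and only such entries occur in the
    -- recursion.
    have H' : ∀ x, s.headI ≤ x → ∃ k, BarValue Y v (x :: s) k := fun x hx => by
      by_contra hk
      refine H x ⟨List.pairwise_cons.2 ⟨fun y hy => ?_, hs⟩, hk⟩
      rcases s with _ | ⟨a, s⟩
      · simp at hy
      · rcases List.mem_cons.1 hy with rfl | hy
        · exact hx
        · exact ((List.pairwise_cons.1 hs).1 y hy).trans hx
    choose! h hh using H'
    let g : ℕ → ℕ := fun n => Nat.rec (max (s.headI) s.length) (fun _ k => max k (h k)) n
    have hg : ∀ n, s.headI ≤ g n := fun n => by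
      induction n with
      | zero => exact le_max_left _ _
      | succ n ih => exact ih.trans (le_max_left _ _)
    exact hns ⟨_, .intro s g (fun i => h (g i)) rfl (fun _ _ => rfl) fun i _ => hh _ (hg i)⟩
  choose f hf using step
  obtain ⟨α, st, hst0, hst, hbad⟩ : ∃ (α : ℕ → ℕ) (st : ℕ → List ℕ),
      st 0 = [] ∧ (∀ n, st (n + 1) = α n :: st n) ∧ ∀ n, Bad (st n) := by
    let st : ℕ → {s // Bad s} := fun n =>
      Nat.rec ⟨[], List.Pairwise.nil, hnil⟩ (fun _ s => ⟨f s :: s.1, hf s⟩) n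
    exact ⟨fun n => f (st n), fun n => (st n).1, rfl, fun _ => rfl, fun n => (st n).2⟩
  have hlen : ∀ n, (st n).length = n := fun n => by
    induction n with
    | zero => rw [hst0, List.length_nil]
    | succ n ih => rw [hst, List.length_cons, ih]
  have hfun : ∀ n i, i ≤ n → stackFun (st (n + 1)) i = α i := fun n i hi => by
    induction n with
    | zero =>
      obtain rfl : i = 0 := by omega
      rw [stackFun, hst, hst0]
      rfl
    | succ n ih =>
      rcases hi.eq_or_lt with rfl | hi
      · simp [stackFun, hst, hlen]
      · rw [← ih (by omega), stackFun, stackFun, hlen, hlen, hst (n + 1),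
          show n + 1 + 1 - 1 - i = (n + 1 - 1 - i) + 1 by omega, List.getD_cons_succ]
  have hmono : Monotone α := fun i j hij => by
    have := stackFun_mono (hbad (j + 1)).1 hij
    rwa [hfun j i hij, hfun j j le_rfl] at this
  -- A finite stack follows the branch up to n and then stays constant, so the monotone branch
  -- majorizes it.
  have hmaj : ∀ n, Maj1 α (stackFun (st (n + 1))) := fun n i j hji => by
    refine ⟨?_, hmono hji⟩
    rcases le_total j n with h | h
    · rw [hfun n j h]; exact hmono hji
    · have h1 : stackFun (st (n + 1)) j = stackFun (st (n + 1)) n := by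
        simp only [stackFun, hlen]
        congr 1
        omega
      rw [h1, hfun n n le_rfl]
      exact hmono (h.trans hji)
  -- At length `Z α + 1` the value of `Y` is at most `Z α`, so the stopping condition holds.
  have h1 := (hZ _ _ (hmaj (Z α))).1
  have h2 := hcalls _ (hbad (Z α + 1))
  rw [calls, hlen, if_pos (by omega)] at h2
  exact h2 rfl

open Computes in
/-- An index for the functional with graph `BarValue`. -/
theorem exists_index_barValue : ∃ e, ∀ (Y : (ℕ → ℕ) → ℕ) (u v k : ℕ), BarValue Y v [] k →
    Computes Y e (Nat.pair u v) k := by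
  -- inputs have the form `pair c (pair (encode s) v)`, where `c` is the index itself
  let stk : ℕ → List ℕ := fun x => (Encodable.decode (α := List ℕ) x.unpair.2.unpair.1).getD []
  have stk_eq : ∀ c s v, stk (Nat.pair c (Nat.pair (Encodable.encode s) v)) = s := by simp [stk]
  have pfst : Primrec fun x : ℕ => x.unpair.1 := Primrec.fst.comp Primrec.unpair
  have psnd : Primrec fun x : ℕ => x.unpair.2 := Primrec.snd.comp Primrec.unpair
  have pstk : Primrec stk := Primrec.option_getD.comp
    ((Primrec.decode (α := List ℕ)).comp (pfst.comp psnd)) (Primrec.const [])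
  have plen : Primrec fun x => (stk x).length := Primrec.list_length.comp pstk
  obtain ⟨cFun, hFun⟩ := of_primrec (f := fun x => stackFun (stk x.unpair.1) x.unpair.2) <| by
    refine (Primrec.list_getD 0).comp (pstk.comp pfst) ?_
    exact Primrec.nat_sub.comp (Primrec.nat_sub.comp (plen.comp pfst) (Primrec.const 1)) psnd
  obtain ⟨cCalls, hCalls⟩ := of_primrec
      (f := fun x => calls x.unpair.1.unpair.2.unpair.2 x.unpair.2 (stk x.unpair.1).length) <| by
    have hv : Primrec fun x : ℕ => x.unpair.1.unpair.2.unpair.2 :=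
      psnd.comp (psnd.comp pfst)
    have hl := plen.comp pfst
    exact (Primrec.ite (Primrec.nat_lt.comp psnd hl) (Primrec.const 0)
      ((Primrec₂.unpaired'.1 Nat.Primrec.pow).comp (Primrec.const 2)
        (Primrec.succ.comp (Primrec.nat_add.comp hv hl)))).of_eq fun x => by
          simp only [calls]
  obtain ⟨cBase, hBase⟩ := of_primrec (f := fun x => max ((stk x).headI) (stk x).length) <| by
    exact Primrec.nat_max.comp (Primrec.list_headI.comp pstk) plen
  -- The index occurs twice: once as the program to be evaluated and once inside the new input, so
  -- that the callee can call itself again. This self-application replaces the recursion theorem.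
  obtain ⟨cArg, hArg⟩ := of_primrec (f := fun x => Nat.pair x.unpair.1.unpair.1
      (Nat.pair x.unpair.1.unpair.1 (Nat.pair
        (Encodable.encode (x.unpair.2.unpair.2 :: stk x.unpair.1))
        x.unpair.1.unpair.2.unpair.2))) <| by
    have hc := pfst.comp pfst
    exact Primrec₂.natPair.comp hc (Primrec₂.natPair.comp hc (Primrec₂.natPair.comp
      (Primrec.encode.comp (Primrec.list_cons.comp (psnd.comp psnd) (pstk.comp pfst)))
      (psnd.comp (psnd.comp pfst))))
  obtain ⟨cMax, hMax⟩ := of_primrec (f := fun x => max x.unpair.1 x.unpair.2)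
    (Primrec.nat_max.comp pfst psnd)
  obtain ⟨cAcc, hAcc⟩ := of_primrec (f := fun x => x.unpair.2.unpair.2) (psnd.comp psnd)
  obtain ⟨cId, hId⟩ := of_primrec (f := fun x => x) Primrec.id
  -- One round of the loop: the maximum of the accumulator and the recursive value at the stack
  -- extended by the accumulator.
  let cStep : ℕ := Nat.pair 5 (Nat.pair cMax (Nat.pair 4 (Nat.pair cAcc
    (Nat.pair 5 (Nat.pair (Nat.pair 8 0) cArg)))))
  -- Primitive recursion over `cStep`, run for the number of rounds obtained by applying `Y` to the
  -- stack function.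
  let cBar : ℕ := Nat.pair 5 (Nat.pair (Nat.pair 6 (Nat.pair cBase cStep))
    (Nat.pair 4 (Nat.pair cId (Nat.pair 5 (Nat.pair cCalls
      (Nat.pair 4 (Nat.pair cId (Nat.pair 7 cFun))))))))
  have key : ∀ (Y : (ℕ → ℕ) → ℕ) (v : ℕ) (s : List ℕ) (k : ℕ), BarValue Y v s k →
      Computes Y cBar (Nat.pair cBar (Nat.pair (Encodable.encode s) v)) k := by
    intro Y v s k hk
    induction hk with
    | intro s g h h0 hg _ ih =>
      set x := Nat.pair cBar (Nat.pair (Encodable.encode s) v) with hx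
      have hs : stk x = s := stk_eq _ _ _
      have hcall : Computes Y (Nat.pair 7 cFun) x (Y (stackFun s)) := .call _ fun n => by
        simpa [hs] using hFun Y (Nat.pair x n)
      have hn : Computes Y _ x (calls v (Y (stackFun s)) s.length) :=
        .comp (.pair (hId Y x) hcall)
          (by simpa [hs, hx, stk_eq] using hCalls Y (Nat.pair x (Y (stackFun s))))
      refine .comp (.pair (hId Y x) hn) ?_
      have hiter : ∀ i ≤ calls v (Y (stackFun s)) s.length,
          Computes Y (Nat.pair 6 (Nat.pair cBase cStep)) (Nat.pair x i) (g i) := by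
        intro i hi
        induction i with
        | zero =>
          rw [h0]
          exact .prec_zero (by simpa [hs] using hBase Y x)
        | succ i ihi =>
          refine .prec_succ (ihi (by omega)) ?_
          rw [hg i (by omega)]
          have harg := hArg Y (Nat.pair x (Nat.pair i (g i)))
          simp only [Nat.unpair_pair, hs] at harg
          simp only [hx, Nat.unpair_pair] at harg
          have hacc := hAcc Y (Nat.pair x (Nat.pair i (g i)))
          simp only [Nat.unpair_pair] at hacc
          have hmax := hMax Y (Nat.pair (g i) (h i))
          simp only [Nat.unpair_pair] at hmax
          exact .comp (.pair hacc (.comp harg (.eval (ih i (by omega))))) hmax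
      exact hiter _ le_rfl
  obtain ⟨cStart, hStart⟩ := of_primrec
    (f := fun x => Nat.pair cBar (Nat.pair (Encodable.encode ([] : List ℕ)) x.unpair.2)) <|
    Primrec₂.natPair.comp (Primrec.const _) (Primrec₂.natPair.comp (Primrec.const _) psnd)
  exact ⟨Nat.pair 5 (Nat.pair cBar cStart), fun Y u v k hk =>
    .comp (by simpa using hStart Y (Nat.pair u v)) (key Y v [] k hk)⟩

open MeasureTheory

/-! ### Contents -/

section
variable {Ω : Type*} {S : Set (Set Ω)} {P : AddContent ENNReal S} {A : ℕ → Set Ω}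

theorem biUnion_Icc_mem (hS : IsSetAlgebra S) (hA : ∀ i, A i ∈ S) (m k : ℕ) :
    ⋃ j ∈ Set.Icc m k, A j ∈ S := by
  have := hS.biUnion_mem (Finset.Icc m k) (s := A) fun i _ => hA i
  simpa using this

theorem biInter_Icc_mem (hS : IsSetAlgebra S) (hA : ∀ i, A i ∈ S) (m k : ℕ) :
    ⋂ j ∈ Set.Icc m k, A j ∈ S := by
  have := hS.biInter_mem (Finset.Icc m k) (s := A) fun i _ => hA i
  simpa using this

theorem biUnion_Icc_subset {m k l : ℕ} (h : k ≤ l) :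
    ⋃ j ∈ Set.Icc m k, A j ⊆ ⋃ j ∈ Set.Icc m l, A j :=
  Set.biUnion_subset_biUnion_left fun _ hj => ⟨hj.1, hj.2.trans h⟩

theorem content_mono (hS : IsSetAlgebra S) {s t : Set Ω} (hs : s ∈ S) (ht : t ∈ S) (h : s ⊆ t) :
    P s ≤ P t := addContent_mono hS.isSetRing.isSetSemiring hs ht h

theorem content_le_one (hS : IsSetAlgebra S) (hP : P Set.univ = 1) {s : Set Ω} (hs : s ∈ S) :
    P s ≤ 1 := hP ▸ content_mono hS hs hS.univ_mem (Set.subset_univ s)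

/-- The sets `J \ D` and `D` are disjoint and lie in `C`, so `J \ D` has content at most `q` after
cancelling `P D`, which is finite. -/
theorem content_le_inter_add (hS : IsSetAlgebra S) (hP : P Set.univ = 1) {J D C : Set Ω}
    {q : ENNReal} (hJ : J ∈ S) (hD : D ∈ S) (hC : C ∈ S) (hJC : J ⊆ C) (hDC : D ⊆ C)
    (h : P C ≤ P D + q) : P J ≤ P (J ∩ D) + q := by
  have hJD := hS.sdiff_mem hJ hD
  have h1 : P (J \ D) + P D ≤ q + P D := by
    rw [← addContent_union hS.isSetRing hJD hD Set.disjoint_sdiff_left, add_comm q]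
    exact (content_mono hS (hS.union_mem hJD hD) hC
      (Set.union_subset (Set.sdiff_subset.trans hJC) hDC)).trans h
  have hfin : P D ≠ ⊤ := ((content_le_one hS hP hD).trans_lt ENNReal.one_lt_top).ne
  have h2 : P (J \ D) ≤ q := (ENNReal.add_le_add_iff_right hfin).1 h1
  calc P J = P ((J ∩ D) ∪ (J \ D)) := by rw [Set.inter_union_sdiff]
    _ = P (J ∩ D) + P (J \ D) := addContent_union hS.isSetRing (hS.inter_mem hJ hD) hJD
        (Set.disjoint_sdiff_right.mono_left Set.inter_subset_right)
    _ ≤ P (J ∩ D) + q := by gcongr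

theorem two_inv_pow_succ_add (n : ℕ) :
    (2⁻¹ : ENNReal) ^ (n + 1) + 2⁻¹ ^ (n + 1) = 2⁻¹ ^ n := by
  rw [← two_mul, pow_succ, mul_comm, mul_assoc, ENNReal.inv_mul_cancel two_ne_zero (by simp),
    mul_one]

theorem two_inv_pow_ne_top (n : ℕ) : (2⁻¹ : ENNReal) ^ n ≠ ⊤ := by simp

theorem two_inv_pow_pos (n : ℕ) : 0 < (2⁻¹ : ENNReal) ^ n := ENNReal.pow_pos (by simp) n

theorem sum_two_inv_pow (v k : ℕ) :
    ∑ m ∈ Finset.range k, (2⁻¹ : ENNReal) ^ (v + m + 1) + 2⁻¹ ^ (v + k) = 2⁻¹ ^ v := by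
  induction k with
  | zero => simp
  | succ k ih =>
    rw [Finset.sum_range_succ, add_assoc, ← add_assoc v, two_inv_pow_succ_add, ih]

/-- If the unions `⋃_{j = m}^{F m} A j` exhaust `⋃_{j = m}^{L} A j` up to small events for all
`m ≤ N ≤ L`, and their intersection is small, then `A L` is small. -/
theorem content_lt (hS : IsSetAlgebra S) (hP : P Set.univ = 1) (hA : ∀ i, A i ∈ S)
    {F : ℕ → ℕ} {N L u v : ℕ} (huv : u < v) (hFL : ∀ m ≤ N, F m ≤ L) (hNL : N ≤ L)
    (h : ∀ m ≤ N, P (⋃ j ∈ Set.Icc m L, A j) ≤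
      P (⋃ j ∈ Set.Icc m (F m), A j) + 2⁻¹ ^ (v + m + 1))
    (hI : P (⋂ m ∈ Set.Icc 0 N, ⋃ j ∈ Set.Icc m (F m), A j) ≤ 2⁻¹ ^ v) :
    P (A L) < 2⁻¹ ^ u := by
  set D : ℕ → Set Ω := fun m => ⋃ j ∈ Set.Icc m (F m), A j with hDdef
  have hD : ∀ m, D m ∈ S := fun m => biUnion_Icc_mem hS hA m (F m)
  let J : ℕ → Set Ω := fun k => A L ∩ ⋂ m ∈ Finset.range k, D m
  have hJ : ∀ k, J k ∈ S := fun k => hS.inter_mem (hA L) (hS.biInter_mem _ fun m _ => hD m)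
  have key : ∀ k ≤ N + 1, P (A L) ≤ P (J k) + ∑ m ∈ Finset.range k, 2⁻¹ ^ (v + m + 1) := by
    intro k hk
    induction k with
    | zero => simp [J]
    | succ k ih =>
      have h1 := content_le_inter_add hS hP (hJ k) (hD k) (biUnion_Icc_mem hS hA k L)
        (Set.inter_subset_left.trans (Set.subset_biUnion_of_mem (u := A)
          (show L ∈ Set.Icc k L from ⟨by omega, le_rfl⟩)))
        (biUnion_Icc_subset (hFL k (by omega))) (h k (by omega))
      have h2 : J k ∩ D k = J (k + 1) := by
        simp only [J, Finset.range_add_one, Finset.set_biInter_insert]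
        rw [Set.inter_assoc, Set.inter_comm (D k)]
      rw [h2] at h1
      calc P (A L) ≤ P (J k) + ∑ m ∈ Finset.range k, 2⁻¹ ^ (v + m + 1) := ih (by omega)
        _ ≤ P (J (k + 1)) + 2⁻¹ ^ (v + k + 1) + ∑ m ∈ Finset.range k, 2⁻¹ ^ (v + m + 1) := by
          gcongr
        _ = _ := by rw [Finset.sum_range_succ]; ring
  have hJI : P (J (N + 1)) ≤ 2⁻¹ ^ v := by
    refine (content_mono hS (hJ _) (biInter_Icc_mem hS hD 0 N) fun x hx => ?_).trans hI
    simp only [J, Set.mem_inter_iff, Set.mem_iInter, Finset.mem_range] at hx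
    simp only [Set.mem_iInter, Set.mem_Icc]
    exact fun m hm => hx.2 m (by omega)
  -- The finite geometric sum falls short of 2^(-v) by its last term; the strictness of the
  -- conclusion comes from here.
  have hsum : ∑ m ∈ Finset.range (N + 1), (2⁻¹ : ENNReal) ^ (v + m + 1) < 2⁻¹ ^ v := by
    have h1 := sum_two_inv_pow v (N + 1)
    rw [← h1]
    refine ENNReal.lt_add_right ?_ (two_inv_pow_pos _).ne'
    exact ne_top_of_le_ne_top (two_inv_pow_ne_top v) (h1 ▸ le_self_add)
  calc P (A L) ≤ P (J (N + 1)) + ∑ m ∈ Finset.range (N + 1), 2⁻¹ ^ (v + m + 1) := key _ le_rfl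
    _ < 2⁻¹ ^ v + 2⁻¹ ^ v := ENNReal.add_lt_add_of_le_of_lt
        (ne_top_of_le_ne_top (two_inv_pow_ne_top v) hJI) hJI hsum
    _ ≤ 2⁻¹ ^ (u + 1) + 2⁻¹ ^ (u + 1) := by
        have := pow_le_pow_right_of_le_one' (a := (2⁻¹ : ENNReal)) (by simp) huv
        simp only [Nat.succ_eq_add_one] at this
        gcongr
    _ = 2⁻¹ ^ u := two_inv_pow_succ_add u

theorem exists_content_le_add (hS : IsSetAlgebra S) (hP : P Set.univ = 1) (hA : ∀ i, A i ∈ S)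
    (m : ℕ) {q : ENNReal} (hq : q ≠ 0) : ∃ k₀, ∀ k,
      P (⋃ j ∈ Set.Icc m k, A j) ≤ P (⋃ j ∈ Set.Icc m k₀, A j) + q := by
  set s := ⨆ k, P (⋃ j ∈ Set.Icc m k, A j) with hs
  have hfin : s ≠ ⊤ := ne_top_of_le_ne_top ENNReal.one_ne_top
    (iSup_le fun k => content_le_one hS hP (biUnion_Icc_mem hS hA m k))
  have h : ∃ k₀, s ≤ P (⋃ j ∈ Set.Icc m k₀, A j) + q := by
    by_contra! H
    refine (ENNReal.lt_add_right hfin hq).not_ge ?_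
    nth_rw 1 [hs]
    rw [ENNReal.iSup_add]
    exact iSup_le fun k => (H k).le
  obtain ⟨k₀, hk₀⟩ := h
  exact ⟨k₀, fun k => (le_iSup (fun k => P (⋃ j ∈ Set.Icc m k, A j)) k).trans hk₀⟩

/-- The function `F` consists of near-maximisers of the unions, one for each m; the index dominates
`M F` and all `F m` with m ≤ `M F`. -/
theorem exists_content_lt (hS : IsSetAlgebra S) (hP : P Set.univ = 1) (hA : ∀ i, A i ∈ S)
    (M : (ℕ → ℕ) → ℕ) {u v : ℕ} (huv : u < v) : ∃ n : ℕ,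
      (∀ F : ℕ → ℕ, P (⋂ m ∈ Set.Icc 0 (M F), ⋃ j ∈ Set.Icc m (F m), A j) ≤ 2⁻¹ ^ v) →
      P (A n) < 2⁻¹ ^ u := by
  choose F hF using fun m =>
    exists_content_le_add hS hP hA m (two_inv_pow_pos (v + m + 1)).ne'
  refine ⟨(Finset.range (M F + 1)).sup F + M F, fun h => ?_⟩
  refine content_lt hS hP hA huv (fun m hm => ?_) (Nat.le_add_left _ _) (fun m _ => hF m _) (h F)
  exact (Finset.le_sup (f := F) (Finset.mem_range.2 (by omega))).trans (Nat.le_add_right _ _)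

/-- Pigeonhole: 2^l successive increases, each larger than 2^(-l), would push a content above 1. -/
theorem exists_content_step (hS : IsSetAlgebra S) (hP : P Set.univ = 1) (hA : ∀ i, A i ∈ S)
    (m l : ℕ) (g : ℕ → ℕ) : ∃ i < 2 ^ l,
      P (⋃ j ∈ Set.Icc m (g (i + 1)), A j) ≤ P (⋃ j ∈ Set.Icc m (g i), A j) + 2⁻¹ ^ l := by
  by_contra! H
  have key : ∀ i ≤ 2 ^ l, i * (2⁻¹ : ENNReal) ^ l ≤ P (⋃ j ∈ Set.Icc m (g i), A j) := by
    intro i hi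
    induction i with
    | zero => simp
    | succ i ih =>
      refine le_trans ?_ (H i hi).le
      rw [Nat.cast_succ, add_mul, one_mul]
      gcongr
      exact ih (by omega)
  -- At the last step, T = 2^l - 1, the lower bound T · 2^(-l) and one more strict increase exceed
  -- 1.
  obtain ⟨T, hT⟩ : ∃ T, 2 ^ l = T + 1 := Nat.exists_eq_succ_of_ne_zero (by positivity)
  have h1 := H T (by omega)
  refine (h1.trans_le (content_le_one hS hP (biUnion_Icc_mem hS hA _ _))).not_ge ?_
  calc (1 : ENNReal) = ((2 ^ l : ℕ) : ENNReal) * 2⁻¹ ^ l := by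
        rw [Nat.cast_pow, ← mul_pow, Nat.cast_ofNat, ENNReal.mul_inv_cancel two_ne_zero (by simp),
          one_pow]
    _ = T * 2⁻¹ ^ l + 2⁻¹ ^ l := by rw [hT, Nat.cast_succ, add_mul, one_mul]
    _ ≤ _ := by
      gcongr
      exact key T (by omega)

/-! ### Correctness of the bar recursive bound -/

theorem stackFun_le_headI {s : List ℕ} (hs : s.Pairwise (· ≥ ·)) (i : ℕ) :
    stackFun s i ≤ s.headI := by
  refine (stackFun_mono hs (show i ≤ s.length - 1 + i by omega)).trans (le_of_eq ?_)
  rw [stackFun, show s.length - 1 - (s.length - 1 + i) = 0 by omega]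
  cases s <;> rfl

theorem stackFun_cons_length (x : ℕ) (s : List ℕ) : stackFun (x :: s) s.length = x := by
  simp [stackFun]

theorem stackFun_cons_of_lt (x : ℕ) {s : List ℕ} {i : ℕ} (hi : i < s.length) :
    stackFun (x :: s) i = stackFun s i := by
  rw [stackFun, stackFun, List.length_cons,
    show s.length + 1 - 1 - i = (s.length - 1 - i) + 1 by omega, List.getD_cons_succ]

/-- Induction along the recursion with the invariant `hPs`: each stack entry is a good value of F(m)
as far as the returned number k. The entries need to be good only up to k, and k is in turn computed
from them; the repeated trials resolve this circularity. -/
theorem BarValue.exists_content_lt (hS : IsSetAlgebra S) (hP : P Set.univ = 1)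
    (hA : ∀ i, A i ∈ S) {M Y : (ℕ → ℕ) → ℕ} (hY : Maj2 Y M) {u v : ℕ} (huv : u < v)
    {s : List ℕ} {k : ℕ} (hk : BarValue Y v s k) (hs : s.Pairwise (· ≥ ·))
    (hPs : ∀ m < s.length, P (⋃ j ∈ Set.Icc m k, A j) ≤
      P (⋃ j ∈ Set.Icc m (stackFun s m), A j) + 2⁻¹ ^ (v + m + 1)) : ∃ n ≤ k,
      (∀ F : ℕ → ℕ, P (⋂ m ∈ Set.Icc 0 (M F), ⋃ j ∈ Set.Icc m (F m), A j) ≤ 2⁻¹ ^ v) →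
      P (A n) < 2⁻¹ ^ u := by
  induction hk with
  | intro s g h h0 hg _ ih =>
    have hMY := (hY _ _ (maj1_self (stackFun_mono hs))).1
    by_cases hlt : Y (stackFun s) < s.length
    · have hc : calls v (Y (stackFun s)) s.length = 0 := if_pos hlt
      rw [hc, h0] at hPs ⊢
      -- At a leaf the function is `stackFun s` itself. By monotonicity of the stack `M` of it is at
      -- most `Y` of it, hence below the length of the stack, so the invariant covers every m that
      -- matters. The returned maximum of head and length dominates both the entries and `M`.
      refine ⟨_, le_rfl, fun hF => content_lt hS hP hA huv (fun m _ => ?_) ?_ (fun m hm => ?_)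
        (hF (stackFun s))⟩
      · exact (stackFun_le_headI hs m).trans (le_max_left _ _)
      · exact (hMY.trans hlt.le).trans (le_max_right _ _)
      · exact hPs m (by omega)
    · have hc : calls v (Y (stackFun s)) s.length = 2 ^ (v + s.length + 1) := if_neg hlt
      rw [hc] at hg ih hPs ⊢
      have hmono : ∀ i j, i ≤ j → j ≤ 2 ^ (v + s.length + 1) → g i ≤ g j := by
        intro i j hij hj
        induction j, hij using Nat.le_induction with
        | base => exact le_rfl
        | succ j _ ihj =>
          rw [hg j (by omega)]
          exact (ihj (by omega)).trans (le_max_left _ _)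
      -- The number of rounds is chosen so that some round i increases the union from `s.length` by
      -- at most the permitted error.
      obtain ⟨i, hi, hstep⟩ := exists_content_step hS hP hA s.length (v + s.length + 1) g
      have hh : h i ≤ g (i + 1) := by rw [hg i hi]; exact le_max_right _ _
      have hhk : h i ≤ g (2 ^ (v + s.length + 1)) := hh.trans (hmono _ _ hi le_rfl)
      have hUmono : ∀ {m k l : ℕ}, k ≤ l →
          P (⋃ j ∈ Set.Icc m k, A j) ≤ P (⋃ j ∈ Set.Icc m l, A j) := fun h =>
        content_mono hS (biUnion_Icc_mem hS hA _ _) (biUnion_Icc_mem hS hA _ _)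
          (biUnion_Icc_subset h)
      have hsort : (g i :: s).Pairwise (· ≥ ·) := List.pairwise_cons.2 ⟨fun y hy => by
        have hy' : y ≤ s.headI := by
          rcases s with _ | ⟨a, s⟩
          · simp at hy
          · rcases List.mem_cons.1 hy with rfl | hy
            · exact le_rfl
            · exact (List.pairwise_cons.1 hs).1 y hy
        calc y ≤ s.headI := hy'
          _ ≤ g 0 := h0 ▸ le_max_left _ _
          _ ≤ g i := hmono _ _ (Nat.zero_le _) hi.le, hs⟩
      -- The call in round i returns `h i`, at most `g (i + 1)`, so the new entry `g i` is good far
      -- enough. The old entries stay good because `h i` is at most the final value.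
      obtain ⟨n, hn, hn'⟩ := ih i hi hsort fun m hm => by
        rcases (Nat.lt_succ_iff.1 hm).eq_or_lt with rfl | hm
        · rw [stackFun_cons_length]
          exact (hUmono hh).trans hstep
        · rw [stackFun_cons_of_lt _ hm]
          exact (hUmono hhk).trans (hPs m hm)
      exact ⟨n, hn.trans hhk, hn'⟩

end

end ProofMining

/-! ### The main theorem -/

theorem mainTheorem3 :
    -- the formal system `F^ω[P]` proves the combinatorial sentence
    ProofMining.Proves ProofMining.combinatorialSentence ∧
    -- the result holds for all probability contents
    (∀ (Ω : Type*) (S : Set (Set Ω)) (_ : MeasureTheory.IsSetAlgebra S)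
        (P : MeasureTheory.AddContent ENNReal S) (_ : P Set.univ = 1)
        (A : ℕ → Set Ω) (_ : ∀ i, A i ∈ S) (M : (ℕ → ℕ) → ℕ) (u v : ℕ), u < v →
      ∃ n : ℕ,
        (∀ F : ℕ → ℕ,
          P (⋂ m ∈ Set.Icc 0 (M F), ⋃ j ∈ Set.Icc m (F m), A j) ≤ (2⁻¹ : ENNReal) ^ v) →
        P (A n) < (2⁻¹ : ENNReal) ^ u) ∧
    -- a computable bound on `n`, depending only on `u`, `v` and a majorant `Y` of `M`
    (∃ e : ℕ,
      (∀ Y : (ℕ → ℕ) → ℕ, (∃ Z, ProofMining.Maj2 Z Y) →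
        ∀ u v : ℕ, ∃ b : ℕ, ProofMining.Computes Y e (Nat.pair u v) b) ∧
      (∀ (Ω : Type*) (S : Set (Set Ω)) (_ : MeasureTheory.IsSetAlgebra S)
          (P : MeasureTheory.AddContent ENNReal S) (_ : P Set.univ = 1)
          (A : ℕ → Set Ω) (_ : ∀ i, A i ∈ S) (M Y : (ℕ → ℕ) → ℕ) (_ : ProofMining.Maj2 Y M)
          (u v b : ℕ), u < v → ProofMining.Computes Y e (Nat.pair u v) b →
        ∃ n ≤ b,
          (∀ F : ℕ → ℕ,
            P (⋂ m ∈ Set.Icc 0 (M F), ⋃ j ∈ Set.Icc m (F m), A j) ≤ (2⁻¹ : ENNReal) ^ v) →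
          P (A n) < (2⁻¹ : ENNReal) ^ u)) := by
  refine ⟨ProofMining.proves_combinatorialSentence, ?_, ?_⟩
  · intro Ω S hS P hP A hA M u v huv
    exact ProofMining.exists_content_lt hS hP hA M huv
  · obtain ⟨e, he⟩ := ProofMining.exists_index_barValue
    refine ⟨e, fun Y hY u v => ?_, fun Ω S hS P hP A hA M Y hY u v b huv hb => ?_⟩
    · obtain ⟨k, hk⟩ := ProofMining.exists_barValue hY v
      exact ⟨k, he Y u v k hk⟩
    · obtain ⟨k, hk⟩ := ProofMining.exists_barValue ⟨Y, fun g f h =>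
        ⟨(hY g f h).2, (hY g f h).2⟩⟩ v
      obtain rfl := (he Y u v k hk).unique hb
      exact hk.exists_content_lt hS hP hA hY huv List.Pairwise.nil (by simp)
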